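/- Let $(X_1(t),\dots,X_{\mathtt n(t)}(t))_{t\ge 0}$ be binary branching Brownian motion on $\mathbb R$ started from one particle at $0$: each particle performs standard Brownian motion and, after an independent exponential lifetime of parameter $1$, splits at its current position into two particles that evolve in the same way, all lifetimes and Brownian motions being independent. The particles are indistinguishable: for each $t$ their positions are listed in such a way that on $\{\mathtt n(t)=n\}$ the law of $(X_1(t),\dots,X_n(t))$ is invariant under permutations. For $f:\mathbb R^k\to\mathbb R$ and $h:\mathbb R^m\to\mathbb R$ let $$(f\hat\otimes h)(y_1,\dots,y_{k+m})=\frac1{(k+m)!}\sum_{\sigma\in S_{k+m}}f(y_{\sigma(1)},\dots,y_{\sigma(k)})\,h(y_{\sigma(k+1)},\dots,y_{\sigma(k+m)}),$$ let $\mathtt p_t(x)=(2\pi t)^{-1/2}e^{-x^2/(2t)}$ for $t>0$, and define recursively $$g_1(t,x;y_1)=e^{-t}\,\mathtt p_t(x-y_1),\qquad g_n(t,x;y)=e^{-t}\int_0^t\int_{\mathbb R}\mathtt p_{t-s}(x-z)\,e^{s}\sum_{k=1}^{n-1}\bigl(g_k(s,z;\cdot)\,\hat\otimes\, g_{n-k}(s,z;\cdot)\bigr)(y)\,dz\,ds\quad(n\ge2).$$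 Then, for $n\ge 2$, $t\ge 0$, $x\in\mathbb R$, $y\in\mathbb R^n$, the last integral converges absolutely, and there are non-negative measurable functions $\rho_n(t,\cdot)$ on $\mathbb R^n$ ($n\ge1$, $t\ge 0$, with $t>0$ if $n=1$) such that the following hold. 1. (Density.) For all such $n,t$ and all Borel sets $A\subseteq\mathbb R^n$, $\mathbb P\bigl(\mathtt n(t)=n,\ (X_1(t),\dots,X_n(t))\in A\bigr)=\int_A\rho_n(t,y)\,dy$. 2. (Equations.) For all $n\ge1$, $t>0$, $y\in\mathbb R^n$, $$\partial_t\rho_n(t,y)=\tfrac12\Bigl(\sum_{k=1}^n\partial_{y_k}\Bigr)^2\rho_n(t,y)+\sum_{k=1}^{n-1}\bigl(\rho_k(t,\cdot)\hat\otimes\rho_{n-k}(t,\cdot)\bigr)(y)-\rho_n(t,y),$$ where $\bigl(\sum_k\partial_{y_k}\bigr)^2\rho_n(t,y)$ is the second derivative at $h=0$ of the $C^2$ function $h\mapsto\rho_n(t,y_1+h,\dots,y_n+h)$. If the coordinates of $y$ are pairwise distinct, then $\rho_n(t,\cdot)$ is $C^2$ near $y$ and this is the equation $$\partial_t\rho_n=\tfrac12\sum_{k,l=1}^n\partial^2_{y_ky_l}\rho_n+\sum_{k=1}^{n-1}\rho_k\hat\otimes\rho_{n-k}-\rho_n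 .$$ 3. (Initial conditions.) $\rho_1(0)=\delta_0$: the law of $X_1(0)$ on $\{\mathtt n(0)=1\}$ is the unit mass at $0$, and $\int\varphi(y)\rho_1(t,y)\,dy\to\varphi(0)$ as $t\downarrow0$ for every bounded continuous $\varphi$. For $n\ge2$, $\rho_n(0,\cdot)=0$ and $\int_{\mathbb R^n}\rho_n(t,y)\,dy\to0$ as $t\downarrow0$. 4. (Representation.) $\rho_n(t,y_1,\dots,y_n)=g_n(t,x;x-y_1,\dots,x-y_n)$ for all $x\in\mathbb R$, $y\in\mathbb R^n$, $n\ge1$ and $t\ge0$ ($t>0$ if $n=1$). -/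

import Mathlib

open MeasureTheory ProbabilityTheory Filter Topology
open scoped NNReal ENNReal BigOperators

namespace BBM

/-! ### The branching particle system

Particles are labelled by finite binary words: `[]` is the initial particle, and when the particle
`v` splits, its two children are `v ++ [false]` and `v ++ [true]`, so that the head of a word
records the first split. Here `τ v` is the lifetime of the particle `v`, and `B v s` is its
displacement from its place of birth at age `s`. -/

/-- The time at which the particle `v` is born: the sum of the lifetimes of its strict ancestors. -/
def birthTime : (List Bool → ℝ) → List Bool → ℝ
  | _, [] => 0
  | τ, b :: v => τ [] + birthTime (fun u => τ (b :: u)) v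

/-- The place at which the particle `v` is born: the sum of the total displacements of its strict
ancestors. -/
def birthPlace : (List Bool → ℝ) → (List Bool → ℝ≥0 → ℝ) → List Bool → ℝ
  | _, _, [] => 0
  | τ, B, b :: v =>
      B [] (τ []).toNNReal + birthPlace (fun u => τ (b :: u)) (fun u => B (b :: u)) v

/-- The particles that are alive at time `t`. -/
def alive (τ : List Bool → ℝ) (t : ℝ) : Set (List Bool) :=
  {v | birthTime τ v ≤ t ∧ t < birthTime τ v + τ v}

/-- The number of particles that are alive at time `t`. -/
noncomputable def count (τ : List Bool → ℝ) (t : ℝ) : ℕ := (alive τ t).ncard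

/-- The position at time `t` of a particle `v` that is alive at that time. -/
noncomputable def position (τ : List Bool → ℝ) (B : List Bool → ℝ≥0 → ℝ) (t : ℝ)
    (v : List Bool) : ℝ :=
  birthPlace τ B v + B v (t - birthTime τ v).toNNReal

variable {Ω : Type*} [MeasurableSpace Ω]

/-- The randomness that drives a binary branching Brownian motion with splitting rate one: the
lifetimes are exponential of parameter one, the displacements are standard Brownian motions, and
all of these are independent. -/
structure IsDriving (P : Measure Ω) (τ : List Bool → Ω → ℝ)
    (B : List Bool → ℝ≥0 → Ω → ℝ) : Prop where
  measurable_lifetime : ∀ v, Measurable (τ v)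
  measurable_motion : ∀ v s, Measurable (B v s)
  lifetime_law : ∀ v, HasLaw (τ v) (expMeasure 1) P
  brownian : ∀ v, IsBrownianReal (B v) P
  indep_lifetime_motion : ∀ v, IndepFun (τ v) (fun ω s => B v s ω) P
  indep_particles : iIndepFun (fun v ω => (τ v ω, fun s => B v s ω)) P

/-- The number `n(t)` of particles at time `t`, as a random variable. -/
noncomputable def particleCount (τ : List Bool → Ω → ℝ) (t : ℝ) (ω : Ω) : ℕ :=
  count (fun v => τ v ω) t

/-- The event that there are `n` particles at time `t` and that the vector of the first `n` entries
of `X t` lies in `A`. -/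
def positionEvent (τ : List Bool → Ω → ℝ) (X : ℝ → ℕ → Ω → ℝ) (n : ℕ) (t : ℝ)
    (A : Set (Fin n → ℝ)) : Set Ω :=
  {ω | particleCount τ t ω = n ∧ (fun i : Fin n => X t i ω) ∈ A}

/-- `X t 0, …, X t (n(t) - 1)` are the positions at time `t` of the particles of the branching
Brownian motion driven by `τ` and `B`, listed in an order that does not distinguish between the
particles: on `n(t) = n` all rearrangements of the list have the same law. -/
structure IsBranchingBrownianMotion (P : Measure Ω) (τ : List Bool → Ω → ℝ)
    (B : List Bool → ℝ≥0 → Ω → ℝ) (X : ℝ → ℕ → Ω → ℝ) : Prop where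
  driving : IsDriving P τ B
  measurable_position : ∀ t k, Measurable (X t k)
  enumerates : ∀ t, 0 ≤ t → ∀ᵐ ω ∂P, ∃ e : ℕ → List Bool,
    Set.BijOn e (Set.Iio (particleCount τ t ω)) (alive (fun v => τ v ω) t) ∧
    ∀ k < particleCount τ t ω,
      X t k ω = position (fun v => τ v ω) (fun v s => B v s ω) t (e k)
  exchangeable : ∀ t, 0 ≤ t → ∀ (n : ℕ) (σ : Equiv.Perm (Fin n)) (A : Set (Fin n → ℝ)),
    MeasurableSet A →
      P (positionEvent τ X n t {y | (fun i => y (σ i)) ∈ A}) = P (positionEvent τ X n t A)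

/-! ### The analytic objects -/

/-- The one-dimensional heat kernel `(2πt)^(-1/2) exp(-x²/(2t))`, for `t > 0`. -/
noncomputable def heatKernel (t x : ℝ) : ℝ :=
  (√(2 * Real.pi * t))⁻¹ * Real.exp (-x ^ 2 / (2 * t))

/-- The symmetric tensor product of a function of `k` variables and a function of `m` variables:
the average over all permutations of the `n = k + m` variables of the tensor product. -/
noncomputable def symTensor {k m n : ℕ} (h : k + m = n) (f : (Fin k → ℝ) → ℝ)
    (f' : (Fin m → ℝ) → ℝ) (y : Fin n → ℝ) : ℝ :=
  ((n.factorial : ℝ))⁻¹ * ∑ σ : Equiv.Perm (Fin n),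
    f (fun i => y (σ (Fin.cast h (Fin.castAdd m i)))) *
      f' (fun j => y (σ (Fin.cast h (Fin.natAdd k j))))

/-- The sum over `1 ≤ k ≤ n - 1` of the symmetric tensor products of `a k` and `a (n - k)`. -/
noncomputable def symTensorSum (a : (k : ℕ) → (Fin k → ℝ) → ℝ) (n : ℕ) (y : Fin n → ℝ) : ℝ :=
  ∑ k : Fin (n - 1),
    symTensor (show (k + 1 : ℕ) + (n - (k + 1)) = n by have := k.isLt; omega)
      (a (k + 1)) (a (n - (k + 1))) y

/-- The functions `g n t x y` given by the recursion against the heat kernel (for `n ≥ 1`; the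
value for `n = 0` is a placeholder). -/
noncomputable def g : (n : ℕ) → ℝ → ℝ → (Fin n → ℝ) → ℝ
  | 0 => fun _ _ _ => 0
  | 1 => fun t x y => Real.exp (-t) * heatKernel t (x - y 0)
  | n + 2 => fun t x y =>
      Real.exp (-t) * ∫ s in (0 : ℝ)..t, ∫ z : ℝ,
        heatKernel (t - s) (x - z) * Real.exp s *
          ∑ k : Fin (n + 1),
            symTensor (show (k + 1 : ℕ) + (n + 2 - (k + 1)) = n + 2 by have := k.isLt; omega)
              (g (k + 1) s z) (g (n + 2 - (k + 1)) s z) y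
termination_by n => n
decreasing_by
  all_goals
    have := k.isLt
    omega

/-- The partial derivative of `f` in the `k`-th variable. -/
noncomputable def partialDeriv {n : ℕ} (k : Fin n) (f : (Fin n → ℝ) → ℝ) (y : Fin n → ℝ) : ℝ :=
  lineDeriv ℝ f y (Pi.single k 1)

end BBM

namespace BBM

/-! ### The heat kernel -/

/-! The densities are `ρ_n(t, y) = g_n(t, 0; -y)`. The recursion for `g` sees only differences of
positions (`g_translate`), so the base point `0` may be replaced by any `x` after shifting `y`. It
remains to analyse `g` and to identify `ρ_n` with the law of the particles.

Analysis in `(t, x)`. For `n ≥ 2`, `e^t g_n` is the Duhamel integral of the source `e^s ∑ g_k ⊗̂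
g_{n-k}`. By induction `g_n(t, x; y) ≤ C p_t(x - y_i)` for every `i` and bounded times
(`exists_g_le`): in each product the factor containing `y_i` keeps its Gaussian, the other factor is
at most a constant times `s^(-1/2)`, which is integrable, and Gaussians convolve to Gaussians. This
gives absolute convergence. For regularity the time integral is cut at some `a` in `(0, t)`: early
sources meet a smooth bounded kernel, late sources are themselves `C²` in space, so that derivatives
can be put on the source (`isRegular_duhamel`). The result is the evolution equation for `g_n` with
the second derivative in `x`. Moving `x` is the same as moving all points of `y` together, so this
is the equation with `(∑ ∂_k)²`, and it holds at all `y`, coincidences included.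

Smoothness in separate coordinates. Derivatives in `y` of a single heat kernel cost negative powers
of `s`, which need not be integrable. If the points of `y` are at distance more than `δ`, however,
the two factors of a product are concentrated near different points, so their product gains a factor
`exp(-κ/s)` that absorbs every power (`HasGaussianBound.mul`). Hence `g_n` is `C²` at configurations
without coincidences (`exists_hasGaussianBound_g`), where `(∑ ∂_k)²` may be expanded.

Probability. For a test function `f`, let the weight be the product of `f` over the particles on the
event that there are `n` of them. Conditioning on the lifetime and displacement of the initial
particle splits the weight into products of weights of two independent copies (`weight_of_split`).
The functional `∫ ∏ f(y_i) ρ_n` obeys the same recursion by Tonelli (`generating_eq`), and both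
agree for one particle, so they agree for all `n ≥ 1` (`IsDriving.lintegral_weight`). Terms with an
empty subtree vanish because a living descendant exists almost surely, and an explosion has weight
zero, so it need not be excluded. Finally, product functions `∏ f(y_i)` determine a finite symmetric
measure (`symmetric_measure_ext`); exchangeability and the symmetry of `ρ_n` turn equality of
functionals into equality of laws. -/

lemma heatKernel_nonneg (t x : ℝ) : 0 ≤ heatKernel t x := by
  unfold heatKernel; positivity

lemma heatKernel_eq_gaussianPDFReal (t : ℝ≥0) (x : ℝ) :
    heatKernel t x = gaussianPDFReal 0 t x := by
  simp [heatKernel, gaussianPDFReal]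

@[fun_prop]
lemma measurable_heatKernel : Measurable (fun p : ℝ × ℝ => heatKernel p.1 p.2) := by
  unfold heatKernel; fun_prop

lemma heatKernel_le_zero {t : ℝ} (ht : 0 < t) (x : ℝ) :
    heatKernel t x ≤ (√t)⁻¹ := by
  unfold heatKernel
  have h1 : Real.exp (-x ^ 2 / (2 * t)) ≤ 1 := by
    rw [Real.exp_le_one_iff]
    apply div_nonpos_of_nonpos_of_nonneg <;> nlinarith [sq_nonneg x]
  have h2 : (√(2 * Real.pi * t))⁻¹ ≤ (√t)⁻¹ := by
    apply inv_anti₀ (by positivity)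
    apply Real.sqrt_le_sqrt
    nlinarith [Real.pi_gt_three]
  calc _ ≤ (√t)⁻¹ * 1 := mul_le_mul h2 h1 (by positivity) (by positivity)
    _ = _ := mul_one _

lemma integrable_heatKernel {t : ℝ} (ht : 0 < t) : Integrable (heatKernel t) := by
  have := integrable_gaussianPDFReal 0 ⟨t, ht.le⟩
  refine this.congr (Eventually.of_forall fun x => ?_)
  exact (heatKernel_eq_gaussianPDFReal ⟨t, ht.le⟩ x).symm

lemma integral_heatKernel {t : ℝ} (ht : 0 < t) : ∫ x, heatKernel t x = 1 := by
  have h : (⟨t, ht.le⟩ : ℝ≥0) ≠ 0 := by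
    intro h; exact ht.ne' (congrArg NNReal.toReal h)
  rw [← integral_gaussianPDFReal_eq_one 0 h]
  exact integral_congr_ae (Eventually.of_forall fun x =>
    heatKernel_eq_gaussianPDFReal ⟨t, ht.le⟩ x)

lemma integrable_heatKernel_sub {t : ℝ} (ht : 0 < t) (x : ℝ) :
    Integrable (fun z => heatKernel t (x - z)) :=
  (integrable_heatKernel ht).comp_sub_left x

lemma integral_heatKernel_sub {t : ℝ} (ht : 0 < t) (x : ℝ) :
    ∫ z, heatKernel t (x - z) = 1 := by
  rw [integral_sub_left_eq_self (heatKernel t) volume x, integral_heatKernel ht]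

/-- Completing the square in `z`: the second factor on the right is the density of a Brownian
bridge. Integrability and the semigroup property both follow by integrating it out. -/
lemma heatKernel_mul_heatKernel {a b : ℝ} (ha : 0 < a) (hb : 0 < b) (x y z : ℝ) :
    heatKernel a (x - z) * heatKernel b (z - y) =
      heatKernel (a + b) (x - y) *
        heatKernel (a * b / (a + b)) ((b * x + a * y) / (a + b) - z) := by
  have hab : 0 < a + b := by positivity
  unfold heatKernel
  have hs : (√(2 * Real.pi * a))⁻¹ * (√(2 * Real.pi * b))⁻¹ =
      (√(2 * Real.pi * (a + b)))⁻¹ * (√(2 * Real.pi * (a * b / (a + b))))⁻¹ := by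
    rw [← mul_inv, ← mul_inv, ← Real.sqrt_mul (by positivity), ← Real.sqrt_mul (by positivity)]
    congr 2
    field_simp
  have he : Real.exp (-(x - z) ^ 2 / (2 * a)) * Real.exp (-(z - y) ^ 2 / (2 * b)) =
      Real.exp (-(x - y) ^ 2 / (2 * (a + b))) *
        Real.exp (-((b * x + a * y) / (a + b) - z) ^ 2 / (2 * (a * b / (a + b)))) := by
    rw [← Real.exp_add, ← Real.exp_add]
    congr 1
    field_simp
    ring
  calc _ = ((√(2 * Real.pi * a))⁻¹ * (√(2 * Real.pi * b))⁻¹) *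
      (Real.exp (-(x - z) ^ 2 / (2 * a)) * Real.exp (-(z - y) ^ 2 / (2 * b))) := by ring
    _ = _ := by rw [hs, he]; ring

lemma integrable_heatKernel_mul_heatKernel {a b : ℝ} (ha : 0 < a) (hb : 0 < b) (x y : ℝ) :
    Integrable (fun z => heatKernel a (x - z) * heatKernel b (z - y)) := by
  simp_rw [heatKernel_mul_heatKernel ha hb]
  exact (integrable_heatKernel_sub (by positivity) _).const_mul _

lemma integral_heatKernel_mul_heatKernel {a b : ℝ} (ha : 0 < a) (hb : 0 < b) (x y : ℝ) :
    ∫ z, heatKernel a (x - z) * heatKernel b (z - y) = heatKernel (a + b) (x - y) := by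
  simp_rw [heatKernel_mul_heatKernel ha hb]
  rw [integral_const_mul, integral_heatKernel_sub (by positivity), mul_one]

/-! ### Duhamel integrals -/

/-- The solution operator of the inhomogeneous heat equation with zero initial condition. -/
noncomputable def duhamel (F : ℝ → ℝ → ℝ) (t x : ℝ) : ℝ :=
  ∫ s in (0 : ℝ)..t, ∫ z : ℝ, heatKernel (t - s) (x - z) * F s z

lemma integrableOn_inv_sqrt (t : ℝ) : IntegrableOn (fun s : ℝ => (√s)⁻¹) (Set.Ioc 0 t) := by
  rcases le_or_gt t 0 with ht | ht
  · simp [Set.Ioc_eq_empty (not_lt.2 ht)]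
  have h : IntervalIntegrable (fun s : ℝ => s ^ (-(1 / 2) : ℝ)) volume 0 t :=
    intervalIntegral.intervalIntegrable_rpow' (by norm_num)
  rw [intervalIntegrable_iff_integrableOn_Ioc_of_le ht.le] at h
  refine h.congr_fun (fun s hs => ?_) measurableSet_Ioc
  simp only
  rw [Real.rpow_neg hs.1.le, Real.sqrt_eq_rpow]

/-- A source term dominated by an integrable-in-time multiple of the heat kernel. -/
structure IsTame (F : ℝ → ℝ → ℝ) (y : ℝ) : Prop where
  measurable : Measurable (Function.uncurry F)
  bound : ∀ T : ℝ, 0 < T → ∃ C : ℝ, 0 ≤ C ∧ ∀ s, 0 < s → s ≤ T → ∀ z,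
    |F s z| ≤ C * (√s)⁻¹ * heatKernel s (z - y)

lemma prod_volume_restrict (t : ℝ) :
    (volume : Measure (ℝ × ℝ)).restrict (Set.Ioc 0 t ×ˢ Set.univ) =
      (volume.restrict (Set.Ioc 0 t)).prod volume := by
  rw [Measure.volume_eq_prod, ← Measure.prod_restrict, Measure.restrict_univ]

lemma IsTame.norm_le {F : ℝ → ℝ → ℝ} {y C T : ℝ} (hC : ∀ s, 0 < s → s ≤ T → ∀ z,
    |F s z| ≤ C * (√s)⁻¹ * heatKernel s (z - y)) {t : ℝ} (htT : t ≤ T) {s : ℝ} (hs : 0 < s)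
    (hst : s ≤ t) (x z : ℝ) :
    ‖heatKernel (t - s) (x - z) * F s z‖ ≤
      C * (√s)⁻¹ * (heatKernel (t - s) (x - z) * heatKernel s (z - y)) := by
  rw [norm_mul, Real.norm_of_nonneg (heatKernel_nonneg _ _), Real.norm_eq_abs]
  calc _ ≤ heatKernel (t - s) (x - z) * (C * (√s)⁻¹ * heatKernel s (z - y)) :=
        mul_le_mul_of_nonneg_left (hC s hs (hst.trans htT) z) (heatKernel_nonneg _ _)
    _ = _ := by ring

lemma IsTame.integrable_slice {F : ℝ → ℝ → ℝ} {y : ℝ} (hF : IsTame F y) {t s : ℝ}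
    (hs : 0 < s) (hst : s < t) (x : ℝ) :
    Integrable (fun z => heatKernel (t - s) (x - z) * F s z) := by
  obtain ⟨C, hC0, hC⟩ := hF.bound t (hs.trans hst)
  refine Integrable.mono' ((integrable_heatKernel_mul_heatKernel (sub_pos.2 hst) hs x y).const_mul
    (C * (√s)⁻¹)) ?_ (Eventually.of_forall fun z => IsTame.norm_le hC le_rfl hs hst.le x z)
  apply Measurable.aestronglyMeasurable
  have h1 : Measurable fun z => F s z := hF.measurable.comp measurable_prodMk_left
  have h2 : Measurable fun z => heatKernel (t - s) (x - z) :=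
    measurable_heatKernel.comp (measurable_const.prodMk (by fun_prop))
  exact h2.mul h1

/-- By the semigroup property the kernels of durations `t - s` and `s` combine to `p_t(x - y)`,
which no longer depends on `s`; only `s^(-1/2)` is left for the time integral. -/
lemma IsTame.integral_norm_slice_le {F : ℝ → ℝ → ℝ} {y C T : ℝ}
    (hC : ∀ s, 0 < s → s ≤ T → ∀ z, |F s z| ≤ C * (√s)⁻¹ * heatKernel s (z - y)) {t s : ℝ}
    (htT : t ≤ T) (hs : 0 < s) (hst : s < t) (x : ℝ) :
    ∫ z, ‖heatKernel (t - s) (x - z) * F s z‖ ≤ C * (√s)⁻¹ * heatKernel t (x - y) := by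
  have := integral_mono_of_nonneg (μ := volume)
    (Eventually.of_forall fun z => norm_nonneg (heatKernel (t - s) (x - z) * F s z))
    ((integrable_heatKernel_mul_heatKernel (sub_pos.2 hst) hs x y).const_mul (C * (√s)⁻¹))
    (Eventually.of_forall fun z => IsTame.norm_le hC htT hs hst.le x z)
  rwa [integral_const_mul, integral_heatKernel_mul_heatKernel (sub_pos.2 hst) hs,
    sub_add_cancel] at this

lemma IsTame.measurable_integrand {F : ℝ → ℝ → ℝ} {y : ℝ} (hF : IsTame F y) (t x : ℝ) :
    Measurable (fun q : ℝ × ℝ => heatKernel (t - q.1) (x - q.2) * F q.1 q.2) := by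
  have h2 : Measurable fun q : ℝ × ℝ => heatKernel (t - q.1) (x - q.2) :=
    measurable_heatKernel.comp (by fun_prop : Measurable fun q : ℝ × ℝ => (t - q.1, x - q.2))
  exact h2.mul hF.measurable

/-- The endpoint `s = t` has to be discarded since `heatKernel 0` is the zero function and not a
unit mass. -/
lemma ae_restrict_Ioc_lt (t : ℝ) : ∀ᵐ s ∂(volume.restrict (Set.Ioc 0 t)), 0 < s ∧ s < t := by
  have h : ∀ᵐ s ∂(volume : Measure ℝ), s ≠ t := by
    simp [ae_iff, measure_singleton]
  filter_upwards [ae_restrict_mem measurableSet_Ioc, ae_restrict_of_ae h] with s hs hs'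
  exact ⟨hs.1, lt_of_le_of_ne hs.2 hs'⟩

lemma IsTame.integrable {F : ℝ → ℝ → ℝ} {y : ℝ} (hF : IsTame F y) (t x : ℝ) :
    Integrable (fun q : ℝ × ℝ => heatKernel (t - q.1) (x - q.2) * F q.1 q.2)
      ((volume.restrict (Set.Ioc 0 t)).prod volume) := by
  rcases le_or_gt t 0 with ht | ht
  · simp [Set.Ioc_eq_empty (not_lt.2 ht)]
  obtain ⟨C, hC0, hC⟩ := hF.bound t ht
  rw [integrable_prod_iff (hF.measurable_integrand t x).aestronglyMeasurable]
  constructor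
  · filter_upwards [ae_restrict_Ioc_lt t] with s hs
    exact hF.integrable_slice hs.1 hs.2 x
  · refine Integrable.mono' (g := fun s => C * (√s)⁻¹ * heatKernel t (x - y)) ?_ ?_ ?_
    · exact ((integrableOn_inv_sqrt t).const_mul C).mul_const _
    · exact (hF.measurable_integrand t x).norm.stronglyMeasurable.integral_prod_right'.aestronglyMeasurable
    · filter_upwards [ae_restrict_Ioc_lt t] with s hs
      rw [Real.norm_of_nonneg (integral_nonneg fun _ => norm_nonneg _)]
      exact IsTame.integral_norm_slice_le hC le_rfl hs.1 hs.2 x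

lemma IsTame.duhamel_eq {F : ℝ → ℝ → ℝ} {y : ℝ} (hF : IsTame F y) {t : ℝ} (ht : 0 ≤ t) (x : ℝ) :
    duhamel F t x = ∫ q, heatKernel (t - q.1) (x - q.2) * F q.1 q.2
      ∂((volume.restrict (Set.Ioc 0 t)).prod volume) := by
  rw [integral_prod _ (hF.integrable t x), duhamel, intervalIntegral.integral_of_le ht]

/-- The Gaussian that dominates the source is handed on to the Duhamel integral, with a constant
uniform up to time `T`. This closes the induction that bounds `g`. -/
lemma abs_duhamel_le {F : ℝ → ℝ → ℝ} {y C T : ℝ} (hC0 : 0 ≤ C)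
    (hC : ∀ s, 0 < s → s ≤ T → ∀ z, |F s z| ≤ C * (√s)⁻¹ * heatKernel s (z - y)) {t : ℝ}
    (ht : 0 < t) (htT : t ≤ T) (x : ℝ) :
    |duhamel F t x| ≤ (C * ∫ s in Set.Ioc 0 T, (√s)⁻¹) * heatKernel t (x - y) := by
  rw [duhamel, intervalIntegral.integral_of_le ht.le]
  have h1 : ‖∫ s in Set.Ioc 0 t, ∫ z : ℝ, heatKernel (t - s) (x - z) * F s z‖ ≤
      ∫ s in Set.Ioc 0 t, C * heatKernel t (x - y) * (√s)⁻¹ := by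
    refine norm_integral_le_of_norm_le ((integrableOn_inv_sqrt t).const_mul _) ?_
    filter_upwards [ae_restrict_Ioc_lt t] with s hs
    calc _ ≤ _ := norm_integral_le_integral_norm _
      _ ≤ _ := IsTame.integral_norm_slice_le hC htT hs.1 hs.2 x
      _ = _ := by ring
  refine h1.trans ?_
  rw [integral_const_mul]
  have h2 : ∫ s in Set.Ioc 0 t, (√s)⁻¹ ≤ ∫ s in Set.Ioc 0 T, (√s)⁻¹ :=
    setIntegral_mono_set (integrableOn_inv_sqrt T) (Eventually.of_forall fun s => by positivity)
      (Set.Ioc_subset_Ioc_right htT).eventuallyLE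
  have h3 := mul_le_mul_of_nonneg_left h2 (mul_nonneg hC0 (heatKernel_nonneg t (x - y)))
  linarith

/-- Integrability of the source without the kernel; it provides the dominating function for early
times, where the kernel and its derivatives are bounded. -/
lemma IsTame.integrable_source {F : ℝ → ℝ → ℝ} {y : ℝ} (hF : IsTame F y) (t : ℝ) :
    Integrable (Function.uncurry F) ((volume.restrict (Set.Ioc 0 t)).prod volume) := by
  rcases le_or_gt t 0 with ht | ht
  · simp [Set.Ioc_eq_empty (not_lt.2 ht)]
  obtain ⟨C, hC0, hC⟩ := hF.bound t ht
  have hk : ∀ s, 0 < s → Integrable fun z => C * (√s)⁻¹ * heatKernel s (z - y) := fun s hs =>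
    ((integrable_heatKernel hs).comp_sub_right y).const_mul _
  have hm : ∀ s, Measurable fun z => F s z := fun s => hF.measurable.comp measurable_prodMk_left
  rw [integrable_prod_iff hF.measurable.aestronglyMeasurable]
  constructor
  · filter_upwards [ae_restrict_Ioc_lt t] with s hs
    exact (hk s hs.1).mono' (hm s).aestronglyMeasurable
      (Eventually.of_forall fun z => hC s hs.1 hs.2.le z)
  · refine Integrable.mono' (g := fun s => C * (√s)⁻¹) ((integrableOn_inv_sqrt t).const_mul C) ?_ ?_
    · exact hF.measurable.norm.stronglyMeasurable.integral_prod_right'.aestronglyMeasurable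
    · filter_upwards [ae_restrict_Ioc_lt t] with s hs
      rw [Real.norm_of_nonneg (integral_nonneg fun _ => norm_nonneg _)]
      have := integral_mono_of_nonneg (μ := volume)
        (Eventually.of_forall fun z => norm_nonneg (F s z)) (hk s hs.1)
        (Eventually.of_forall fun z => hC s hs.1 hs.2.le z)
      rwa [integral_const_mul, integral_sub_right_eq_self (heatKernel s) y,
        integral_heatKernel hs.1, mul_one] at this

/-! ### Symmetric tensor products -/

lemma symTensor_perm {k m n : ℕ} (h : k + m = n) (f : (Fin k → ℝ) → ℝ)
    (f' : (Fin m → ℝ) → ℝ) (y : Fin n → ℝ) (π : Equiv.Perm (Fin n)) :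
    symTensor h f f' (fun i => y (π i)) = symTensor h f f' y := by
  unfold symTensor
  congr 1
  exact Fintype.sum_equiv (Equiv.mulLeft π) _ _ fun σ => rfl

lemma symTensorSum_perm (a : (k : ℕ) → (Fin k → ℝ) → ℝ) {n : ℕ} (y : Fin n → ℝ)
    (π : Equiv.Perm (Fin n)) :
    symTensorSum a n (fun i => y (π i)) = symTensorSum a n y :=
  Finset.sum_congr rfl fun _ _ => symTensor_perm _ _ _ _ _

/-- Only subconfigurations of `y` enter the sum, so agreement along index maps into `Fin n`
suffices. This lets translated or reflected configurations be compared factor by factor. -/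
lemma symTensorSum_congr {a b : (k : ℕ) → (Fin k → ℝ) → ℝ} {n : ℕ} {y y' : Fin n → ℝ}
    (h : ∀ k, 1 ≤ k → k < n → ∀ e : Fin k → Fin n,
      a k (fun i => y (e i)) = b k (fun i => y' (e i))) :
    symTensorSum a n y = symTensorSum b n y' := by
  refine Finset.sum_congr rfl fun k _ => ?_
  have := k.isLt
  unfold symTensor
  congr 1
  refine Finset.sum_congr rfl fun σ _ => ?_
  congr 1
  · exact h _ (by omega) (by omega) fun i => σ (Fin.cast _ (Fin.castAdd _ i))
  · exact h _ (by omega) (by omega) fun i => σ (Fin.cast _ (Fin.natAdd _ i))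

lemma symTensorSum_nonneg {a : (k : ℕ) → (Fin k → ℝ) → ℝ} {n : ℕ} {y : Fin n → ℝ}
    (h : ∀ k, 1 ≤ k → k < n → ∀ w, 0 ≤ a k w) : 0 ≤ symTensorSum a n y := by
  refine Finset.sum_nonneg fun k _ => ?_
  have := k.isLt
  unfold symTensor
  refine mul_nonneg (by positivity) (Finset.sum_nonneg fun σ _ => mul_nonneg ?_ ?_)
  · exact h _ (by omega) (by omega) _
  · exact h _ (by omega) (by omega) _

lemma symTensor_le {k m n : ℕ} (h : k + m = n) (f : (Fin k → ℝ) → ℝ) (f' : (Fin m → ℝ) → ℝ)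
    (y : Fin n → ℝ) {D : ℝ}
    (hD : ∀ σ : Equiv.Perm (Fin n), f (fun i => y (σ (Fin.cast h (Fin.castAdd m i)))) *
      f' (fun j => y (σ (Fin.cast h (Fin.natAdd k j)))) ≤ D) :
    symTensor h f f' y ≤ D := by
  unfold symTensor
  have h1 := Finset.sum_le_sum fun σ (_ : σ ∈ Finset.univ) => hD σ
  rw [Finset.sum_const, Finset.card_univ, Fintype.card_perm, Fintype.card_fin, nsmul_eq_mul] at h1
  rw [inv_mul_le_iff₀ (by positivity)]
  exact h1

/-- If all factors are dominated by a function of any single variable, then so is the sum of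
the symmetric tensor products. -/
lemma symTensorSum_le {a : (k : ℕ) → (Fin k → ℝ) → ℝ} {n : ℕ} {y : Fin n → ℝ} {A D : ℝ}
    {φ : ℝ → ℝ} (hA : 0 ≤ A) (hφD : ∀ r, φ r ≤ D) (hφ : ∀ r, 0 ≤ φ r)
    (h0 : ∀ k, 1 ≤ k → k < n → ∀ w, 0 ≤ a k w)
    (h : ∀ k, 1 ≤ k → k < n → ∀ w (i : Fin k), a k w ≤ A * φ (w i)) (j : Fin n) :
    symTensorSum a n y ≤ n * (A * D * (A * φ (y j))) := by
  have hD : 0 ≤ D := (hφ 0).trans (hφD 0)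
  have key : ∀ k : Fin (n - 1),
      symTensor (show (k + 1 : ℕ) + (n - (k + 1)) = n by have := k.isLt; omega)
      (a (k + 1)) (a (n - (k + 1))) y ≤ A * D * (A * φ (y j)) := by
    intro k
    have hk := k.isLt
    apply symTensor_le
    intro σ
    have hn : (k + 1 : ℕ) + (n - (k + 1)) = n := by omega
    -- The coordinate `j` lies in exactly one of the two factors. That factor keeps `φ (y j)`, the
    -- other one is bounded by `A * D`.
    obtain ⟨l, hl⟩ : ∃ l : Fin ((k + 1 : ℕ) + (n - (k + 1))), σ (Fin.cast hn l) = j :=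
      ⟨Fin.cast hn.symm (σ.symm j), by simp⟩
    have bd : ∀ m, 1 ≤ m → m < n → ∀ w, a m w ≤ A * D := fun m hm hm' w =>
      (h m hm hm' w ⟨0, hm⟩).trans (mul_le_mul_of_nonneg_left (hφD _) hA)
    induction l using Fin.addCases with
    | left i =>
      rw [mul_comm]
      refine mul_le_mul (bd _ (by omega) (by omega) _) ?_ (h0 _ (by omega) (by omega) _)
        (by positivity)
      have := h (k + 1) (by omega) (by omega)
        (fun i => y (σ (Fin.cast hn (Fin.castAdd (n - (k + 1)) i)))) i
      rwa [hl] at this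
    | right i =>
      refine mul_le_mul (bd _ (by omega) (by omega) _) ?_ (h0 _ (by omega) (by omega) _)
        (by positivity)
      have := h (n - (k + 1)) (by omega) (by omega)
        (fun i => y (σ (Fin.cast hn (Fin.natAdd (k + 1) i)))) i
      rwa [hl] at this
  calc symTensorSum a n y ≤ ∑ k : Fin (n - 1), A * D * (A * φ (y j)) :=
        Finset.sum_le_sum fun k _ => key k
    _ = (n - 1 : ℕ) * (A * D * (A * φ (y j))) := by simp
    _ ≤ _ := by
      have : ((n - 1 : ℕ) : ℝ) ≤ n := by exact_mod_cast Nat.sub_le _ _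
      exact mul_le_mul_of_nonneg_right this (mul_nonneg (mul_nonneg hA hD)
        (mul_nonneg hA (hφ _)))

lemma measurable_symTensorSum {α : Type*} [MeasurableSpace α] {n : ℕ}
    {a : (k : ℕ) → α → (Fin k → ℝ) → ℝ} {y : α → Fin n → ℝ} (hy : Measurable y)
    (ha : ∀ k, 1 ≤ k → k < n → Measurable (Function.uncurry (a k))) :
    Measurable (fun p => symTensorSum (fun k => a k p) n (y p)) := by
  unfold symTensorSum symTensor
  refine Finset.measurable_fun_sum _ fun k _ => Measurable.const_mul
    (Finset.measurable_fun_sum _ fun σ _ => Measurable.mul ?_ ?_) _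
  · have := k.isLt
    refine (ha _ (by omega) (by omega)).comp (measurable_id.prodMk ?_)
    exact measurable_pi_lambda _ fun i => (measurable_pi_apply _).comp hy
  · have := k.isLt
    refine (ha _ (by omega) (by omega)).comp (measurable_id.prodMk ?_)
    exact measurable_pi_lambda _ fun i => (measurable_pi_apply _).comp hy

/-! ### Basic properties of `g` -/

/-- The source term in the recursion for `g n`, as a function of time and space. -/
noncomputable def source (n : ℕ) (y : Fin n → ℝ) (s z : ℝ) : ℝ :=
  Real.exp s * symTensorSum (fun k => g k s z) n y

lemma g_zero (t x : ℝ) (y : Fin 0 → ℝ) : g 0 t x y = 0 := by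
  rw [g]

lemma g_one (t x : ℝ) (y : Fin 1 → ℝ) : g 1 t x y = Real.exp (-t) * heatKernel t (x - y 0) := by
  rw [g]

lemma g_eq_duhamel {n : ℕ} (hn : 2 ≤ n) (t x : ℝ) (y : Fin n → ℝ) :
    g n t x y = Real.exp (-t) * duhamel (source n y) t x := by
  obtain ⟨n, rfl⟩ := Nat.exists_eq_add_of_le' hn
  rw [g]
  unfold duhamel source symTensorSum
  simp only [mul_assoc]
  rfl

/-- The kernel sees only differences, so a shift of the integration variable `z` passes the
invariance through the recursion. -/
lemma g_translate (n : ℕ) (t x h : ℝ) (y : Fin n → ℝ) :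
    g n t (x + h) (fun i => y i + h) = g n t x y := by
  induction n using Nat.strong_induction_on generalizing t x with
  | _ n ih =>
    match n with
    | 0 => rw [g_zero, g_zero]
    | 1 => simp [g_one]
    | n + 2 =>
      rw [g_eq_duhamel (by omega), g_eq_duhamel (by omega)]
      congr 1
      refine intervalIntegral.integral_congr fun s _ => ?_
      rw [← integral_add_right_eq_self _ h]
      refine integral_congr_ae (Eventually.of_forall fun z => ?_)
      have h1 : source (n + 2) (fun i => y i + h) s (z + h) = source (n + 2) y s z := by
        unfold source
        rw [symTensorSum_congr fun k _ hk e => ih k hk s z fun i => y (e i)]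
      simp only [h1, add_sub_add_right_eq_sub]

lemma g_perm (n : ℕ) (t x : ℝ) (y : Fin n → ℝ) (π : Equiv.Perm (Fin n)) :
    g n t x (fun i => y (π i)) = g n t x y := by
  match n with
  | 0 => simp only [g_zero]
  | 1 => rw [Subsingleton.elim π 1]; rfl
  | n + 2 =>
    rw [g_eq_duhamel (by omega), g_eq_duhamel (by omega)]
    unfold source
    simp only [symTensorSum_perm]

lemma g_nonneg {n : ℕ} {t : ℝ} (ht : 0 ≤ t) (x : ℝ) (y : Fin n → ℝ) : 0 ≤ g n t x y := by
  induction n using Nat.strong_induction_on generalizing t x with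
  | _ n ih =>
    match n with
    | 0 => simp only [g_zero]; exact le_rfl
    | 1 => rw [g_one]; have := heatKernel_nonneg t (x - y 0); positivity
    | n + 2 =>
      rw [g_eq_duhamel (by omega)]
      refine mul_nonneg (Real.exp_pos _).le (intervalIntegral.integral_nonneg ht fun s hs => ?_)
      refine integral_nonneg fun z => mul_nonneg (heatKernel_nonneg _ _)
        (mul_nonneg (Real.exp_pos _).le (symTensorSum_nonneg fun k _ hk w => ih k hk hs.1 _ _))

lemma g_zero_time {n : ℕ} (hn : 2 ≤ n) (x : ℝ) (y : Fin n → ℝ) : g n 0 x y = 0 := by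
  rw [g_eq_duhamel hn, duhamel]; simp

lemma measurable_g (n : ℕ) :
    Measurable (fun p : (ℝ × ℝ) × (Fin n → ℝ) => g n p.1.1 p.1.2 p.2) := by
  induction n using Nat.strong_induction_on with
  | _ n ih =>
    match n with
    | 0 => simp only [g_zero]; exact measurable_const
    | 1 =>
      simp only [g_one]
      have : Measurable fun p : (ℝ × ℝ) × (Fin 1 → ℝ) => heatKernel p.1.1 (p.1.2 - p.2 0) :=
        measurable_heatKernel.comp
          (by fun_prop : Measurable fun p : (ℝ × ℝ) × (Fin 1 → ℝ) => (p.1.1, p.1.2 - p.2 0))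
      fun_prop
    | n + 2 =>
      simp only [g_eq_duhamel (show 2 ≤ n + 2 by omega)]
      have hS : Measurable fun q : (((ℝ × ℝ) × (Fin (n + 2) → ℝ)) × ℝ) × ℝ =>
          heatKernel (q.1.1.1.1 - q.1.2) (q.1.1.1.2 - q.2) * source (n + 2) q.1.1.2 q.1.2 q.2 := by
        refine Measurable.mul (measurable_heatKernel.comp (by fun_prop :
          Measurable fun q : (((ℝ × ℝ) × (Fin (n + 2) → ℝ)) × ℝ) × ℝ =>
            (q.1.1.1.1 - q.1.2, q.1.1.1.2 - q.2))) ?_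
        unfold source
        refine Measurable.mul (by fun_prop) ?_
        refine measurable_symTensorSum (a := fun k (q : (((ℝ × ℝ) × (Fin (n + 2) → ℝ)) × ℝ) × ℝ) =>
          g k q.1.2 q.2) (by fun_prop) fun k _ hk => ?_
        exact (ih k hk).comp (by fun_prop :
          Measurable fun q : ((((ℝ × ℝ) × (Fin (n + 2) → ℝ)) × ℝ) × ℝ) × (Fin k → ℝ) =>
            ((q.1.1.2, q.1.2), q.2))
      have hI : Measurable fun q : ((ℝ × ℝ) × (Fin (n + 2) → ℝ)) × ℝ =>
          ∫ z, heatKernel (q.1.1.1 - q.2) (q.1.1.2 - z) * source (n + 2) q.1.2 q.2 z :=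
        (hS.stronglyMeasurable.integral_prod_right' (ν := volume)).measurable
      refine Measurable.mul (by fun_prop) ?_
      unfold duhamel intervalIntegral
      refine Measurable.sub ?_ ?_
      -- The limits of integration depend on the parameter, so the interval is moved into the
      -- integrand as an indicator.
      · simp_rw [← integral_indicator measurableSet_Ioc]
        refine (StronglyMeasurable.integral_prod_right (Measurable.stronglyMeasurable ?_)).measurable
        refine Measurable.ite (p := fun q : ((ℝ × ℝ) × (Fin (n + 2) → ℝ)) × ℝ =>
          q.2 ∈ Set.Ioc 0 q.1.1.1) ?_ hI measurable_const
        exact (measurableSet_lt measurable_const measurable_snd).inter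
          (measurableSet_le measurable_snd (by fun_prop))
      · simp_rw [← integral_indicator measurableSet_Ioc]
        refine (StronglyMeasurable.integral_prod_right (Measurable.stronglyMeasurable ?_)).measurable
        refine Measurable.ite (p := fun q : ((ℝ × ℝ) × (Fin (n + 2) → ℝ)) × ℝ =>
          q.2 ∈ Set.Ioc q.1.1.1 0) ?_ hI measurable_const
        exact (measurableSet_lt (by fun_prop) measurable_snd).inter
          (measurableSet_le measurable_snd measurable_const)

lemma measurable_source (n : ℕ) (y : Fin n → ℝ) : Measurable (Function.uncurry (source n y)) := by
  unfold source Function.uncurry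
  refine Measurable.mul (by fun_prop) ?_
  refine measurable_symTensorSum (a := fun k (q : ℝ × ℝ) => g k q.1 q.2) (by fun_prop)
    fun k _ _ => measurable_g k

lemma exists_abs_source_le {n : ℕ}
    (h : ∀ k, 1 ≤ k → k < n → ∀ T, 0 < T → ∃ C : ℝ, 0 ≤ C ∧ ∀ t, 0 < t → t ≤ T →
      ∀ x (w : Fin k → ℝ) i, g k t x w ≤ C * heatKernel t (x - w i)) :
    ∀ T : ℝ, 0 < T → ∃ C : ℝ, 0 ≤ C ∧ ∀ s, 0 < s → s ≤ T → ∀ (y : Fin n → ℝ) (j : Fin n) z,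
      |source n y s z| ≤ C * (√s)⁻¹ * heatKernel s (z - y j) := by
  intro T hT
  choose! C hC0 hC using h
  -- A common constant for all `k < n`. The absolute values are there because `C 0 T` is
  -- unconstrained.
  set A := ∑ k ∈ Finset.range n, |C k T| with hA
  have hA0 : 0 ≤ A := Finset.sum_nonneg fun _ _ => abs_nonneg _
  refine ⟨Real.exp T * (n * (A * A)), by positivity, fun s hs hsT y j z => ?_⟩
  have h0 : ∀ k, 1 ≤ k → k < n → ∀ w : Fin k → ℝ, 0 ≤ g k s z w := fun k _ _ w =>
    g_nonneg hs.le _ _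
  have hb := symTensorSum_le (a := fun k => g k s z) (y := y) (φ := fun r => heatKernel s (z - r))
    hA0 (D := (√s)⁻¹) (fun r => heatKernel_le_zero hs _) (fun r => heatKernel_nonneg _ _) h0
    (fun k hk1 hkn w i => (hC k hk1 hkn T hT s hs hsT z w i).trans
      (mul_le_mul_of_nonneg_right ((le_abs_self _).trans
        (Finset.single_le_sum (f := fun k => |C k T|) (fun _ _ => abs_nonneg _)
          (Finset.mem_range.2 hkn))) (heatKernel_nonneg _ _))) j
  have hs0 := symTensorSum_nonneg (y := y) h0
  rw [source, abs_of_nonneg (mul_nonneg (Real.exp_pos _).le hs0)]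
  calc _ ≤ Real.exp T * (n * (A * (√s)⁻¹ * (A * heatKernel s (z - y j)))) :=
        mul_le_mul (Real.exp_le_exp.2 hsT) hb hs0 (Real.exp_pos _).le
    _ = _ := by ring

/-- The bound must hold around every single point `y i`: the next step of the induction does not
know in advance which factor of a product will contain a given coordinate. -/
lemma exists_g_le {n : ℕ} (hn : 1 ≤ n) {T : ℝ} (hT : 0 < T) : ∃ C : ℝ, 0 ≤ C ∧ ∀ t, 0 < t → t ≤ T →
    ∀ x (y : Fin n → ℝ) i, g n t x y ≤ C * heatKernel t (x - y i) := by
  induction n using Nat.strong_induction_on generalizing T with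
  | _ n ih =>
    rcases hn.eq_or_lt with rfl | hn
    · refine ⟨1, zero_le_one, fun t ht _ x y i => ?_⟩
      rw [g_one, Subsingleton.elim i 0]
      exact mul_le_mul_of_nonneg_right (Real.exp_le_one_iff.2 (by linarith))
        (heatKernel_nonneg _ _)
    · have hI : 0 ≤ ∫ s in Set.Ioc 0 T, (√s)⁻¹ := integral_nonneg fun s => by positivity
      obtain ⟨C, hC0, hC⟩ := exists_abs_source_le
        (fun k hk hkn T hT => ih k hkn hk hT) T hT
      refine ⟨C * ∫ s in Set.Ioc 0 T, (√s)⁻¹, by positivity, fun t ht htT x y i => ?_⟩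
      have h1 := abs_duhamel_le hC0 (fun s hs hsT => hC s hs hsT y i) ht htT x
      have h4 : Real.exp (-t) ≤ 1 := Real.exp_le_one_iff.2 (by linarith)
      rw [g_eq_duhamel hn]
      calc _ ≤ Real.exp (-t) * |duhamel (source n y) t x| :=
            mul_le_mul_of_nonneg_left (le_abs_self _) (Real.exp_pos _).le
        _ ≤ 1 * |duhamel (source n y) t x| := mul_le_mul_of_nonneg_right h4 (abs_nonneg _)
        _ ≤ _ := by rwa [one_mul]

lemma isTame_source {n : ℕ} (y : Fin n → ℝ) (j : Fin n) : IsTame (source n y) (y j) where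
  measurable := measurable_source n y
  bound T hT := by
    obtain ⟨C, hC0, hC⟩ := exists_abs_source_le (fun k hk _ T hT => exists_g_le (n := k) hk hT) T hT
    exact ⟨C, hC0, fun s hs hsT z => hC s hs hsT y j z⟩

/-! ### Derivatives of the heat kernel -/

/-- The first space derivative of the heat kernel. -/
noncomputable def heatKernel₁ (t x : ℝ) : ℝ := -(x / t) * heatKernel t x

/-- The second space derivative of the heat kernel. -/
noncomputable def heatKernel₂ (t x : ℝ) : ℝ := (x ^ 2 / t ^ 2 - 1 / t) * heatKernel t x

lemma hasDerivAt_heatKernel (t x : ℝ) : HasDerivAt (heatKernel t) (heatKernel₁ t x) x := by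
  have h1 : HasDerivAt (fun x : ℝ => -x ^ 2 / (2 * t)) (-(x / t)) x := by
    have := ((hasDerivAt_pow 2 x).neg).div_const (2 * t)
    refine this.congr_deriv ?_
    rcases eq_or_ne t 0 with rfl | ht
    · simp
    · field_simp; simp
  have h2 := (h1.exp).const_mul (√(2 * Real.pi * t))⁻¹
  refine h2.congr_deriv ?_
  simp only [heatKernel₁, heatKernel]; ring

lemma hasDerivAt_heatKernel₁ (t x : ℝ) : HasDerivAt (heatKernel₁ t) (heatKernel₂ t x) x := by
  have h1 : HasDerivAt (fun x : ℝ => -(x / t)) (-(1 / t)) x := ((hasDerivAt_id x).div_const t).neg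
  refine (h1.mul (hasDerivAt_heatKernel t x)).congr_deriv ?_
  simp only [heatKernel₁, heatKernel₂]; ring

lemma hasDerivAt_heatKernel_time {t : ℝ} (ht : 0 < t) (x : ℝ) :
    HasDerivAt (fun t => heatKernel t x) (1 / 2 * heatKernel₂ t x) t := by
  have h0 : HasDerivAt (fun t : ℝ => 2 * Real.pi * t) (2 * Real.pi) t := by
    simpa using (hasDerivAt_id t).const_mul (2 * Real.pi)
  have hp : 0 < 2 * Real.pi * t := by positivity
  have h1 : HasDerivAt (fun t : ℝ => (√(2 * Real.pi * t))⁻¹)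
      (-(2 * Real.pi / (2 * √(2 * Real.pi * t))) / √(2 * Real.pi * t) ^ 2) t :=
    (h0.sqrt hp.ne').inv (Real.sqrt_pos.2 hp).ne'
  have h2 : HasDerivAt (fun t : ℝ => -x ^ 2 / (2 * t)) (x ^ 2 / (2 * t ^ 2)) t := by
    have h3 : HasDerivAt (fun t : ℝ => 2 * t) 2 t := by
      simpa using (hasDerivAt_id t).const_mul 2
    refine ((hasDerivAt_const t (-x ^ 2)).div h3 (by positivity)).congr_deriv ?_
    field_simp; ring
  refine (h1.mul h2.exp).congr_deriv ?_
  simp only [heatKernel₂, heatKernel]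
  rw [Real.sq_sqrt hp.le]
  have h4 : √(2 * Real.pi * t) ≠ 0 := (Real.sqrt_pos.2 hp).ne'
  field_simp
  ring

@[fun_prop]
lemma measurable_heatKernel₁ : Measurable (fun p : ℝ × ℝ => heatKernel₁ p.1 p.2) := by
  unfold heatKernel₁; fun_prop

@[fun_prop]
lemma measurable_heatKernel₂ : Measurable (fun p : ℝ × ℝ => heatKernel₂ p.1 p.2) := by
  unfold heatKernel₂; fun_prop

lemma continuousAt_heatKernel {t : ℝ} (ht : 0 < t) (x : ℝ) :
    ContinuousAt (Function.uncurry heatKernel) (t, x) := by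
  have hp : 0 < 2 * Real.pi * t := by positivity
  unfold heatKernel Function.uncurry
  refine ContinuousAt.mul (ContinuousAt.inv₀ (by fun_prop) (Real.sqrt_pos.2 hp).ne')
    (ContinuousAt.rexp (ContinuousAt.div (by fun_prop) (by fun_prop) ?_))
  simp [ht.ne']

lemma continuousAt_heatKernel₁ {t : ℝ} (ht : 0 < t) (x : ℝ) :
    ContinuousAt (Function.uncurry heatKernel₁) (t, x) := by
  refine ContinuousAt.mul (f := fun p : ℝ × ℝ => -(p.2 / p.1)) ?_ (continuousAt_heatKernel ht x)
  exact (ContinuousAt.div (by fun_prop) (by fun_prop) ht.ne').neg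

lemma continuousAt_heatKernel₂ {t : ℝ} (ht : 0 < t) (x : ℝ) :
    ContinuousAt (Function.uncurry heatKernel₂) (t, x) := by
  refine ContinuousAt.mul (f := fun p : ℝ × ℝ => p.2 ^ 2 / p.1 ^ 2 - 1 / p.1) ?_
    (continuousAt_heatKernel ht x)
  exact (ContinuousAt.div (by fun_prop) (by fun_prop) (by simp [ht.ne'])).sub
    (ContinuousAt.div (by fun_prop) (by fun_prop) ht.ne')

/-- Half of the exponent is traded for the polynomial, via `1 + u ≤ 4 exp(u/4)`. This removes the
polynomial prefactors in derivatives of the heat kernel. -/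
lemma one_add_mul_exp_neg_le (u : ℝ) :
    (1 + u) * Real.exp (-u / 2) ≤ 4 * Real.exp (-u / 4) := by
  have h1 : 1 + u ≤ 4 * Real.exp (u / 4) := by
    have := Real.add_one_le_exp (u / 4)
    linarith
  calc _ ≤ 4 * Real.exp (u / 4) * Real.exp (-u / 2) :=
        mul_le_mul_of_nonneg_right h1 (Real.exp_pos _).le
    _ = _ := by rw [mul_assoc, ← Real.exp_add]; ring_nf

lemma heatKernel_le {t : ℝ} (ht : 0 < t) (x : ℝ) :
    heatKernel t x ≤ (√t)⁻¹ * Real.exp (-(x ^ 2 / t) / 2) := by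
  unfold heatKernel
  have h2 : (√(2 * Real.pi * t))⁻¹ ≤ (√t)⁻¹ := by
    apply inv_anti₀ (by positivity)
    apply Real.sqrt_le_sqrt
    nlinarith [Real.pi_gt_three]
  have h3 : -x ^ 2 / (2 * t) = -(x ^ 2 / t) / 2 := by field_simp
  rw [h3]
  exact mul_le_mul_of_nonneg_right h2 (Real.exp_pos _).le

lemma mul_heatKernel_le {t : ℝ} (ht : 0 < t) (x : ℝ) {m D : ℝ} (hD : 0 ≤ D)
    (hm : |m| ≤ D * (1 + x ^ 2 / t)) :
    |m * heatKernel t x| ≤ 4 * D * (√t)⁻¹ * Real.exp (-(x ^ 2 / t) / 4) := by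
  have hu : 0 ≤ x ^ 2 / t := by positivity
  rw [abs_mul, abs_of_nonneg (heatKernel_nonneg t x)]
  calc _ ≤ D * (1 + x ^ 2 / t) * ((√t)⁻¹ * Real.exp (-(x ^ 2 / t) / 2)) :=
        mul_le_mul hm (heatKernel_le ht x) (heatKernel_nonneg _ _) (by positivity)
    _ = D * (√t)⁻¹ * ((1 + x ^ 2 / t) * Real.exp (-(x ^ 2 / t) / 2)) := by ring
    _ ≤ D * (√t)⁻¹ * (4 * Real.exp (-(x ^ 2 / t) / 4)) :=
        mul_le_mul_of_nonneg_left (one_add_mul_exp_neg_le _) (by positivity)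
    _ = _ := by ring

/-- This and the next two bounds have a common shape: each space derivative costs one factor
`t^(-1/2)`, and the Gaussian is widened once and for all to `exp(-x²/(4t))`. -/
lemma abs_heatKernel_le {t : ℝ} (ht : 0 < t) (x : ℝ) :
    |heatKernel t x| ≤ 4 * (√t)⁻¹ ^ 1 * Real.exp (-(x ^ 2 / t) / 4) := by
  have hu : 0 ≤ x ^ 2 / t := by positivity
  have := mul_heatKernel_le ht x (m := 1) (D := 1) zero_le_one (by rw [abs_one]; linarith)
  simpa using this

lemma abs_heatKernel₁_le {t : ℝ} (ht : 0 < t) (x : ℝ) :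
    |heatKernel₁ t x| ≤ 4 * (√t)⁻¹ ^ 2 * Real.exp (-(x ^ 2 / t) / 4) := by
  have hs : 0 < √t := Real.sqrt_pos.2 ht
  have := mul_heatKernel_le ht x (m := -(x / t)) (D := (√t)⁻¹) (by positivity) ?_
  · calc _ ≤ _ := this
      _ = _ := by ring
  -- With `t = r²` the claim amounts to `|r| |x| ≤ r² + x²`, obtained below by completing the
  -- square.
  · obtain ⟨r, rfl⟩ : ∃ r, t = r ^ 2 := ⟨√t, (Real.sq_sqrt ht.le).symm⟩
    rw [Real.sqrt_sq_eq_abs] at hs ⊢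
    have hr : r ^ 2 = |r| ^ 2 := (sq_abs r).symm
    rw [abs_neg, abs_div, hr, abs_of_nonneg (by positivity : 0 ≤ |r| ^ 2), ← sq_abs x]
    rw [div_le_iff₀ (by positivity)]
    have h1 : |r|⁻¹ * (1 + |x| ^ 2 / |r| ^ 2) * |r| ^ 2 = |r| + |x| ^ 2 / |r| := by
      field_simp
    rw [h1]
    have h2 : |r| + |x| ^ 2 / |r| - |x| = ((|r| - |x| / 2) ^ 2 + 3 / 4 * |x| ^ 2) / |r| := by
      field_simp; ring
    have h3 : 0 ≤ ((|r| - |x| / 2) ^ 2 + 3 / 4 * |x| ^ 2) / |r| := by positivity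
    linarith

lemma abs_heatKernel₂_le {t : ℝ} (ht : 0 < t) (x : ℝ) :
    |heatKernel₂ t x| ≤ 4 * (√t)⁻¹ ^ 3 * Real.exp (-(x ^ 2 / t) / 4) := by
  have := mul_heatKernel_le ht x (m := x ^ 2 / t ^ 2 - 1 / t) (D := t⁻¹) (by positivity) ?_
  · calc _ ≤ _ := this
      _ = 4 * (√t ^ 2)⁻¹ * (√t)⁻¹ * Real.exp (-(x ^ 2 / t) / 4) := by rw [Real.sq_sqrt ht.le]
      _ = _ := by ring
  · have h1 : t⁻¹ * (1 + x ^ 2 / t) = 1 / t + x ^ 2 / t ^ 2 := by field_simp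
    have h2 : 0 ≤ 1 / t := by positivity
    have h3 : 0 ≤ x ^ 2 / t ^ 2 := by positivity
    rw [h1, abs_le]
    constructor <;> linarith

/-- A space-time kernel that is measurable, continuous at positive times, and bounded away from
time zero. -/
structure IsNiceKernel (κ : ℝ → ℝ → ℝ) : Prop where
  measurable : Measurable (fun p : ℝ × ℝ => κ p.1 p.2)
  continuousAt : ∀ t, 0 < t → ∀ x, ContinuousAt (Function.uncurry κ) (t, x)
  bound : ∀ ε, 0 < ε → ∃ C, ∀ t, ε ≤ t → ∀ x, |κ t x| ≤ C

lemma bound_of_le_pow {κ : ℝ → ℝ → ℝ} {k : ℕ} (h : ∀ t, 0 < t → ∀ x,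
    |κ t x| ≤ 4 * (√t)⁻¹ ^ k * Real.exp (-(x ^ 2 / t) / 4)) (ε : ℝ) (hε : 0 < ε) :
    ∃ C, ∀ t, ε ≤ t → ∀ x, |κ t x| ≤ C := by
  refine ⟨4 * (√ε)⁻¹ ^ k * 1, fun t ht x => (h t (hε.trans_le ht) x).trans ?_⟩
  have h0 : 0 < √ε := Real.sqrt_pos.2 hε
  have ht0 : 0 < t := hε.trans_le ht
  have h1 : (√t)⁻¹ ≤ (√ε)⁻¹ := inv_anti₀ h0 (Real.sqrt_le_sqrt ht)
  have h2 : Real.exp (-(x ^ 2 / t) / 4) ≤ 1 := by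
    rw [Real.exp_le_one_iff]
    have : 0 ≤ x ^ 2 / t := by positivity
    linarith
  gcongr

lemma isNiceKernel_heatKernel : IsNiceKernel heatKernel :=
  ⟨measurable_heatKernel, fun _ ht x => continuousAt_heatKernel ht x,
    bound_of_le_pow fun _ ht x => abs_heatKernel_le ht x⟩

lemma isNiceKernel_heatKernel₁ : IsNiceKernel heatKernel₁ :=
  ⟨measurable_heatKernel₁, fun _ ht x => continuousAt_heatKernel₁ ht x,
    bound_of_le_pow fun _ ht x => abs_heatKernel₁_le ht x⟩

lemma isNiceKernel_heatKernel₂ : IsNiceKernel heatKernel₂ :=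
  ⟨measurable_heatKernel₂, fun _ ht x => continuousAt_heatKernel₂ ht x,
    bound_of_le_pow fun _ ht x => abs_heatKernel₂_le ht x⟩

lemma IsNiceKernel.const_mul {κ : ℝ → ℝ → ℝ} (h : IsNiceKernel κ) (c : ℝ) :
    IsNiceKernel (fun t x => c * κ t x) where
  measurable := h.measurable.const_mul c
  continuousAt t ht x := (h.continuousAt t ht x).const_mul c
  bound ε hε := by
    obtain ⟨C, hC⟩ := h.bound ε hε
    exact ⟨|c| * C, fun t ht x => by
      rw [abs_mul]; exact mul_le_mul_of_nonneg_left (hC t ht x) (abs_nonneg c)⟩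

/-! ### The contribution of early times -/

section Early

variable {μ : Measure (ℝ × ℝ)} {F : ℝ × ℝ → ℝ} {a : ℝ} {κ κ' : ℝ → ℝ → ℝ}

/-- The contribution of a source to a potential. -/
noncomputable def potential (μ : Measure (ℝ × ℝ)) (F : ℝ × ℝ → ℝ) (κ : ℝ → ℝ → ℝ)
    (t x : ℝ) : ℝ :=
  ∫ q, κ (t - q.1) (x - q.2) * F q ∂μ

lemma IsNiceKernel.aestronglyMeasurable (hκ : IsNiceKernel κ) (hF : Integrable F μ) (t x : ℝ) :
    AEStronglyMeasurable (fun q => κ (t - q.1) (x - q.2) * F q) μ :=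
  (hκ.measurable.comp (by fun_prop : Measurable fun q : ℝ × ℝ =>
    (t - q.1, x - q.2))).aestronglyMeasurable.mul hF.aestronglyMeasurable

/-- The source lives at times at most `a`, so the kernel is evaluated only at durations at least
`ε`, where it is bounded. The resulting multiple of `‖F‖` dominates the integrands in this section.
-/
lemma IsNiceKernel.norm_le {C ε : ℝ} (hC : ∀ t, ε ≤ t → ∀ x, |κ t x| ≤ C)
    {t : ℝ} (ht : a + ε ≤ t) (x : ℝ) {q : ℝ × ℝ} (hq : q.1 ≤ a) :
    ‖κ (t - q.1) (x - q.2) * F q‖ ≤ C * ‖F q‖ := by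
  rw [norm_mul]
  exact mul_le_mul_of_nonneg_right (hC _ (by linarith) _) (norm_nonneg _)

lemma IsNiceKernel.integrable (hκ : IsNiceKernel κ) (hF : Integrable F μ)
    (hμ : ∀ᵐ q ∂μ, q.1 ≤ a) {t : ℝ} (ht : a < t) (x : ℝ) :
    Integrable (fun q => κ (t - q.1) (x - q.2) * F q) μ := by
  obtain ⟨C, hC⟩ := hκ.bound (t - a) (by linarith)
  refine (hF.norm.const_mul C).mono' (hκ.aestronglyMeasurable hF t x) ?_
  filter_upwards [hμ] with q hq using IsNiceKernel.norm_le hC (by linarith) x hq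

lemma IsNiceKernel.exists_potential_le (hκ : IsNiceKernel κ) (hF : Integrable F μ)
    (hμ : ∀ᵐ q ∂μ, q.1 ≤ a) {ε : ℝ} (hε : 0 < ε) :
    ∃ C, ∀ t, a + ε ≤ t → ∀ x, |potential μ F κ t x| ≤ C := by
  obtain ⟨C, hC⟩ := hκ.bound ε hε
  refine ⟨∫ q, C * ‖F q‖ ∂μ, fun t ht x => ?_⟩
  rw [← Real.norm_eq_abs, potential]
  refine norm_integral_le_of_norm_le (hF.norm.const_mul C) ?_
  filter_upwards [hμ] with q hq using IsNiceKernel.norm_le hC ht x hq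

lemma IsNiceKernel.continuousAt_potential (hκ : IsNiceKernel κ) (hF : Integrable F μ)
    (hμ : ∀ᵐ q ∂μ, q.1 ≤ a) {t : ℝ} (ht : a < t) (x : ℝ) :
    ContinuousAt (Function.uncurry (potential μ F κ)) (t, x) := by
  -- Half of the gap `t - a` is kept as a margin, so that the bound holds on a neighbourhood of `t`.
  obtain ⟨C, hC⟩ := hκ.bound ((t - a) / 2) (by linarith)
  change ContinuousAt (fun p : ℝ × ℝ => ∫ q, κ (p.1 - q.1) (p.2 - q.2) * F q ∂μ) (t, x)
  refine continuousAt_of_dominated (bound := fun q => C * ‖F q‖)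
    (F := fun (p : ℝ × ℝ) q => κ (p.1 - q.1) (p.2 - q.2) * F q)
    (Eventually.of_forall fun p => hκ.aestronglyMeasurable hF p.1 p.2) ?_ (hF.norm.const_mul C) ?_
  · have : ∀ᶠ p : ℝ × ℝ in 𝓝 (t, x), a + (t - a) / 2 < p.1 :=
      continuous_fst.continuousAt.eventually_const_lt (by simp only; linarith)
    filter_upwards [this] with p hp
    filter_upwards [hμ] with q hq using IsNiceKernel.norm_le hC hp.le _ hq
  · filter_upwards [hμ] with q hq
    refine ContinuousAt.mul ?_ continuousAt_const
    have h1 := hκ.continuousAt (t - q.1) (by linarith) (x - q.2)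
    exact ContinuousAt.comp (f := fun p : ℝ × ℝ => (p.1 - q.1, p.2 - q.2)) (x := (t, x)) h1
      (by fun_prop)

lemma IsNiceKernel.hasDerivAt_potential_space (hκ : IsNiceKernel κ) (hκ' : IsNiceKernel κ')
    (hd : ∀ t, 0 < t → ∀ x, HasDerivAt (κ t) (κ' t x) x) (hF : Integrable F μ)
    (hμ : ∀ᵐ q ∂μ, q.1 ≤ a) {t : ℝ} (ht : a < t) (x : ℝ) :
    HasDerivAt (potential μ F κ t) (potential μ F κ' t x) x := by
  obtain ⟨C, hC⟩ := hκ'.bound (t - a) (by linarith)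
  refine (hasDerivAt_integral_of_dominated_loc_of_deriv_le (s := Set.univ)
    (F := fun x q => κ (t - q.1) (x - q.2) * F q) (F' := fun x q => κ' (t - q.1) (x - q.2) * F q)
    (bound := fun q => C * ‖F q‖) univ_mem
    (Eventually.of_forall fun x => hκ.aestronglyMeasurable hF t x) (hκ.integrable hF hμ ht x)
    (hκ'.aestronglyMeasurable hF t x) ?_ (hF.norm.const_mul C) ?_).2
  · filter_upwards [hμ] with q hq x _ using IsNiceKernel.norm_le hC (by linarith) x hq
  · filter_upwards [hμ] with q hq x _
    exact ((hd (t - q.1) (by linarith) (x - q.2)).comp_sub_const x q.2).mul_const (F q)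

lemma IsNiceKernel.hasDerivAt_potential_time (hκ : IsNiceKernel κ) (hκ' : IsNiceKernel κ')
    (hd : ∀ t, 0 < t → ∀ x, HasDerivAt (fun t => κ t x) (κ' t x) t) (hF : Integrable F μ)
    (hμ : ∀ᵐ q ∂μ, q.1 ≤ a) {t : ℝ} (ht : a < t) (x : ℝ) :
    HasDerivAt (fun t => potential μ F κ t x) (potential μ F κ' t x) t := by
  obtain ⟨C, hC⟩ := hκ'.bound ((t - a) / 2) (by linarith)
  refine (hasDerivAt_integral_of_dominated_loc_of_deriv_le (s := Set.Ioi (a + (t - a) / 2))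
    (F := fun t q => κ (t - q.1) (x - q.2) * F q) (F' := fun t q => κ' (t - q.1) (x - q.2) * F q)
    (bound := fun q => C * ‖F q‖) (Ioi_mem_nhds (by linarith))
    (Eventually.of_forall fun t => hκ.aestronglyMeasurable hF t x) (hκ.integrable hF hμ ht x)
    (hκ'.aestronglyMeasurable hF t x) ?_ (hF.norm.const_mul C) ?_).2
  · filter_upwards [hμ] with q hq s hs using IsNiceKernel.norm_le hC (Set.mem_Ioi.1 hs).le x hq
  · filter_upwards [hμ] with q hq s hs
    have := Set.mem_Ioi.1 hs
    exact ((hd (s - q.1) (by linarith) (x - q.2)).comp_sub_const s q.1).mul_const (F q)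

end Early

/-! ### The heat semigroup on smooth functions -/

/-- The average of `h` over a Gaussian of variance `r` centred at `x`. -/
noncomputable def heatAvg (h : ℝ → ℝ) (r x : ℝ) : ℝ :=
  ∫ w, h (x - √r * w) ∂(gaussianReal 0 1)

lemma integral_gaussianReal_eq_heatKernel (k : ℝ → ℝ) :
    ∫ w, k w ∂(gaussianReal 0 1) = ∫ w, heatKernel 1 w * k w := by
  rw [integral_gaussianReal_eq_integral_smul one_ne_zero]
  have := heatKernel_eq_gaussianPDFReal 1
  simp only [NNReal.coe_one] at this
  simp [this]

/-- Substitution `z = x - √r w`. The Gaussian form is preferred because it stays meaningful and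
continuous at `r = 0`, where the heat kernel degenerates. -/
lemma heatAvg_eq_integral (h : ℝ → ℝ) {r : ℝ} (hr : 0 < r) (x : ℝ) :
    heatAvg h r x = ∫ z, heatKernel r (x - z) * h z := by
  have hs : 0 < √r := Real.sqrt_pos.2 hr
  rw [heatAvg, integral_gaussianReal_eq_heatKernel]
  rw [← integral_sub_left_eq_self (fun z => heatKernel r (x - z) * h z) volume x]
  have := Measure.integral_comp_mul_left (fun z => heatKernel r (x - (x - z)) * h (x - z)) (√r)
  rw [abs_of_pos (inv_pos.2 hs), smul_eq_mul, eq_comm, inv_mul_eq_iff_eq_mul₀ hs.ne'] at this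
  rw [this, ← integral_const_mul]
  congr 1 with w
  have h1 : √r * heatKernel r (√r * w) = heatKernel 1 w := by
    unfold heatKernel
    rw [Real.sqrt_mul (by positivity) r, mul_pow, Real.sq_sqrt hr.le]
    have : -(r * w ^ 2) / (2 * r) = -w ^ 2 / (2 * 1) := by field_simp
    rw [this, mul_one]
    field_simp
  rw [sub_sub_cancel, ← h1]
  ring

lemma heatAvg_zero (h : ℝ → ℝ) (x : ℝ) : heatAvg h 0 x = h x := by
  simp [heatAvg]

lemma abs_heatAvg_le {h : ℝ → ℝ} {C : ℝ} (hC : ∀ x, |h x| ≤ C) (r x : ℝ) :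
    |heatAvg h r x| ≤ C := by
  have := norm_integral_le_of_norm_le_const (μ := gaussianReal 0 1)
    (f := fun w => h (x - √r * w)) (Eventually.of_forall fun w => hC (x - √r * w))
  simpa [heatAvg] using this

/-- All parameters sit in the integrand and the measure is fixed, so domination by a constant
suffices. No sign condition on the variance is needed, as `√r` is continuous and vanishes for `r ≤
0`. -/
lemma continuous_heatAvg {f : ℝ → ℝ → ℝ} {C : ℝ} (hf : Continuous (Function.uncurry f))
    (hC : ∀ s x, |f s x| ≤ C) {X : Type*} [TopologicalSpace X] [FirstCountableTopology X]
    {s r x : X → ℝ} (hs : Continuous s) (hr : Continuous r) (hx : Continuous x) :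
    Continuous (fun p => heatAvg (f (s p)) (r p) (x p)) := by
  have hF : ∀ w : ℝ, Continuous fun p => f (s p) (x p - √(r p) * w) := fun w =>
    hf.comp (hs.prodMk (by fun_prop))
  refine continuous_of_dominated (bound := fun _ => C) (fun p => ?_) (fun p => ?_)
    (integrable_const _) (Eventually.of_forall hF)
  · exact (hf.comp (by fun_prop : Continuous fun w : ℝ => (s p, x p - √(r p) * w))).aestronglyMeasurable
  · exact Eventually.of_forall fun w => hC _ _

lemma hasDerivAt_heatAvg {h h' : ℝ → ℝ} {C : ℝ} (hh' : Continuous h')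
    (hC : ∀ x, |h x| ≤ C) (hC' : ∀ x, |h' x| ≤ C) (hd : ∀ x, HasDerivAt h (h' x) x) (r x : ℝ) :
    HasDerivAt (heatAvg h r) (heatAvg h' r x) x := by
  have hh : Continuous h := continuous_iff_continuousAt.2 fun x => (hd x).continuousAt
  refine (hasDerivAt_integral_of_dominated_loc_of_deriv_le (s := Set.univ)
    (F := fun x w => h (x - √r * w)) (F' := fun x w => h' (x - √r * w))
    (bound := fun _ => C) univ_mem
    (Eventually.of_forall fun x => (by fun_prop : Continuous fun w => h (x - √r * w)).aestronglyMeasurable)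
    ?_ (by fun_prop : Continuous fun w => h' (x - √r * w)).aestronglyMeasurable
    (Eventually.of_forall fun w x _ => hC' _) (integrable_const _)
    (Eventually.of_forall fun w x _ => (hd _).comp_sub_const x _)).2
  exact (integrable_const C).mono' (by fun_prop : Continuous fun w => h (x - √r * w)).aestronglyMeasurable
    (Eventually.of_forall fun w => hC _)

lemma integrable_id_gaussianReal : Integrable (fun w : ℝ => w) (gaussianReal 0 1) :=
  (memLp_id_gaussianReal 1).integrable le_rfl

/-- Gaussian integration by parts. -/
lemma integral_mul_gaussianReal {k k' : ℝ → ℝ} {C : ℝ} (hk' : Continuous k')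
    (hC : ∀ x, |k x| ≤ C) (hC' : ∀ x, |k' x| ≤ C) (hd : ∀ x, HasDerivAt k (k' x) x) :
    ∫ w, w * k w ∂(gaussianReal 0 1) = ∫ w, k' w ∂(gaussianReal 0 1) := by
  have hk : Continuous k := continuous_iff_continuousAt.2 fun x => (hd x).continuousAt
  have hp : Integrable (heatKernel 1) := integrable_heatKernel one_pos
  have hp1 : Integrable (heatKernel₁ 1) := by
    have h1 : Integrable (fun x : ℝ => 4 * Real.exp (-(1 / 4) * x ^ 2)) :=
      (integrable_exp_neg_mul_sq (by norm_num)).const_mul 4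
    refine h1.mono' (measurable_heatKernel₁.comp measurable_prodMk_left).aestronglyMeasurable
      (Eventually.of_forall fun x => ?_)
    have := abs_heatKernel₁_le one_pos x
    rw [Real.norm_eq_abs]
    refine this.trans (le_of_eq ?_)
    simp only [Real.sqrt_one, inv_one, one_pow, mul_one, div_one]
    ring_nf
  have key := integral_mul_deriv_eq_deriv_mul_of_integrable (u := k) (v := heatKernel 1)
    (u' := k') (v' := heatKernel₁ 1) (fun x _ => hd x) (fun x _ => hasDerivAt_heatKernel 1 x)
    (hp1.bdd_mul hk.aestronglyMeasurable (Eventually.of_forall hC))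
    (hp.bdd_mul hk'.aestronglyMeasurable (Eventually.of_forall hC'))
    (hp.bdd_mul hk.aestronglyMeasurable (Eventually.of_forall hC))
  rw [integral_gaussianReal_eq_heatKernel, integral_gaussianReal_eq_heatKernel]
  have h2 : ∫ w, heatKernel 1 w * k' w = ∫ w, k' w * heatKernel 1 w := by
    congr 1 with w; ring
  have h3 : ∫ w, heatKernel 1 w * (w * k w) = -∫ w, k w * heatKernel₁ 1 w := by
    rw [← integral_neg]; congr 1 with w; simp only [heatKernel₁]; ring
  rw [h2, h3, key, neg_neg]

/-- Differentiating `√r` produces `-w h₁ / (2√r)`. Gaussian integration by parts replaces the factor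
`w` by a derivative, which contributes `-√r h₂`; the square roots cancel and leave half of `h₂`. -/
lemma hasDerivAt_heatAvg_time {h h₁ h₂ : ℝ → ℝ} {C : ℝ} (hh₂ : Continuous h₂)
    (hC : ∀ x, |h x| ≤ C) (hC₁ : ∀ x, |h₁ x| ≤ C) (hC₂ : ∀ x, |h₂ x| ≤ C)
    (hd : ∀ x, HasDerivAt h (h₁ x) x) (hd₁ : ∀ x, HasDerivAt h₁ (h₂ x) x) {r : ℝ} (hr : 0 < r)
    (x : ℝ) :
    HasDerivAt (fun r => heatAvg h r x) (1 / 2 * heatAvg h₂ r x) r := by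
  have hh : Continuous h := continuous_iff_continuousAt.2 fun x => (hd x).continuousAt
  have hh₁ : Continuous h₁ := continuous_iff_continuousAt.2 fun x => (hd₁ x).continuousAt
  have hC0 : 0 ≤ C := (abs_nonneg _).trans (hC 0)
  have hs : 0 < √r := Real.sqrt_pos.2 hr
  have key := (hasDerivAt_integral_of_dominated_loc_of_deriv_le (s := Set.Ioi (r / 2))
    (μ := gaussianReal 0 1) (x₀ := r)
    (F := fun r w => h (x - √r * w)) (F' := fun r w => h₁ (x - √r * w) * (-(1 / (2 * √r) * w)))
    (bound := fun w => C * (1 / (2 * √(r / 2)) * |w|)) (Ioi_mem_nhds (by linarith))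
    (Eventually.of_forall fun r => (by fun_prop : Continuous fun w => h (x - √r * w)).aestronglyMeasurable)
    ((integrable_const C).mono' (by fun_prop : Continuous fun w => h (x - √r * w)).aestronglyMeasurable
      (Eventually.of_forall fun w => hC _))
    (by fun_prop : Continuous fun w => h₁ (x - √r * w) * (-(1 / (2 * √r) * w))).aestronglyMeasurable
    (Eventually.of_forall fun w q hq => ?_)
    ((integrable_id_gaussianReal.abs.const_mul _).const_mul _)
    (Eventually.of_forall fun w q hq => ?_)).2
  · refine key.congr_deriv ?_
    have hst := integral_mul_gaussianReal (k := fun w => h₁ (x - √r * w))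
      (k' := fun w => h₂ (x - √r * w) * (-√r)) (C := C + C * √r) (by fun_prop)
      (fun w => (hC₁ _).trans (by nlinarith)) (fun w => by
        rw [abs_mul, abs_neg, abs_of_pos hs]
        nlinarith [mul_le_mul_of_nonneg_right (hC₂ (x - √r * w)) hs.le]) (fun w => by
        have h1 : HasDerivAt (fun w => x - √r * w) (-√r) w := by
          simpa using ((hasDerivAt_id w).const_mul (√r)).const_sub x
        exact (hd₁ _).comp w h1)
    rw [integral_mul_const] at hst
    have h2 : ∫ w, h₁ (x - √r * w) * (-(1 / (2 * √r) * w)) ∂(gaussianReal 0 1) =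
        -(1 / (2 * √r)) * ∫ w, w * h₁ (x - √r * w) ∂(gaussianReal 0 1) := by
      rw [← integral_const_mul]; congr 1 with w; ring
    rw [h2, hst, heatAvg]
    field_simp
  · have hq' : r / 2 < q := hq
    have hs2 : 0 < √(r / 2) := Real.sqrt_pos.2 (by linarith)
    have hsq : √(r / 2) ≤ √q := Real.sqrt_le_sqrt hq'.le
    rw [norm_mul, Real.norm_eq_abs, Real.norm_eq_abs, abs_neg, abs_mul,
      abs_of_nonneg (by positivity : 0 ≤ 1 / (2 * √q))]
    have : 1 / (2 * √q) ≤ 1 / (2 * √(r / 2)) := by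
      apply one_div_le_one_div_of_le <;> linarith
    exact mul_le_mul (hC₁ _) (mul_le_mul_of_nonneg_right this (abs_nonneg _)) (by positivity) hC0
  · have hq' : r / 2 < q := hq
    have hq0 : q ≠ 0 := by linarith
    have h1 : HasDerivAt (fun q => x - √q * w) (-(1 / (2 * √q) * w)) q :=
      ((Real.hasDerivAt_sqrt hq0).mul_const w).const_sub x
    exact (hd _).comp q h1

/-- The integrated form reaches down to variance zero, where the differentiation above is
unavailable because of the factor `1/√r`; continuity at the endpoint is enough. -/
lemma heatAvg_eq_add_integral {h h₁ h₂ : ℝ → ℝ} {C : ℝ} (hh₂ : Continuous h₂)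
    (hC : ∀ x, |h x| ≤ C) (hC₁ : ∀ x, |h₁ x| ≤ C) (hC₂ : ∀ x, |h₂ x| ≤ C)
    (hd : ∀ x, HasDerivAt h (h₁ x) x) (hd₁ : ∀ x, HasDerivAt h₁ (h₂ x) x) {r : ℝ} (hr : 0 ≤ r)
    (x : ℝ) :
    heatAvg h r x = h x + 1 / 2 * ∫ q in (0 : ℝ)..r, heatAvg h₂ q x := by
  have hh : Continuous h := continuous_iff_continuousAt.2 fun x => (hd x).continuousAt
  have hc : ∀ {k : ℝ → ℝ}, Continuous k → (∀ x, |k x| ≤ C) → Continuous fun r => heatAvg k r x :=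
    fun {k} hk hkC => continuous_heatAvg (f := fun _ => k) (s := fun _ => 0)
      (hk.comp continuous_snd) (fun _ => hkC) continuous_const continuous_id continuous_const
  have := intervalIntegral.integral_eq_sub_of_hasDerivAt_of_le hr (hc hh hC).continuousOn
    (fun q hq => hasDerivAt_heatAvg_time hh₂ hC hC₁ hC₂ hd hd₁ hq.1 x)
    (((hc hh₂ hC₂).const_mul (1 / 2)).intervalIntegrable _ _)
  rw [intervalIntegral.integral_const_mul, heatAvg_zero] at this
  linarith

lemma integral_triangle_swap {k : ℝ → ℝ → ℝ} {a t C : ℝ} (hat : a ≤ t)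
    (hk : Continuous (Function.uncurry k)) (hC : ∀ s r, |k s r| ≤ C) :
    ∫ s in a..t, ∫ r in s..t, k s r = ∫ r in a..t, ∫ s in a..r, k s r := by
  set μ := (volume : Measure ℝ).restrict (Set.Ioc a t)
  have h1 : ∫ s in a..t, ∫ r in s..t, k s r =
      ∫ s, ∫ r, (Set.Ioi s).indicator (fun r => k s r) r ∂μ ∂μ := by
    rw [intervalIntegral.integral_of_le hat]
    refine setIntegral_congr_fun measurableSet_Ioc fun s hs => ?_
    rw [intervalIntegral.integral_of_le hs.2, setIntegral_indicator measurableSet_Ioi]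
    congr 2
    ext r
    simp only [Set.mem_Ioc, Set.mem_inter_iff, Set.mem_Ioi]
    constructor
    · rintro ⟨h, h'⟩; exact ⟨⟨hs.1.trans h, h'⟩, h⟩
    · rintro ⟨⟨_, h'⟩, h⟩; exact ⟨h, h'⟩
  have h2 : ∫ r in a..t, ∫ s in a..r, k s r =
      ∫ r, ∫ s, (Set.Ioi s).indicator (fun r => k s r) r ∂μ ∂μ := by
    rw [intervalIntegral.integral_of_le hat]
    refine setIntegral_congr_fun measurableSet_Ioc fun r hr => ?_
    have : ∀ s, (Set.Ioi s).indicator (fun r => k s r) r =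
        (Set.Iio r).indicator (fun s => k s r) s := fun s => by
      simp [Set.indicator_apply]
    simp_rw [this]
    rw [intervalIntegral.integral_of_le hr.1.le, setIntegral_indicator measurableSet_Iio,
      integral_Ioc_eq_integral_Ioo]
    congr 2
    ext s
    simp only [Set.mem_Ioc, Set.mem_Ioo, Set.mem_inter_iff, Set.mem_Iio]
    constructor
    · rintro ⟨h, h'⟩; exact ⟨⟨h, h'.le.trans hr.2⟩, h'⟩
    · rintro ⟨⟨h, _⟩, h'⟩; exact ⟨h, h'⟩
  rw [h1, h2]
  refine integral_integral_swap (f := fun s r => (Set.Ioi s).indicator (fun r => k s r) r) ?_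
  refine (integrable_const C).mono' (Measurable.aestronglyMeasurable ?_)
    (Eventually.of_forall fun p => ?_)
  · refine Measurable.ite (p := fun p : ℝ × ℝ => p.2 ∈ Set.Ioi p.1) ?_ hk.measurable
      measurable_const
    exact measurableSet_lt measurable_fst measurable_snd
  · simp only [Function.uncurry, Set.indicator_apply]
    split_ifs
    · exact hC _ _
    · simpa using (abs_nonneg _).trans (hC 0 0)

/-! ### The contribution of late times -/

/-- A globally bounded and continuous function of time and space with globally bounded and
continuous first two space derivatives. -/
structure IsBoundedC2 (f f₁ f₂ : ℝ → ℝ → ℝ) (C : ℝ) : Prop where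
  cont : Continuous (Function.uncurry f)
  cont₁ : Continuous (Function.uncurry f₁)
  cont₂ : Continuous (Function.uncurry f₂)
  le : ∀ s x, |f s x| ≤ C
  le₁ : ∀ s x, |f₁ s x| ≤ C
  le₂ : ∀ s x, |f₂ s x| ≤ C
  deriv : ∀ s x, HasDerivAt (f s) (f₁ s x) x
  deriv₁ : ∀ s x, HasDerivAt (f₁ s) (f₂ s x) x

/-- The Duhamel integral started at time `a`, written with Gaussian averages. -/
noncomputable def lateDuhamel (f : ℝ → ℝ → ℝ) (a t x : ℝ) : ℝ :=
  ∫ s in a..t, heatAvg (f s) (t - s) x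

lemma continuous_lateDuhamel {f : ℝ → ℝ → ℝ} {C : ℝ} (hf : Continuous (Function.uncurry f))
    (hC : ∀ s x, |f s x| ≤ C) (a : ℝ) : Continuous (Function.uncurry (lateDuhamel f a)) := by
  unfold lateDuhamel Function.uncurry
  refine intervalIntegral.continuous_parametric_intervalIntegral_of_continuous
    (f := fun (p : ℝ × ℝ) s => heatAvg (f s) (p.1 - s) p.2) ?_ continuous_fst
  exact continuous_heatAvg hf hC continuous_snd (by fun_prop) (by fun_prop)

lemma abs_lateDuhamel_le {f : ℝ → ℝ → ℝ} {C : ℝ} (hC : ∀ s x, |f s x| ≤ C) (a t x : ℝ) :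
    |lateDuhamel f a t x| ≤ C * |t - a| := by
  rw [← Real.norm_eq_abs, lateDuhamel]
  exact intervalIntegral.norm_integral_le_of_norm_le_const fun s _ => abs_heatAvg_le (hC s) _ _

/-- The derivative falls on the source and not on the kernel, so no singularity arises at `s = t`.
-/
lemma hasDerivAt_lateDuhamel {f f' : ℝ → ℝ → ℝ} {C : ℝ} (hf : Continuous (Function.uncurry f))
    (hf' : Continuous (Function.uncurry f')) (hC : ∀ s x, |f s x| ≤ C)
    (hC' : ∀ s x, |f' s x| ≤ C) (hd : ∀ s x, HasDerivAt (f s) (f' s x) x) (a t x : ℝ) :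
    HasDerivAt (lateDuhamel f a t) (lateDuhamel f' a t x) x := by
  have hc : ∀ x, Continuous fun s => heatAvg (f s) (t - s) x := fun x =>
    continuous_heatAvg hf hC continuous_id (by fun_prop) (by fun_prop)
  have hc' : ∀ x, Continuous fun s => heatAvg (f' s) (t - s) x := fun x =>
    continuous_heatAvg hf' hC' continuous_id (by fun_prop) (by fun_prop)
  refine (intervalIntegral.hasDerivAt_integral_of_dominated_loc_of_deriv_le (s := Set.univ)
    (F := fun x s => heatAvg (f s) (t - s) x) (F' := fun x s => heatAvg (f' s) (t - s) x)
    (bound := fun _ => C) univ_mem (Eventually.of_forall fun x => (hc x).aestronglyMeasurable)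
    ((hc x).intervalIntegrable _ _) (hc' x).aestronglyMeasurable
    (Eventually.of_forall fun s _ x _ => abs_heatAvg_le (hC' s) _ _)
    intervalIntegrable_const (Eventually.of_forall fun s _ x _ => ?_)).2
  have : Continuous (f' s) := hf'.comp (continuous_const.prodMk continuous_id)
  exact hasDerivAt_heatAvg this (hC s) (hC' s) (hd s) _ _

/-- Each Gaussian average is expanded as its initial value plus a time integral, and the order of
integration over the triangle `a < s < r ≤ t` is exchanged. The Duhamel integral thereby becomes the
integral of a continuous function of `r`, to which the fundamental theorem of calculus applies. -/
lemma IsBoundedC2.lateDuhamel_eq {f f₁ f₂ : ℝ → ℝ → ℝ} {C : ℝ} (h : IsBoundedC2 f f₁ f₂ C)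
    {a t : ℝ} (hat : a ≤ t) (x : ℝ) :
    lateDuhamel f a t x = ∫ r in a..t, (f r x + 1 / 2 * lateDuhamel f₂ a r x) := by
  have hsec : ∀ s, Continuous (f₂ s) := fun s => h.cont₂.comp (continuous_const.prodMk continuous_id)
  have hfx : Continuous fun s => f s x := h.cont.comp (continuous_id.prodMk continuous_const)
  have hl : Continuous fun r => lateDuhamel f₂ a r x :=
    (continuous_lateDuhamel h.cont₂ h.le₂ a).comp (continuous_id.prodMk continuous_const)
  have h1 : lateDuhamel f a t x =
      ∫ s in a..t, (f s x + 1 / 2 * ∫ r in s..t, heatAvg (f₂ s) (r - s) x) := by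
    refine intervalIntegral.integral_congr fun s hs => ?_
    rw [Set.uIcc_of_le hat] at hs
    rw [heatAvg_eq_add_integral (hsec s) (h.le s) (h.le₁ s) (h.le₂ s) (h.deriv s) (h.deriv₁ s)
      (by linarith [hs.2])]
    rw [intervalIntegral.integral_comp_sub_right (fun q => heatAvg (f₂ s) q x), sub_self]
  have hcont : Continuous fun p : ℝ × ℝ => heatAvg (f₂ p.1) (p.2 - p.1) x :=
    continuous_heatAvg h.cont₂ h.le₂ continuous_fst (by fun_prop) (by fun_prop)
  have hin : Continuous fun s => ∫ r in s..t, heatAvg (f₂ s) (r - s) x := by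
    simp_rw [intervalIntegral.integral_symm t]
    exact (intervalIntegral.continuous_parametric_intervalIntegral_of_continuous
      (f := fun s r => heatAvg (f₂ s) (r - s) x) hcont continuous_id).neg
  rw [h1, intervalIntegral.integral_add (hfx.intervalIntegrable _ _)
    ((hin.const_mul _).intervalIntegrable _ _), intervalIntegral.integral_add
    (hfx.intervalIntegrable _ _) ((hl.const_mul _).intervalIntegrable _ _),
    intervalIntegral.integral_const_mul, intervalIntegral.integral_const_mul]
  rw [integral_triangle_swap (k := fun s r => heatAvg (f₂ s) (r - s) x) hat hcont
    fun s r => abs_heatAvg_le (h.le₂ s) _ _]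
  rfl

lemma IsBoundedC2.hasDerivAt_lateDuhamel_time {f f₁ f₂ : ℝ → ℝ → ℝ} {C : ℝ}
    (h : IsBoundedC2 f f₁ f₂ C) {a t : ℝ} (hat : a < t) (x : ℝ) :
    HasDerivAt (fun t => lateDuhamel f a t x) (1 / 2 * lateDuhamel f₂ a t x + f t x) t := by
  have hfx : Continuous fun s => f s x := h.cont.comp (continuous_id.prodMk continuous_const)
  have hl : Continuous fun r => lateDuhamel f₂ a r x :=
    (continuous_lateDuhamel h.cont₂ h.le₂ a).comp (continuous_id.prodMk continuous_const)
  have hc : Continuous fun r => f r x + 1 / 2 * lateDuhamel f₂ a r x := by fun_prop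
  have := (hc.integral_hasStrictDerivAt a t).hasDerivAt
  rw [add_comm]
  refine this.congr_of_eventuallyEq ?_
  filter_upwards [lt_mem_nhds hat] with r hr using h.lateDuhamel_eq hr.le x

/-! ### Regularity of Duhamel integrals -/

/-- `f` is twice continuously differentiable in space with derivatives `f₁` and `f₂`, for positive
times, and all three are locally bounded in time. -/
structure IsRegular (f f₁ f₂ : ℝ → ℝ → ℝ) : Prop where
  cont : ∀ t, 0 < t → ∀ x, ContinuousAt (Function.uncurry f) (t, x)
  cont₁ : ∀ t, 0 < t → ∀ x, ContinuousAt (Function.uncurry f₁) (t, x)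
  cont₂ : ∀ t, 0 < t → ∀ x, ContinuousAt (Function.uncurry f₂) (t, x)
  deriv : ∀ t, 0 < t → ∀ x, HasDerivAt (f t) (f₁ t x) x
  deriv₁ : ∀ t, 0 < t → ∀ x, HasDerivAt (f₁ t) (f₂ t x) x
  bound : ∀ a b, 0 < a → a ≤ b → ∃ C, ∀ t ∈ Set.Icc a b, ∀ x, |f t x| ≤ C ∧ |f₁ t x| ≤ C ∧ |f₂ t x| ≤ C

/-- Freezing time outside `[a, b]` makes the local bounds global and does not change the functions
on `[a, b]`. -/
lemma IsRegular.isBoundedC2 {f f₁ f₂ : ℝ → ℝ → ℝ} (h : IsRegular f f₁ f₂) {a b : ℝ} (ha : 0 < a)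
    (hab : a ≤ b) : ∃ C, IsBoundedC2 (fun s => f (Set.projIcc a b hab s))
      (fun s => f₁ (Set.projIcc a b hab s)) (fun s => f₂ (Set.projIcc a b hab s)) C := by
  obtain ⟨C, hC⟩ := h.bound a b ha hab
  have hpos : ∀ s, 0 < (Set.projIcc a b hab s : ℝ) := fun s =>
    ha.trans_le (Set.projIcc a b hab s).2.1
  have hcont : ∀ k : ℝ → ℝ → ℝ, (∀ t, 0 < t → ∀ x, ContinuousAt (Function.uncurry k) (t, x)) →
      Continuous (Function.uncurry fun s => k (Set.projIcc a b hab s)) := fun k hk => by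
    rw [continuous_iff_continuousAt]
    rintro ⟨s, x⟩
    have h1 : Continuous fun p : ℝ × ℝ => ((Set.projIcc a b hab p.1 : ℝ), p.2) :=
      (continuous_subtype_val.comp (continuous_projIcc.comp continuous_fst)).prodMk continuous_snd
    exact ContinuousAt.comp (f := fun p : ℝ × ℝ => ((Set.projIcc a b hab p.1 : ℝ), p.2))
      (g := Function.uncurry k) (x := (s, x)) (hk _ (hpos s) x) h1.continuousAt
  exact ⟨C, hcont _ h.cont, hcont _ h.cont₁, hcont _ h.cont₂,
    fun s x => (hC _ (Set.projIcc a b hab s).2 x).1,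
    fun s x => (hC _ (Set.projIcc a b hab s).2 x).2.1,
    fun s x => (hC _ (Set.projIcc a b hab s).2 x).2.2,
    fun s x => h.deriv _ (hpos s) x, fun s x => h.deriv₁ _ (hpos s) x⟩

/-- The heat measure of early times. -/
noncomputable abbrev earlyMeasure (a : ℝ) : Measure (ℝ × ℝ) :=
  ((volume : Measure ℝ).restrict (Set.Ioc 0 a)).prod volume

lemma ae_earlyMeasure_le (a : ℝ) : ∀ᵐ q ∂(earlyMeasure a), q.1 ≤ a := by
  have : ∀ᵐ s ∂((volume : Measure ℝ).restrict (Set.Ioc 0 a)), s ≤ a := by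
    filter_upwards [ae_restrict_mem measurableSet_Ioc] with s hs using hs.2
  exact Measure.quasiMeasurePreserving_fst.ae this

/-- The cut at time `a` separates the two singularities: before `a` the source may blow up but the
kernel is smooth, after `a` the kernel may blow up but the source is `C²`. -/
lemma duhamel_eq_add {f : ℝ → ℝ → ℝ} {y : ℝ} (hT : IsTame f y)
    {a b t : ℝ} (ha : 0 < a) (hab : a ≤ b) (hat : a < t) (htb : t ≤ b) (x : ℝ) :
    duhamel f t x = potential (earlyMeasure a) (Function.uncurry f) heatKernel t x +
      lateDuhamel (fun s => f (Set.projIcc a b hab s)) a t x := by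
  have hint := hT.integrable t x
  have hI : IntegrableOn (fun s => ∫ z, heatKernel (t - s) (x - z) * f s z) (Set.Ioc 0 t) :=
    hint.integral_prod_left
  have hIa := hI.mono_set (Set.Ioc_subset_Ioc_right hat.le)
  have hIt := hI.mono_set (Set.Ioc_subset_Ioc_left ha.le)
  rw [duhamel, ← intervalIntegral.integral_add_adjacent_intervals
    ((intervalIntegrable_iff_integrableOn_Ioc_of_le ha.le).2 hIa)
    ((intervalIntegrable_iff_integrableOn_Ioc_of_le hat.le).2 hIt)]
  congr 1
  · rw [intervalIntegral.integral_of_le ha.le, potential]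
    have := integral_prod _ (isNiceKernel_heatKernel.integrable (hT.integrable_source a)
      (ae_earlyMeasure_le a) hat x)
    exact this.symm
  -- The endpoint `s = t` is removed on both sides, because there the Gaussian average is the source
  -- itself whereas `heatKernel 0` vanishes.
  · rw [lateDuhamel, intervalIntegral.integral_of_le hat.le, intervalIntegral.integral_of_le hat.le,
      integral_Ioc_eq_integral_Ioo, integral_Ioc_eq_integral_Ioo]
    refine setIntegral_congr_fun measurableSet_Ioo fun s hs => ?_
    rw [heatAvg_eq_integral _ (sub_pos.2 hs.2),
      Set.projIcc_of_mem hab ⟨hs.1.le, hs.2.le.trans htb⟩]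

/-- On the window `(a, b)` each derivative is a potential of the differentiated kernel plus a late
integral of the differentiated source. The bounds require distance `ε` from `a`, since the kernels
blow up there. -/
lemma local_isRegular_duhamel {f f₁ f₂ : ℝ → ℝ → ℝ} {y : ℝ} (hT : IsTame f y)
    (h : IsRegular f f₁ f₂) {a b : ℝ} (ha : 0 < a) (hab : a < b) :
    ∃ v v₁ v₂ : ℝ → ℝ → ℝ,
      (∀ t ∈ Set.Ioo a b, ∀ x, duhamel f t x = v t x) ∧
      (∀ t ∈ Set.Ioo a b, ∀ x, HasDerivAt (v t) (v₁ t x) x ∧ HasDerivAt (v₁ t) (v₂ t x) x ∧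
        HasDerivAt (fun t => v t x) (1 / 2 * v₂ t x + f t x) t ∧
        ContinuousAt (Function.uncurry v) (t, x) ∧ ContinuousAt (Function.uncurry v₁) (t, x) ∧
        ContinuousAt (Function.uncurry v₂) (t, x)) ∧
      ∀ ε, 0 < ε → ∃ C, ∀ t, a + ε ≤ t → t ≤ b → ∀ x, |v t x| ≤ C ∧ |v₁ t x| ≤ C ∧ |v₂ t x| ≤ C := by
  obtain ⟨C, hC⟩ := h.isBoundedC2 ha hab.le
  have hF := hT.integrable_source a
  have hμ := ae_earlyMeasure_le a
  have k0 := isNiceKernel_heatKernel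
  have k1 := isNiceKernel_heatKernel₁
  have k2 := isNiceKernel_heatKernel₂
  refine ⟨fun t x => potential (earlyMeasure a) (Function.uncurry f) heatKernel t x +
      lateDuhamel (fun s => f (Set.projIcc a b hab.le s)) a t x,
    fun t x => potential (earlyMeasure a) (Function.uncurry f) heatKernel₁ t x +
      lateDuhamel (fun s => f₁ (Set.projIcc a b hab.le s)) a t x,
    fun t x => potential (earlyMeasure a) (Function.uncurry f) heatKernel₂ t x +
      lateDuhamel (fun s => f₂ (Set.projIcc a b hab.le s)) a t x,
    fun t ht x => duhamel_eq_add hT ha hab.le ht.1 ht.2.le x, fun t ht x => ⟨?_, ?_, ?_, ?_, ?_, ?_⟩,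
    fun ε hε => ?_⟩
  · exact (k0.hasDerivAt_potential_space k1 (fun t _ x => hasDerivAt_heatKernel t x) hF hμ ht.1 x).add
      (hasDerivAt_lateDuhamel hC.cont hC.cont₁ hC.le hC.le₁ hC.deriv a t x)
  · exact (k1.hasDerivAt_potential_space k2 (fun t _ x => hasDerivAt_heatKernel₁ t x) hF hμ ht.1 x).add
      (hasDerivAt_lateDuhamel hC.cont₁ hC.cont₂ hC.le₁ hC.le₂ hC.deriv₁ a t x)
  · refine ((k0.hasDerivAt_potential_time (k2.const_mul (1 / 2))
      (fun t ht x => hasDerivAt_heatKernel_time ht x) hF hμ ht.1 x).add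
      (hC.hasDerivAt_lateDuhamel_time ht.1 x)).congr_deriv ?_
    rw [Set.projIcc_of_mem hab.le ⟨ht.1.le, ht.2.le⟩]
    have : potential (earlyMeasure a) (Function.uncurry f) (fun t x => 1 / 2 * heatKernel₂ t x) t x
        = 1 / 2 * potential (earlyMeasure a) (Function.uncurry f) heatKernel₂ t x := by
      unfold potential
      rw [← integral_const_mul]
      simp only [mul_assoc]
    rw [this]
    ring
  · exact (k0.continuousAt_potential hF hμ ht.1 x).add
      (continuous_lateDuhamel hC.cont hC.le a).continuousAt
  · exact (k1.continuousAt_potential hF hμ ht.1 x).add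
      (continuous_lateDuhamel hC.cont₁ hC.le₁ a).continuousAt
  · exact (k2.continuousAt_potential hF hμ ht.1 x).add
      (continuous_lateDuhamel hC.cont₂ hC.le₂ a).continuousAt
  · obtain ⟨D0, hD0⟩ := k0.exists_potential_le hF hμ hε
    obtain ⟨D1, hD1⟩ := k1.exists_potential_le hF hμ hε
    obtain ⟨D2, hD2⟩ := k2.exists_potential_le hF hμ hε
    have hC0 : 0 ≤ C := (abs_nonneg _).trans (hC.le 0 0)
    refine ⟨max D0 (max D1 D2) + C * (b - a), fun t ht htb x => ?_⟩
    have hl : C * |t - a| ≤ C * (b - a) := by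
      rw [abs_of_nonneg (by linarith)]
      exact mul_le_mul_of_nonneg_left (by linarith) hC0
    refine ⟨(abs_add_le _ _).trans (add_le_add ((hD0 t ht x).trans (le_max_left _ _))
      ((abs_lateDuhamel_le hC.le a t x).trans hl)),
      (abs_add_le _ _).trans (add_le_add ((hD1 t ht x).trans
        ((le_max_left _ _).trans (le_max_right _ _)))
      ((abs_lateDuhamel_le hC.le₁ a t x).trans hl)),
      (abs_add_le _ _).trans (add_le_add ((hD2 t ht x).trans
        ((le_max_right _ _).trans (le_max_right _ _)))
      ((abs_lateDuhamel_le hC.le₂ a t x).trans hl))⟩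

/-- The Duhamel integral of a regular source is regular and solves the inhomogeneous heat
equation. -/
theorem isRegular_duhamel {f f₁ f₂ : ℝ → ℝ → ℝ} {y : ℝ} (hT : IsTame f y)
    (h : IsRegular f f₁ f₂) :
    ∃ u₁ u₂ : ℝ → ℝ → ℝ, IsRegular (duhamel f) u₁ u₂ ∧ ∀ t, 0 < t → ∀ x,
      HasDerivAt (fun t => duhamel f t x) (1 / 2 * u₂ t x + f t x) t := by
  -- The local representatives are identified with iterated `deriv`s, which do not depend on the
  -- window; this is what glues different windows together.
  have key : ∀ a b, 0 < a → a < b → ∃ v v₁ v₂ : ℝ → ℝ → ℝ,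
      (∀ t ∈ Set.Ioo a b, duhamel f t = v t ∧ (fun x => deriv (duhamel f t) x) = v₁ t ∧
        (fun x => deriv (fun x => deriv (duhamel f t) x) x) = v₂ t) ∧
      (∀ t ∈ Set.Ioo a b, ∀ x, HasDerivAt (v t) (v₁ t x) x ∧ HasDerivAt (v₁ t) (v₂ t x) x ∧
        HasDerivAt (fun t => v t x) (1 / 2 * v₂ t x + f t x) t ∧
        ContinuousAt (Function.uncurry v) (t, x) ∧ ContinuousAt (Function.uncurry v₁) (t, x) ∧
        ContinuousAt (Function.uncurry v₂) (t, x)) ∧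
      ∀ ε, 0 < ε → ∃ C, ∀ t, a + ε ≤ t → t ≤ b → ∀ x,
        |v t x| ≤ C ∧ |v₁ t x| ≤ C ∧ |v₂ t x| ≤ C := by
    intro a b ha hab
    obtain ⟨v, v₁, v₂, h1, h2, h3⟩ := local_isRegular_duhamel hT h ha hab
    refine ⟨v, v₁, v₂, fun t ht => ?_, h2, h3⟩
    have e0 : duhamel f t = v t := funext fun x => h1 t ht x
    have e1 : (fun x => deriv (duhamel f t) x) = v₁ t := by
      funext x; rw [e0]; exact (h2 t ht x).1.deriv
    refine ⟨e0, e1, ?_⟩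
    rw [e1]; funext x; exact (h2 t ht x).2.1.deriv
  have hmem : ∀ t : ℝ, 0 < t → t ∈ Set.Ioo (t / 2) (t + 1) := fun t ht =>
    ⟨by linarith, by linarith⟩
  have hev : ∀ {u v : ℝ → ℝ → ℝ} {t : ℝ}, 0 < t → ∀ x,
      (∀ s ∈ Set.Ioo (t / 2) (t + 1), u s = v s) →
      Function.uncurry u =ᶠ[𝓝 (t, x)] Function.uncurry v := fun {u v t} ht x huv => by
    have : ∀ᶠ p : ℝ × ℝ in 𝓝 (t, x), p.1 ∈ Set.Ioo (t / 2) (t + 1) :=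
      continuous_fst.continuousAt.eventually (Ioo_mem_nhds (hmem t ht).1 (hmem t ht).2)
    filter_upwards [this] with p hp
    simp only [Function.uncurry, huv p.1 hp]
  refine ⟨fun t x => deriv (duhamel f t) x, fun t x => deriv (fun x => deriv (duhamel f t) x) x,
    ⟨fun t ht x => ?_, fun t ht x => ?_, fun t ht x => ?_, fun t ht x => ?_, fun t ht x => ?_,
      fun a b ha hab => ?_⟩, fun t ht x => ?_⟩
  · obtain ⟨v, v₁, v₂, h1, h2, -⟩ := key (t / 2) (t + 1) (by linarith) (by linarith)
    exact (h2 t (hmem t ht) x).2.2.2.1.congr (hev ht x fun s hs => (h1 s hs).1).symm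
  · obtain ⟨v, v₁, v₂, h1, h2, -⟩ := key (t / 2) (t + 1) (by linarith) (by linarith)
    exact (h2 t (hmem t ht) x).2.2.2.2.1.congr (hev ht x fun s hs => (h1 s hs).2.1).symm
  · obtain ⟨v, v₁, v₂, h1, h2, -⟩ := key (t / 2) (t + 1) (by linarith) (by linarith)
    exact (h2 t (hmem t ht) x).2.2.2.2.2.congr (hev ht x fun s hs => (h1 s hs).2.2).symm
  · obtain ⟨v, v₁, v₂, h1, h2, -⟩ := key (t / 2) (t + 1) (by linarith) (by linarith)
    have e := h1 t (hmem t ht)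
    rw [e.1]
    exact (h2 t (hmem t ht) x).1.differentiableAt.hasDerivAt
  · obtain ⟨v, v₁, v₂, h1, h2, -⟩ := key (t / 2) (t + 1) (by linarith) (by linarith)
    have e := h1 t (hmem t ht)
    rw [e.2.1]
    exact (h2 t (hmem t ht) x).2.1.differentiableAt.hasDerivAt
  -- The window starts at `a / 2`, which leaves the margin `ε = a / 2` needed for uniform bounds on
  -- `[a, b]`.
  · obtain ⟨v, v₁, v₂, h1, -, h3⟩ := key (a / 2) (b + 1) (by linarith) (by linarith)
    obtain ⟨C, hC⟩ := h3 (a / 2) (by linarith)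
    refine ⟨C, fun t ht x => ?_⟩
    have e := h1 t ⟨by linarith [ht.1], by linarith [ht.2]⟩
    have := hC t (by linarith [ht.1]) (by linarith [ht.2]) x
    rwa [← e.1, ← e.2.1, ← e.2.2] at this
  · obtain ⟨v, v₁, v₂, h1, h2, -⟩ := key (t / 2) (t + 1) (by linarith) (by linarith)
    have e := h1 t (hmem t ht)
    simp only [e.2.2]
    refine (h2 t (hmem t ht) x).2.2.1.congr_of_eventuallyEq ?_
    filter_upwards [Ioo_mem_nhds (hmem t ht).1 (hmem t ht).2] with s hs
    rw [(h1 s hs).1]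

/-! ### Regularity of `g` in time and along the diagonal -/

lemma IsRegular.add {f f₁ f₂ k k₁ k₂ : ℝ → ℝ → ℝ} (hf : IsRegular f f₁ f₂)
    (hk : IsRegular k k₁ k₂) :
    IsRegular (fun t x => f t x + k t x) (fun t x => f₁ t x + k₁ t x)
      (fun t x => f₂ t x + k₂ t x) where
  cont t ht x := (hf.cont t ht x).add (hk.cont t ht x)
  cont₁ t ht x := (hf.cont₁ t ht x).add (hk.cont₁ t ht x)
  cont₂ t ht x := (hf.cont₂ t ht x).add (hk.cont₂ t ht x)
  deriv t ht x := (hf.deriv t ht x).add (hk.deriv t ht x)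
  deriv₁ t ht x := (hf.deriv₁ t ht x).add (hk.deriv₁ t ht x)
  bound a b ha hab := by
    obtain ⟨C, hC⟩ := hf.bound a b ha hab
    obtain ⟨D, hD⟩ := hk.bound a b ha hab
    exact ⟨C + D, fun t ht x => ⟨(abs_add_le _ _).trans (add_le_add (hC t ht x).1 (hD t ht x).1),
      (abs_add_le _ _).trans (add_le_add (hC t ht x).2.1 (hD t ht x).2.1),
      (abs_add_le _ _).trans (add_le_add (hC t ht x).2.2 (hD t ht x).2.2)⟩⟩

lemma IsRegular.mul {f f₁ f₂ k k₁ k₂ : ℝ → ℝ → ℝ} (hf : IsRegular f f₁ f₂)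
    (hk : IsRegular k k₁ k₂) :
    IsRegular (fun t x => f t x * k t x) (fun t x => f₁ t x * k t x + f t x * k₁ t x)
      (fun t x => (f₂ t x * k t x + f₁ t x * k₁ t x) + (f₁ t x * k₁ t x + f t x * k₂ t x)) where
  cont t ht x := (hf.cont t ht x).mul (hk.cont t ht x)
  cont₁ t ht x := ((hf.cont₁ t ht x).mul (hk.cont t ht x)).add
    ((hf.cont t ht x).mul (hk.cont₁ t ht x))
  cont₂ t ht x := (((hf.cont₂ t ht x).mul (hk.cont t ht x)).add
    ((hf.cont₁ t ht x).mul (hk.cont₁ t ht x))).add (((hf.cont₁ t ht x).mul (hk.cont₁ t ht x)).add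
    ((hf.cont t ht x).mul (hk.cont₂ t ht x)))
  deriv t ht x := (hf.deriv t ht x).mul (hk.deriv t ht x)
  deriv₁ t ht x := ((hf.deriv₁ t ht x).mul (hk.deriv t ht x)).add
    ((hf.deriv t ht x).mul (hk.deriv₁ t ht x))
  bound a b ha hab := by
    obtain ⟨C, hC⟩ := hf.bound a b ha hab
    obtain ⟨D, hD⟩ := hk.bound a b ha hab
    have hC0 : 0 ≤ C := (abs_nonneg _).trans (hC a ⟨le_rfl, hab⟩ 0).1
    have hD0 : 0 ≤ D := (abs_nonneg _).trans (hD a ⟨le_rfl, hab⟩ 0).1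
    have hm : ∀ {p q : ℝ}, |p| ≤ C → |q| ≤ D → |p * q| ≤ C * D := fun hp hq => by
      rw [abs_mul]; exact mul_le_mul hp hq (abs_nonneg _) hC0
    have h2 : ∀ {p q : ℝ} {A B : ℝ}, |p| ≤ A → |q| ≤ B → |p + q| ≤ A + B := fun hp hq =>
      (abs_add_le _ _).trans (add_le_add hp hq)
    have hCD : 0 ≤ C * D := mul_nonneg hC0 hD0
    refine ⟨(C * D + C * D) + (C * D + C * D), fun t ht x => ?_⟩
    obtain ⟨c0, c1, c2⟩ := hC t ht x
    obtain ⟨d0, d1, d2⟩ := hD t ht x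
    exact ⟨(hm c0 d0).trans (by linarith), (h2 (hm c1 d0) (hm c0 d1)).trans (by linarith),
      h2 (h2 (hm c2 d0) (hm c1 d1)) (h2 (hm c1 d1) (hm c0 d2))⟩

lemma isRegular_of_time {c : ℝ → ℝ} (hc : Continuous c) :
    IsRegular (fun t _ => c t) (fun _ _ => 0) (fun _ _ => 0) where
  cont t _ x := (hc.comp continuous_fst).continuousAt
  cont₁ t _ x := continuousAt_const
  cont₂ t _ x := continuousAt_const
  deriv t _ x := hasDerivAt_const x _
  deriv₁ t _ x := hasDerivAt_const x _
  bound a b _ _ := by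
    obtain ⟨C, hC⟩ := (isCompact_Icc (a := a) (b := b)).exists_bound_of_continuousOn hc.continuousOn
    exact ⟨max C 0, fun t ht x => ⟨(hC t ht).trans (le_max_left _ _), by simp, by simp⟩⟩

lemma exists_isRegular_sum {ι : Type*} (s : Finset ι) {f : ι → ℝ → ℝ → ℝ}
    (h : ∀ i ∈ s, ∃ f₁ f₂, IsRegular (f i) f₁ f₂) :
    ∃ f₁ f₂, IsRegular (fun t x => ∑ i ∈ s, f i t x) f₁ f₂ := by
  classical
  induction s using Finset.induction_on with
  | empty => exact ⟨_, _, by simpa using isRegular_of_time (continuous_const (y := (0 : ℝ)))⟩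
  | insert i s hi ih =>
    obtain ⟨f₁, f₂, hf⟩ := h i (Finset.mem_insert_self _ _)
    obtain ⟨k₁, k₂, hk⟩ := ih fun j hj => h j (Finset.mem_insert_of_mem hj)
    simp_rw [Finset.sum_insert hi]
    exact ⟨_, _, hf.add hk⟩

lemma isRegular_heatKernel (y : ℝ) : IsRegular (fun t x => heatKernel t (x - y))
    (fun t x => heatKernel₁ t (x - y)) (fun t x => heatKernel₂ t (x - y)) := by
  have hs : ∀ {κ : ℝ → ℝ → ℝ}, IsNiceKernel κ → ∀ t, 0 < t → ∀ x,
      ContinuousAt (Function.uncurry fun t x => κ t (x - y)) (t, x) := fun {κ} hκ t ht x =>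
    ContinuousAt.comp (f := fun p : ℝ × ℝ => (p.1, p.2 - y)) (g := Function.uncurry κ)
      (x := (t, x)) (hκ.continuousAt t ht (x - y)) (by fun_prop)
  refine ⟨hs isNiceKernel_heatKernel, hs isNiceKernel_heatKernel₁, hs isNiceKernel_heatKernel₂,
    fun t _ x => (hasDerivAt_heatKernel t (x - y)).comp_sub_const x y,
    fun t _ x => (hasDerivAt_heatKernel₁ t (x - y)).comp_sub_const x y, fun a b ha _ => ?_⟩
  obtain ⟨D0, hD0⟩ := isNiceKernel_heatKernel.bound a ha
  obtain ⟨D1, hD1⟩ := isNiceKernel_heatKernel₁.bound a ha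
  obtain ⟨D2, hD2⟩ := isNiceKernel_heatKernel₂.bound a ha
  exact ⟨max D0 (max D1 D2), fun t ht x => ⟨(hD0 t ht.1 _).trans (le_max_left _ _),
    (hD1 t ht.1 _).trans ((le_max_left _ _).trans (le_max_right _ _)),
    (hD2 t ht.1 _).trans ((le_max_right _ _).trans (le_max_right _ _))⟩⟩

lemma exists_isRegular_symTensorSum {a : (k : ℕ) → ℝ → ℝ → (Fin k → ℝ) → ℝ} {n : ℕ} (y : Fin n → ℝ)
    (h : ∀ k, 1 ≤ k → k < n → ∀ w, ∃ f₁ f₂, IsRegular (fun t x => a k t x w) f₁ f₂) :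
    ∃ f₁ f₂, IsRegular (fun t x => symTensorSum (fun k => a k t x) n y) f₁ f₂ := by
  unfold symTensorSum symTensor
  refine exists_isRegular_sum _ fun k _ => ?_
  have hk := k.isLt
  obtain ⟨f₁, f₂, hf⟩ := exists_isRegular_sum (Finset.univ : Finset (Equiv.Perm (Fin n)))
    (f := fun σ t x =>
      a (k + 1) t x (fun i => y (σ (Fin.cast (by omega) (Fin.castAdd (n - (k + 1)) i)))) *
      a (n - (k + 1)) t x (fun j => y (σ (Fin.cast (by omega) (Fin.natAdd (k + 1) j)))))
    (fun σ _ => by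
      obtain ⟨p₁, p₂, hp⟩ := h (k + 1) (by omega) (by omega)
        (fun i => y (σ (Fin.cast (by omega) (Fin.castAdd (n - (k + 1)) i))))
      obtain ⟨q₁, q₂, hq⟩ := h (n - (k + 1)) (by omega) (by omega)
        (fun j => y (σ (Fin.cast (by omega) (Fin.natAdd (k + 1) j))))
      exact ⟨_, _, hp.mul hq⟩)
  exact ⟨_, _, (isRegular_of_time (continuous_const (y := ((n.factorial : ℝ))⁻¹))).mul hf⟩

/-- The functions `g n` are regular in time and space and satisfy the evolution equation. -/
theorem exists_isRegular_g {n : ℕ} (hn : 1 ≤ n) (y : Fin n → ℝ) :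
    ∃ u₁ u₂ : ℝ → ℝ → ℝ, IsRegular (fun t x => g n t x y) u₁ u₂ ∧ ∀ t, 0 < t → ∀ x,
      HasDerivAt (fun t => g n t x y)
        (1 / 2 * u₂ t x + symTensorSum (fun k => g k t x) n y - g n t x y) t := by
  have hexp : ∀ t : ℝ, HasDerivAt (fun t : ℝ => Real.exp (-t)) (-Real.exp (-t)) t := fun t => by
    simpa using (hasDerivAt_neg t).exp
  have he : Continuous fun t : ℝ => Real.exp (-t) := by fun_prop
  induction n using Nat.strong_induction_on with
  | _ n ih =>
    rcases hn.eq_or_lt with rfl | hn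
    · have hr := (isRegular_of_time he).mul (isRegular_heatKernel (y 0))
      simp_rw [g_one]
      refine ⟨_, _, hr, fun t ht x => ?_⟩
      refine ((hexp t).mul (hasDerivAt_heatKernel_time ht (x - y 0))).congr_deriv ?_
      simp [symTensorSum]
      ring
    · obtain ⟨f₁, f₂, hf⟩ := exists_isRegular_symTensorSum (a := g) y fun k hk hkn w => by
        obtain ⟨u₁, u₂, hu, -⟩ := ih k hkn hk w
        exact ⟨u₁, u₂, hu⟩
      obtain ⟨u₁, u₂, hu, hut⟩ := isRegular_duhamel (isTame_source y ⟨0, by omega⟩)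
        ((isRegular_of_time Real.continuous_exp).mul hf)
      have hr := (isRegular_of_time he).mul hu
      simp_rw [g_eq_duhamel hn]
      refine ⟨_, _, hr, fun t ht x => ?_⟩
      -- In the product rule the derivative of `e^(-t)` yields the term `-g_n`, and `e^(-t)` cancels
      -- the factor `e^t` of the source.
      refine ((hexp t).mul (hut t ht x)).congr_deriv ?_
      have : Real.exp (-t) * Real.exp t = 1 := by rw [← Real.exp_add]; simp
      have h2 : Real.exp (-t) * source n y t x = symTensorSum (fun k => g k t x) n y := by
        rw [source, ← mul_assoc, this, one_mul]
      rw [mul_add, h2]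
      ring

/-! ### Differentiation of parametric integrals to higher order -/

section Parametric

variable {α : Type*} [MeasurableSpace α] {μ : Measure α} {n : ℕ}

lemma sum_proj_smulRight {V : Type*} [NormedAddCommGroup V] [NormedSpace ℝ V]
    (L : (Fin n → ℝ) →L[ℝ] V) :
    ∑ i, (ContinuousLinearMap.proj (R := ℝ) (φ := fun _ : Fin n => ℝ) i).smulRight
      (L (Pi.single i 1)) = L := by
  refine ContinuousLinearMap.ext fun x => ?_
  simp only [sum_apply, ContinuousLinearMap.smulRight_apply, ContinuousLinearMap.proj_apply]
  simp_rw [← map_smul, ← map_sum]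
  congr 1
  ext j
  simp [Finset.sum_apply, Pi.single_apply]

/-- Directional derivatives are limits of difference quotients along a sequence, hence measurable,
and a linear map on `ℝ^n` is a finite combination of its values on the standard basis. -/
lemma aestronglyMeasurable_of_hasFDerivAt {V : Type*} [NormedAddCommGroup V] [NormedSpace ℝ V]
    {Φ : α → (Fin n → ℝ) → V} {Φ' : α → (Fin n → ℝ) →L[ℝ] V} {U : Set (Fin n → ℝ)}
    (hU : IsOpen U) {y : Fin n → ℝ} (hy : y ∈ U)
    (hm : ∀ y ∈ U, AEStronglyMeasurable (fun a => Φ a y) μ)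
    (hd : ∀ᵐ a ∂μ, HasFDerivAt (Φ a) (Φ' a) y) : AEStronglyMeasurable Φ' μ := by
  have hdir : ∀ v, AEStronglyMeasurable (fun a => Φ' a v) μ := by
    intro v
    have hc : Tendsto (fun m : ℕ => ‖((m : ℝ) + 1)‖) atTop atTop :=
      (tendsto_atTop_add_const_right _ _ tendsto_natCast_atTop_atTop).congr fun m => by
        rw [Real.norm_of_nonneg (by positivity)]
    have hlim : Tendsto (fun m : ℕ => y + ((m : ℝ) + 1)⁻¹ • v) atTop (𝓝 y) := by
      have : Tendsto (fun m : ℕ => ((m : ℝ) + 1)⁻¹) atTop (𝓝 0) :=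
        tendsto_inv_atTop_zero.comp
          (tendsto_atTop_add_const_right _ _ tendsto_natCast_atTop_atTop)
      simpa using tendsto_const_nhds.add (this.smul_const v)
    -- Measurability is known only inside `U`, so the sequence starts once its points have entered
    -- `U`.
    obtain ⟨N, hN⟩ := eventually_atTop.1 (hlim.eventually (hU.mem_nhds hy))
    refine aestronglyMeasurable_of_tendsto_ae (u := atTop) (f := fun (m : ℕ) a =>
      (((m + N : ℕ) : ℝ) + 1) • (Φ a (y + (((m + N : ℕ) : ℝ) + 1)⁻¹ • v) - Φ a y))
      (fun m => ((hm _ (hN _ (by omega))).sub (hm _ hy)).const_smul _) ?_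
    filter_upwards [hd] with a ha
    exact (ha.lim v hc).comp (tendsto_add_atTop_nat N)
  have : Φ' = fun a => ∑ i, (ContinuousLinearMap.proj (R := ℝ) (φ := fun _ : Fin n => ℝ) i).smulRight
      (Φ' a (Pi.single i 1)) := funext fun a => (sum_proj_smulRight _).symm
  rw [this]
  refine Finset.aestronglyMeasurable_fun_sum _ fun i _ => ?_
  exact (ContinuousLinearMap.smulRightL ℝ (Fin n → ℝ) V
    (ContinuousLinearMap.proj (R := ℝ) (φ := fun _ : Fin n => ℝ) i)).continuous.comp_aestronglyMeasurable
    (hdir _)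

variable {F : α → (Fin n → ℝ) → ℝ} {U : Set (Fin n → ℝ)} {k : ℕ} {b : α → ℝ}

lemma hasFDerivAt_iteratedFDeriv {f : (Fin n → ℝ) → ℝ} {y : Fin n → ℝ} (hf : ContDiffAt ℝ k f y)
    {i : ℕ} (hi : i < k) :
    HasFDerivAt (iteratedFDeriv ℝ i f)
      (continuousMultilinearCurryLeftEquiv ℝ (fun _ => Fin n → ℝ) ℝ (iteratedFDeriv ℝ (i + 1) f y))
      y := by
  have := (hf.differentiableAt_iteratedFDeriv (m := i) (by exact_mod_cast hi)).hasFDerivAt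
  rwa [iteratedFDeriv_succ_eq_comp_left, Function.comp_apply, LinearIsometryEquiv.apply_symm_apply]

lemma aestronglyMeasurable_iteratedFDeriv (hU : IsOpen U)
    (hm : ∀ y ∈ U, AEStronglyMeasurable (fun a => F a y) μ)
    (hF : ∀ᵐ a ∂μ, ∀ y ∈ U, ContDiffAt ℝ k (F a) y) {i : ℕ} (hi : i ≤ k) :
    ∀ y ∈ U, AEStronglyMeasurable (fun a => iteratedFDeriv ℝ i (F a) y) μ := by
  induction i with
  | zero =>
    intro y hy
    simp_rw [iteratedFDeriv_zero_eq_comp]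
    exact (LinearIsometryEquiv.continuous _).comp_aestronglyMeasurable (hm y hy)
  | succ i ih =>
    intro y hy
    have h1 := aestronglyMeasurable_of_hasFDerivAt (Φ := fun a => iteratedFDeriv ℝ i (F a))
      (Φ' := fun a => continuousMultilinearCurryLeftEquiv ℝ (fun _ => Fin n → ℝ) ℝ
        (iteratedFDeriv ℝ (i + 1) (F a) y)) hU hy (ih (by omega)) (by
        filter_upwards [hF] with a ha using hasFDerivAt_iteratedFDeriv (ha y hy) (by omega))
    have h2 := (continuousMultilinearCurryLeftEquiv ℝ (fun _ : Fin (i + 1) => Fin n → ℝ)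
      ℝ).symm.continuous.comp_aestronglyMeasurable h1
    simpa using h2

/-- A parametric integral is as smooth as the integrand, if all derivatives are dominated, and its
derivatives are obtained under the integral sign. -/
lemma contDiffOn_integral (hU : IsOpen U) (hb : Integrable b μ)
    (hm : ∀ y ∈ U, AEStronglyMeasurable (fun a => F a y) μ)
    (hF : ∀ᵐ a ∂μ, ∀ y ∈ U, ContDiffAt ℝ k (F a) y)
    (hbd : ∀ᵐ a ∂μ, ∀ y ∈ U, ∀ i ≤ k, ‖iteratedFDeriv ℝ i (F a) y‖ ≤ b a) :
    ContDiffOn ℝ k (fun y => ∫ a, F a y ∂μ) U ∧ ∀ y ∈ U, ∀ i ≤ k,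
      iteratedFDeriv ℝ i (fun y => ∫ a, F a y ∂μ) y = ∫ a, iteratedFDeriv ℝ i (F a) y ∂μ := by
  have hmeas : ∀ {i : ℕ}, i ≤ k → ∀ y ∈ U,
      AEStronglyMeasurable (fun a => iteratedFDeriv ℝ i (F a) y) μ := fun hi =>
    aestronglyMeasurable_iteratedFDeriv hU hm hF hi
  have hint : ∀ {i : ℕ}, i ≤ k → ∀ y ∈ U,
      Integrable (fun a => iteratedFDeriv ℝ i (F a) y) μ := fun hi y hy =>
    hb.mono' (hmeas hi y hy) (by filter_upwards [hbd] with a ha using ha y hy _ hi)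
  have hT : HasFTaylorSeriesUpToOn ((k : ℕ∞) : WithTop ℕ∞) (fun y => ∫ a, F a y ∂μ)
      (fun y i => ∫ a, iteratedFDeriv ℝ i (F a) y ∂μ) U := by
    refine ⟨fun y hy => ?_, fun i hi y hy => ?_, fun i hi => ?_⟩
    · have := (continuousMultilinearCurryFin0 ℝ (Fin n → ℝ) ℝ).toContinuousLinearEquiv.integral_comp_comm
        (μ := μ) (fun a => iteratedFDeriv ℝ 0 (F a) y)
      have h2 : ∀ f : (Fin n → ℝ) → ℝ, (iteratedFDeriv ℝ 0 f y).curry0 = f y := fun f => by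
        simp [ContinuousMultilinearMap.curry0]
      simp only [LinearIsometryEquiv.coe_toContinuousLinearEquiv,
        continuousMultilinearCurryFin0_apply] at this
      simp only [ContinuousMultilinearMap.curry0, Matrix.zero_empty] at h2 ⊢
      rw [show (![] : Fin 0 → (Fin n → ℝ)) = 0 from Subsingleton.elim _ _, ← this]
      simp
    · have hi' : i < k := by exact_mod_cast hi
      have hd := hasFDerivAt_integral_of_dominated_of_fderiv_le (μ := μ) (x₀ := y) (bound := b)
        (F := fun y a => iteratedFDeriv ℝ i (F a) y)
        (F' := fun y a => continuousMultilinearCurryLeftEquiv ℝ (fun _ => Fin n → ℝ) ℝ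
          (iteratedFDeriv ℝ (i + 1) (F a) y)) (hU.mem_nhds hy)
        (by filter_upwards [hU.mem_nhds hy] with y hy using hmeas hi'.le y hy)
        (hint hi'.le y hy)
        ((LinearIsometryEquiv.continuous _).comp_aestronglyMeasurable (hmeas hi' y hy))
        (by
          filter_upwards [hbd] with a ha y hy
          rw [LinearIsometryEquiv.norm_map]
          exact ha y hy _ hi') hb
        (by filter_upwards [hF] with a ha y hy using hasFDerivAt_iteratedFDeriv (ha y hy) hi')
      let L : ((Fin n → ℝ) [×(i + 1)]→L[ℝ] ℝ) →L[ℝ]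
          ((Fin n → ℝ) →L[ℝ] ((Fin n → ℝ) [×i]→L[ℝ] ℝ)) :=
        (continuousMultilinearCurryLeftEquiv ℝ (fun _ : Fin (i + 1) => Fin n → ℝ)
          ℝ).toContinuousLinearEquiv.toContinuousLinearMap
      have hc := ContinuousLinearMap.integral_comp_comm (𝕜 := ℝ)
        (Fₗ := (Fin n → ℝ) →L[ℝ] ((Fin n → ℝ) [×i]→L[ℝ] ℝ)) L (hint hi' y hy)
      change HasFDerivAt _ (∫ a, L (iteratedFDeriv ℝ (i + 1) (F a) y) ∂μ) y at hd
      rw [hc] at hd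
      exact hd.hasFDerivWithinAt
    · have hi' : i ≤ k := by exact_mod_cast hi
      intro y hy
      refine (continuousAt_of_dominated (bound := b)
        (by filter_upwards [hU.mem_nhds hy] with y hy using hmeas hi' y hy) ?_ hb ?_).continuousWithinAt
      · filter_upwards [hU.mem_nhds hy] with y hy
        filter_upwards [hbd] with a ha using ha y hy _ hi'
      · filter_upwards [hF] with a ha
        exact (ha y hy).continuousAt_iteratedFDeriv (by exact_mod_cast hi')
  refine ⟨by exact_mod_cast hT.contDiffOn, fun y hy i hi => ?_⟩
  have := hT.eq_iteratedFDerivWithin_of_uniqueDiffOn (m := i) (by exact_mod_cast hi)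
    hU.uniqueDiffOn hy
  rw [iteratedFDerivWithin_of_isOpen i hU hy] at this
  exact this.symm

end Parametric

/-! ### Smoothness in the positions away from coincidences -/

/-- The configurations whose points are more than `δ` apart. -/
def separated (n : ℕ) (δ : ℝ) : Set (Fin n → ℝ) := {y | ∀ i j, i ≠ j → δ < |y i - y j|}

lemma isOpen_separated (n : ℕ) (δ : ℝ) : IsOpen (separated n δ) := by
  have : separated n δ = ⋂ i, ⋂ j, ⋂ (_ : i ≠ j), {y : Fin n → ℝ | δ < |y i - y j|} := by
    ext y; simp [separated]
  rw [this]
  refine isOpen_iInter_of_finite fun i => isOpen_iInter_of_finite fun j =>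
    isOpen_iInter_of_finite fun _ => isOpen_lt continuous_const (by fun_prop)

lemma exists_mem_separated {n : ℕ} {y : Fin n → ℝ} (hy : Function.Injective y) :
    ∃ δ, 0 < δ ∧ y ∈ separated n δ := by
  have h : ∀ p : Fin n × Fin n, ∃ δ, 0 < δ ∧ (p.1 ≠ p.2 → δ < |y p.1 - y p.2|) := fun p => by
    by_cases hp : p.1 = p.2
    · exact ⟨1, one_pos, fun h => (h hp).elim⟩
    · have : 0 < |y p.1 - y p.2| := abs_pos.2 (sub_ne_zero.2 fun h => hp (hy h))
      exact ⟨_, half_pos this, fun _ => by linarith⟩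
  choose d hd0 hd using h
  obtain ⟨δ, hδ, h⟩ : ∃ δ, 0 < δ ∧ ∀ p, δ ≤ d p := by
    rcases isEmpty_or_nonempty (Fin n × Fin n) with he | he
    · exact ⟨1, one_pos, fun p => (he.false p).elim⟩
    · exact ⟨Finset.univ.inf' Finset.univ_nonempty d, by simpa using hd0,
        fun p => Finset.inf'_le _ (Finset.mem_univ p)⟩
  exact ⟨δ, hδ, fun i j hij => (h (i, j)).trans_lt (hd (i, j) hij)⟩

/-- The restriction of a configuration to some of its indices. -/
noncomputable def reindex {k n : ℕ} (e : Fin k → Fin n) : (Fin n → ℝ) →L[ℝ] (Fin k → ℝ) :=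
  ContinuousLinearMap.pi fun i => ContinuousLinearMap.proj (e i)

lemma norm_reindex_le {k n : ℕ} (e : Fin k → Fin n) : ‖reindex e‖ ≤ 1 := by
  refine ContinuousLinearMap.opNorm_le_bound _ zero_le_one fun y => ?_
  rw [one_mul, pi_norm_le_iff_of_nonneg (norm_nonneg _)]
  exact fun i => norm_le_pi_norm y (e i)

lemma reindex_mem_separated {k n : ℕ} {e : Fin k → Fin n} (he : Function.Injective e) {δ : ℝ}
    {y : Fin n → ℝ} (hy : y ∈ separated n δ) : reindex e y ∈ separated k δ :=
  fun i j hij => hy (e i) (e j) fun h => hij (he h)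

/-- A family of functions of `n` points is `C²` at separated configurations, with derivatives
dominated by a negative power of time and Gaussian tails around all points indexed by `J`. -/
def HasGaussianBound {n : ℕ} (δ T : ℝ) (M : ℕ) (J : Set (Fin n))
    (Φ : ℝ → ℝ → (Fin n → ℝ) → ℝ) : Prop :=
  ∃ C c : ℝ, 0 ≤ C ∧ 0 < c ∧ ∀ s, 0 < s → s ≤ T → ∀ z, ∀ y ∈ separated n δ,
    ContDiffAt ℝ 2 (Φ s z) y ∧ ∀ i ≤ 2, ∀ j ∈ J,
      ‖iteratedFDeriv ℝ i (Φ s z) y‖ ≤ C * (√s)⁻¹ ^ M * Real.exp (-c * (z - y j) ^ 2 / s)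

section

variable {n : ℕ} {δ T : ℝ} {M : ℕ} {J : Set (Fin n)} {Φ Ψ : ℝ → ℝ → (Fin n → ℝ) → ℝ}

lemma exp_neg_mul_sq_div_anti {c c' s : ℝ} (hs : 0 < s) (h : c ≤ c') (w : ℝ) :
    Real.exp (-c' * w ^ 2 / s) ≤ Real.exp (-c * w ^ 2 / s) := by
  rw [Real.exp_le_exp]
  have : 0 ≤ w ^ 2 := sq_nonneg w
  gcongr

/-- A function of a subconfiguration decays only around the points it sees, which is why the index
set shrinks to the range of `e`. Restriction has norm at most one, so the chain rule costs no
constant. -/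
lemma HasGaussianBound.reindex {k : ℕ} {Φ : ℝ → ℝ → (Fin k → ℝ) → ℝ}
    (h : HasGaussianBound δ T M Set.univ Φ) {e : Fin k → Fin n} (he : Function.Injective e) :
    HasGaussianBound δ T M (Set.range e) (fun s z y => Φ s z (fun i => y (e i))) := by
  obtain ⟨C, c, hC, hc, H⟩ := h
  refine ⟨C, c, hC, hc, fun s hs hsT z y hy => ?_⟩
  have hU := isOpen_separated k δ
  have hy' := reindex_mem_separated he hy
  refine ⟨(H s hs hsT z _ hy').1.comp y (BBM.reindex e).contDiff.contDiffAt, fun i hi j hj => ?_⟩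
  obtain ⟨l, rfl⟩ := hj
  have hd : ContDiffOn ℝ 2 (Φ s z) (separated k δ) := fun w hw =>
    (H s hs hsT z w hw).1.contDiffWithinAt
  have hV : IsOpen (BBM.reindex e ⁻¹' separated k δ) := hU.preimage (BBM.reindex e).continuous
  have h1 := (BBM.reindex e).iteratedFDerivWithin_comp_right hd hU.uniqueDiffOn hV.uniqueDiffOn hy'
    (i := i) (by exact_mod_cast hi)
  rw [iteratedFDerivWithin_of_isOpen i hV hy', iteratedFDerivWithin_of_isOpen i hU hy'] at h1
  change ‖iteratedFDeriv ℝ i (Φ s z ∘ BBM.reindex e) y‖ ≤ _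
  rw [h1]
  calc _ ≤ ‖iteratedFDeriv ℝ i (Φ s z) (BBM.reindex e y)‖ * ∏ _i : Fin i, ‖BBM.reindex e‖ :=
        ContinuousMultilinearMap.norm_compContinuousLinearMap_le _ _
    _ ≤ ‖iteratedFDeriv ℝ i (Φ s z) (BBM.reindex e y)‖ * 1 :=
        mul_le_mul_of_nonneg_left (Finset.prod_le_one (fun _ _ => norm_nonneg _)
          fun _ _ => norm_reindex_le e) (norm_nonneg _)
    _ ≤ _ := by rw [mul_one]; exact (H s hs hsT z _ hy').2 i hi l trivial

/-- Leibniz rule; the constant `4` bounds the sum `2^i` of the binomial coefficients for `i ≤ 2`. -/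
lemma norm_iteratedFDeriv_mul_le_of_bound {f g : (Fin n → ℝ) → ℝ} {U : Set (Fin n → ℝ)}
    (hU : IsOpen U) (hf : ∀ y ∈ U, ContDiffAt ℝ 2 f y) (hg : ∀ y ∈ U, ContDiffAt ℝ 2 g y)
    {y : Fin n → ℝ} (hy : y ∈ U) {A B : ℝ} (hA : 0 ≤ A)
    (hfA : ∀ i ≤ 2, ‖iteratedFDeriv ℝ i f y‖ ≤ A) (hgB : ∀ i ≤ 2, ‖iteratedFDeriv ℝ i g y‖ ≤ B)
    {i : ℕ} (hi : i ≤ 2) : ‖iteratedFDeriv ℝ i (fun y => f y * g y) y‖ ≤ 4 * (A * B) := by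
  have h1 := norm_iteratedFDerivWithin_mul_le (𝕜 := ℝ) (fun y hy => (hf y hy).contDiffWithinAt)
    (fun y hy => (hg y hy).contDiffWithinAt) hU.uniqueDiffOn hy (n := i) (by exact_mod_cast hi)
  rw [iteratedFDerivWithin_of_isOpen i hU hy] at h1
  refine h1.trans ?_
  have hB : 0 ≤ B := (norm_nonneg _).trans (hgB 0 (by omega))
  calc _ ≤ ∑ l ∈ Finset.range (i + 1), (i.choose l : ℝ) * (A * B) := by
        refine Finset.sum_le_sum fun l hl => ?_
        have hl' : l ≤ i := by simpa [Nat.lt_succ_iff] using hl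
        rw [iteratedFDerivWithin_of_isOpen l hU hy, iteratedFDerivWithin_of_isOpen (i - l) hU hy,
          mul_assoc]
        exact mul_le_mul_of_nonneg_left (mul_le_mul (hfA l (by omega)) (hgB _ (by omega))
          (norm_nonneg _) hA) (by positivity)
    _ = (2 ^ i : ℕ) * (A * B) := by
        rw [← Finset.sum_mul, ← Nat.sum_range_choose]; push_cast; rfl
    _ ≤ _ := by
        have : ((2 ^ i : ℕ) : ℝ) ≤ 4 := by
          exact_mod_cast (Nat.pow_le_pow_right (by norm_num) hi).trans (by norm_num)
        exact mul_le_mul_of_nonneg_right this (mul_nonneg hA hB)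

/-- With `r = s^(-1/2)` one has `r^M ≤ 1 + r^(2M)` and `(κ r²)^M exp(-κ r²) ≤ M!`. -/
lemma exists_pow_mul_exp_neg_le (M : ℕ) {κ : ℝ} (hκ : 0 < κ) :
    ∃ D : ℝ, 0 ≤ D ∧ ∀ s, 0 < s → (√s)⁻¹ ^ M * Real.exp (-κ / s) ≤ D := by
  refine ⟨1 + M.factorial / κ ^ M, by positivity, fun s hs => ?_⟩
  have hr : 0 < (√s)⁻¹ := inv_pos.2 (Real.sqrt_pos.2 hs)
  set r := (√s)⁻¹ with hrdef
  have hs' : -κ / s = -(κ * r ^ 2) := by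
    rw [hrdef, inv_pow, Real.sq_sqrt hs.le]; ring
  have h1 := Real.pow_div_factorial_le_exp (κ * r ^ 2) (by positivity) M
  have h2 : (κ * r ^ 2) ^ M * Real.exp (-(κ * r ^ 2)) ≤ M.factorial := by
    rw [Real.exp_neg]
    rw [div_le_iff₀ (by positivity)] at h1
    rw [← div_eq_mul_inv, div_le_iff₀ (Real.exp_pos _)]
    linarith
  have h3 : r ^ M ≤ 1 + (r ^ 2) ^ M := by
    rw [← pow_mul, mul_comm 2 M, pow_mul]
    nlinarith [sq_nonneg (r ^ M - 1)]
  have h4 : Real.exp (-(κ * r ^ 2)) ≤ 1 := Real.exp_le_one_iff.2 (by nlinarith [sq_nonneg r])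
  rw [hs']
  calc _ ≤ (1 + (r ^ 2) ^ M) * Real.exp (-(κ * r ^ 2)) :=
        mul_le_mul_of_nonneg_right h3 (Real.exp_pos _).le
    _ = Real.exp (-(κ * r ^ 2)) + ((κ * r ^ 2) ^ M * Real.exp (-(κ * r ^ 2))) / κ ^ M := by
        rw [mul_pow]; field_simp
    _ ≤ _ := add_le_add h4 (by gcongr)

/-- The product of two families that are concentrated around complementary sets of points is
bounded near time zero. -/
lemma HasGaussianBound.mul {M' : ℕ} {J' : Set (Fin n)} (hδ : 0 < δ)
    (h : HasGaussianBound δ T M J Φ) (h' : HasGaussianBound δ T M' J' Ψ)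
    (hJ : J.Nonempty) (hJ' : J'.Nonempty) (hd : Disjoint J J') (hu : J ∪ J' = Set.univ) :
    HasGaussianBound δ T 0 Set.univ (fun s z y => Φ s z y * Ψ s z y) := by
  obtain ⟨C, c, hC, hc, H⟩ := h
  obtain ⟨C', c', hC', hc', H'⟩ := h'
  set k := min c c' with hk
  have hk0 : 0 < k := lt_min hc hc'
  -- The two points satisfy `(z - y p)² + (z - y q)² ≥ δ²/2`. One half of the exponent `k` is spent
  -- on this lower bound to absorb the powers of `s`; the other half keeps the decay around `y j`.
  obtain ⟨D, hD0, hD⟩ := exists_pow_mul_exp_neg_le (M + M') (κ := k / 2 * (δ ^ 2 / 2)) (by positivity)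
  refine ⟨4 * (C * C' * D), k / 2, by positivity, by positivity, fun s hs hsT z y hy =>
    ⟨(H s hs hsT z y hy).1.mul (H' s hs hsT z y hy).1, fun i hi j _ => ?_⟩⟩
  have key : ∀ p ∈ J, ∀ q ∈ J', (j = p ∨ j = q) →
      ‖iteratedFDeriv ℝ i (fun y => Φ s z y * Ψ s z y) y‖ ≤
        4 * (C * C' * D) * (√s)⁻¹ ^ 0 * Real.exp (-(k / 2) * (z - y j) ^ 2 / s) := by
    intro p hp q hq hj
    have hpq : p ≠ q := fun e => Set.disjoint_left.1 hd hp (e ▸ hq)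
    have h1 := norm_iteratedFDeriv_mul_le_of_bound (isOpen_separated n δ)
      (fun y hy => (H s hs hsT z y hy).1) (fun y hy => (H' s hs hsT z y hy).1) hy
      (by positivity) (fun i hi => (H s hs hsT z y hy).2 i hi p hp)
      (fun i hi => (H' s hs hsT z y hy).2 i hi q hq) hi
    refine h1.trans ?_
    have e1 := exp_neg_mul_sq_div_anti hs (min_le_left c c') (z - y p)
    have e2 := exp_neg_mul_sq_div_anti hs (min_le_right c c') (z - y q)
    have e3 : Real.exp (-k * (z - y p) ^ 2 / s) * Real.exp (-k * (z - y q) ^ 2 / s) ≤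
        Real.exp (-(k / 2 * (δ ^ 2 / 2)) / s) * Real.exp (-(k / 2) * (z - y j) ^ 2 / s) := by
      rw [← Real.exp_add, ← Real.exp_add, Real.exp_le_exp, ← add_div, ← add_div]
      apply div_le_div_of_nonneg_right _ hs.le
      have hdist := hy p q hpq
      have h2 : δ ^ 2 ≤ (y p - y q) ^ 2 := by
        rw [← sq_abs (y p - y q)]; gcongr
      have h3 : (y p - y q) ^ 2 ≤ 2 * ((z - y p) ^ 2 + (z - y q) ^ 2) := by
        nlinarith [sq_nonneg ((z - y p) + (z - y q))]
      have h5 : (z - y j) ^ 2 ≤ (z - y p) ^ 2 + (z - y q) ^ 2 := by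
        rcases hj with e | e <;> rw [e] <;> nlinarith [sq_nonneg (z - y p), sq_nonneg (z - y q)]
      nlinarith
    calc _ ≤ 4 * ((C * (√s)⁻¹ ^ M * Real.exp (-k * (z - y p) ^ 2 / s)) *
          (C' * (√s)⁻¹ ^ M' * Real.exp (-k * (z - y q) ^ 2 / s))) := by gcongr
      _ = 4 * (C * C') * (√s)⁻¹ ^ (M + M') *
          (Real.exp (-k * (z - y p) ^ 2 / s) * Real.exp (-k * (z - y q) ^ 2 / s)) := by
          rw [pow_add]; ring
      _ ≤ 4 * (C * C') * (√s)⁻¹ ^ (M + M') * (Real.exp (-(k / 2 * (δ ^ 2 / 2)) / s) *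
          Real.exp (-(k / 2) * (z - y j) ^ 2 / s)) := by gcongr
      _ = 4 * (C * C') * ((√s)⁻¹ ^ (M + M') * Real.exp (-(k / 2 * (δ ^ 2 / 2)) / s)) *
          Real.exp (-(k / 2) * (z - y j) ^ 2 / s) := by ring
      _ ≤ 4 * (C * C') * D * Real.exp (-(k / 2) * (z - y j) ^ 2 / s) := by
          gcongr
          exact hD s hs
      _ = _ := by ring
  obtain ⟨p, hp⟩ := hJ
  obtain ⟨q, hq⟩ := hJ'
  rcases (hu ▸ Set.mem_univ j : j ∈ J ∪ J') with hj | hj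
  · exact key j hj q hq (Or.inl rfl)
  · exact key p hp j hj (Or.inr rfl)

lemma HasGaussianBound.add (h : HasGaussianBound δ T M J Φ) (h' : HasGaussianBound δ T M J Ψ) :
    HasGaussianBound δ T M J (fun s z y => Φ s z y + Ψ s z y) := by
  obtain ⟨C, c, hC, hc, H⟩ := h
  obtain ⟨C', c', hC', hc', H'⟩ := h'
  refine ⟨C + C', min c c', by positivity, lt_min hc hc', fun s hs hsT z y hy =>
    ⟨(H s hs hsT z y hy).1.add (H' s hs hsT z y hy).1, fun i hi j hj => ?_⟩⟩
  have e1 := exp_neg_mul_sq_div_anti hs (min_le_left c c') (z - y j)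
  have e2 := exp_neg_mul_sq_div_anti hs (min_le_right c c') (z - y j)
  have h1 := iteratedFDeriv_add_apply (𝕜 := ℝ) (i := i)
    ((H s hs hsT z y hy).1.of_le (by exact_mod_cast hi))
    ((H' s hs hsT z y hy).1.of_le (by exact_mod_cast hi))
  change ‖iteratedFDeriv ℝ i (Φ s z + Ψ s z) y‖ ≤ _
  rw [h1]
  calc _ ≤ _ := norm_add_le _ _
    _ ≤ _ := add_le_add ((H s hs hsT z y hy).2 i hi j hj) ((H' s hs hsT z y hy).2 i hi j hj)
    _ ≤ C * (√s)⁻¹ ^ M * Real.exp (-(min c c') * (z - y j) ^ 2 / s) +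
        C' * (√s)⁻¹ ^ M * Real.exp (-(min c c') * (z - y j) ^ 2 / s) := by gcongr
    _ = _ := by ring

lemma hasGaussianBound_zero : HasGaussianBound δ T M J (fun _ _ _ => 0) := by
  refine ⟨0, 1, le_rfl, one_pos, fun s _ _ z y _ => ⟨contDiffAt_const, fun i _ j _ => ?_⟩⟩
  have : iteratedFDeriv ℝ i (fun _ : Fin n → ℝ => (0 : ℝ)) y = 0 := by
    rw [iteratedFDeriv_fun_zero]; rfl
  simp [this]

lemma hasGaussianBound_sum {ι : Type*} (u : Finset ι) {Φ : ι → ℝ → ℝ → (Fin n → ℝ) → ℝ}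
    (h : ∀ i ∈ u, HasGaussianBound δ T M J (Φ i)) :
    HasGaussianBound δ T M J (fun s z y => ∑ i ∈ u, Φ i s z y) := by
  classical
  induction u using Finset.induction_on with
  | empty => simpa using hasGaussianBound_zero
  | insert i u hi ih =>
    simp_rw [Finset.sum_insert hi]
    exact (h i (Finset.mem_insert_self _ _)).add (ih fun j hj => h j (Finset.mem_insert_of_mem hj))

lemma HasGaussianBound.const_mul (h : HasGaussianBound δ T M J Φ) {a : ℝ → ℝ} {A : ℝ}
    (ha : ∀ s, 0 < s → s ≤ T → |a s| ≤ A) :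
    HasGaussianBound δ T M J (fun s z y => a s * Φ s z y) := by
  obtain ⟨C, c, hC, hc, H⟩ := h
  refine ⟨|A| * C, c, by positivity, hc, fun s hs hsT z y hy =>
    ⟨contDiffAt_const.mul (H s hs hsT z y hy).1, fun i hi j hj => ?_⟩⟩
  have h1 := iteratedFDeriv_const_smul_apply (𝕜 := ℝ) (i := i) (a := a s)
    ((H s hs hsT z y hy).1.of_le (by exact_mod_cast hi))
  change ‖iteratedFDeriv ℝ i (a s • Φ s z) y‖ ≤ _
  rw [h1, norm_smul]
  calc _ ≤ |A| * (C * (√s)⁻¹ ^ M * Real.exp (-c * (z - y j) ^ 2 / s)) :=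
        mul_le_mul ((ha s hs hsT).trans (le_abs_self A)) ((H s hs hsT z y hy).2 i hi j hj)
          (norm_nonneg _) (abs_nonneg _)
    _ = _ := by ring

end

/-- Cauchy–Schwarz: the difference of the two sides is a square divided by a positive number. -/
lemma add_sq_div_add_le {a b : ℝ} (ha : 0 < a) (hb : 0 < b) (u v : ℝ) :
    (u + v) ^ 2 / (a + b) ≤ u ^ 2 / a + v ^ 2 / b := by
  have : u ^ 2 / a + v ^ 2 / b - (u + v) ^ 2 / (a + b) = (b * u - a * v) ^ 2 / (a * b * (a + b)) := by
    field_simp; ring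
  have h2 : 0 ≤ (b * u - a * v) ^ 2 / (a * b * (a + b)) := by positivity
  linarith

/-- Half of the Gaussian exponent is kept as a kernel of doubled variance, which still integrates to
one; the other half is free to be spent on transporting decay from `z` to `x`. -/
lemma heatKernel_eq_mul_double {r : ℝ} (hr : 0 < r) (u : ℝ) :
    heatKernel r u = √2 * heatKernel (2 * r) u * Real.exp (-(1 / 4) * (u ^ 2 / r)) := by
  unfold heatKernel
  have h1 : √(2 * Real.pi * (2 * r)) = √2 * √(2 * Real.pi * r) := by
    rw [← Real.sqrt_mul (by norm_num)]; congr 1; ring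
  have h2 : -u ^ 2 / (2 * r) = -u ^ 2 / (2 * (2 * r)) + -(1 / 4) * (u ^ 2 / r) := by
    field_simp; ring
  rw [h1, h2, Real.exp_add]
  have : √2 ≠ 0 := by positivity
  field_simp

/-- The spare factor `exp(-(x - z)²/(4(t - s)))` and the decay around `w` at time `s` combine, by
convexity, to decay of `x` around `w` at time `t`. The spare exponent is `1/4`, whence `k ≤ 1/4`. -/
lemma heatKernel_mul_exp_le {t s k : ℝ} (hs : 0 < s) (hst : s < t) (hk : 0 < k) (hk4 : k ≤ 1 / 4)
    (x z w : ℝ) :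
    heatKernel (t - s) (x - z) * Real.exp (-k * (z - w) ^ 2 / s) ≤
      √2 * heatKernel (2 * (t - s)) (x - z) * Real.exp (-k * (x - w) ^ 2 / t) := by
  have hts : 0 < t - s := sub_pos.2 hst
  rw [heatKernel_eq_mul_double hts, mul_assoc _ (Real.exp _), ← Real.exp_add]
  refine mul_le_mul_of_nonneg_left (Real.exp_le_exp.2 ?_)
    (mul_nonneg (by positivity) (heatKernel_nonneg _ _))
  have h1 := add_sq_div_add_le hts hs (x - z) (z - w)
  have h2 : x - z + (z - w) = x - w := by ring
  rw [h2, sub_add_cancel] at h1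
  have h3 : 0 ≤ (x - z) ^ 2 / (t - s) := by positivity
  have h4 := mul_le_mul_of_nonneg_left h1 hk.le
  have e1 : -k * (x - w) ^ 2 / t = -(k * ((x - w) ^ 2 / t)) := by ring
  have e2 : -k * (z - w) ^ 2 / s = -(k * ((z - w) ^ 2 / s)) := by ring
  rw [e1, e2]
  nlinarith

lemma integrable_heatKernel_double (t x : ℝ) :
    Integrable (fun q : ℝ × ℝ => heatKernel (2 * (t - q.1)) (x - q.2)) (earlyMeasure t) ∧
      ∫ q, heatKernel (2 * (t - q.1)) (x - q.2) ∂(earlyMeasure t) = max t 0 := by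
  have hm : Measurable fun q : ℝ × ℝ => heatKernel (2 * (t - q.1)) (x - q.2) :=
    measurable_heatKernel.comp (by fun_prop : Measurable fun q : ℝ × ℝ => (2 * (t - q.1), x - q.2))
  have h1 : ∀ᵐ s ∂(volume.restrict (Set.Ioc 0 t)), ∫ z, heatKernel (2 * (t - s)) (x - z) = 1 := by
    filter_upwards [ae_restrict_Ioc_lt t] with s hs
    exact integral_heatKernel_sub (by linarith [hs.2]) x
  have hI : Integrable (fun q : ℝ × ℝ => heatKernel (2 * (t - q.1)) (x - q.2)) (earlyMeasure t) := by
    rw [integrable_prod_iff hm.aestronglyMeasurable]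
    constructor
    · filter_upwards [ae_restrict_Ioc_lt t] with s hs
      exact integrable_heatKernel_sub (by linarith [hs.2]) x
    · simp_rw [Real.norm_of_nonneg (heatKernel_nonneg _ _)]
      refine (integrable_const (1 : ℝ)).congr ?_
      filter_upwards [h1] with s hs using hs.symm
  refine ⟨hI, ?_⟩
  rw [integral_prod _ hI, integral_congr_ae h1]
  simp [measureReal_def, ENNReal.toReal_ofReal']

/-- Differentiation under the integral is dominated by the doubled kernel, whose total mass over
`(0, t]` is `t`. The bound on the source carries no negative power of `s`, so nothing is lost at
time zero. -/
lemma HasGaussianBound.duhamel {n : ℕ} {δ T : ℝ} {F : ℝ → ℝ → (Fin n → ℝ) → ℝ}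
    (h : HasGaussianBound δ T 0 Set.univ F) {p : (Fin n → ℝ) → ℝ}
    (hT : ∀ y, IsTame (fun s z => F s z y) (p y)) (hn : 1 ≤ n) :
    HasGaussianBound δ T 0 Set.univ (fun t x y => duhamel (fun s z => F s z y) t x) := by
  obtain ⟨C, c, hC, hc, H⟩ := h
  set k := min c (1 / 4) with hk
  have hk0 : 0 < k := lt_min hc (by norm_num)
  refine ⟨C * √2 * max T 0, k, by positivity, hk0, fun t ht htT x => ?_⟩
  have hU := isOpen_separated n δ
  set b : ℝ × ℝ → ℝ := fun q => √2 * heatKernel (2 * (t - q.1)) (x - q.2) with hb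
  have hbi : Integrable b (earlyMeasure t) := (integrable_heatKernel_double t x).1.const_mul _
  have hbI : ∫ q, b q ∂(earlyMeasure t) = √2 * t := by
    rw [hb, integral_const_mul, (integrable_heatKernel_double t x).2, max_eq_left ht.le]
  have hae : ∀ᵐ q ∂(earlyMeasure t), 0 < q.1 ∧ q.1 < t :=
    Measure.quasiMeasurePreserving_fst.ae (ae_restrict_Ioc_lt t)
  have hcd : ∀ q : ℝ × ℝ, 0 < q.1 ∧ q.1 < t → ∀ y ∈ separated n δ,
      ContDiffAt ℝ 2 (fun y => heatKernel (t - q.1) (x - q.2) * F q.1 q.2 y) y := fun q hq y hy =>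
    contDiffAt_const.mul (H q.1 hq.1 (hq.2.le.trans htT) q.2 y hy).1
  have hbd : ∀ q : ℝ × ℝ, 0 < q.1 ∧ q.1 < t → ∀ y ∈ separated n δ, ∀ i ≤ 2, ∀ j,
      ‖iteratedFDeriv ℝ i (fun y => heatKernel (t - q.1) (x - q.2) * F q.1 q.2 y) y‖ ≤
        b q * (C * Real.exp (-k * (x - y j) ^ 2 / t)) := by
    intro q hq y hy i hi j
    have hq1 := (H q.1 hq.1 (hq.2.le.trans htT) q.2 y hy)
    have h1 := iteratedFDeriv_const_smul_apply (𝕜 := ℝ) (i := i)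
      (a := heatKernel (t - q.1) (x - q.2)) (hq1.1.of_le (by exact_mod_cast hi))
    change ‖iteratedFDeriv ℝ i (heatKernel (t - q.1) (x - q.2) • F q.1 q.2) y‖ ≤ _
    rw [h1, norm_smul, Real.norm_of_nonneg (heatKernel_nonneg _ _)]
    have h2 := hq1.2 i hi j trivial
    have h3 := exp_neg_mul_sq_div_anti hq.1 (min_le_left c (1 / 4)) (q.2 - y j)
    have h4 := heatKernel_mul_exp_le hq.1 hq.2 hk0 (min_le_right _ _) x q.2 (y j)
    calc _ ≤ heatKernel (t - q.1) (x - q.2) * (C * Real.exp (-k * (q.2 - y j) ^ 2 / q.1)) := by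
          refine mul_le_mul_of_nonneg_left (h2.trans ?_) (heatKernel_nonneg _ _)
          rw [pow_zero, mul_one]
          exact mul_le_mul_of_nonneg_left h3 hC
      _ = C * (heatKernel (t - q.1) (x - q.2) * Real.exp (-k * (q.2 - y j) ^ 2 / q.1)) := by ring
      _ ≤ C * (b q * Real.exp (-k * (x - y j) ^ 2 / t)) := mul_le_mul_of_nonneg_left h4 hC
      _ = _ := by ring
  have hb0 : ∀ q, 0 ≤ b q := fun q => mul_nonneg (by positivity) (heatKernel_nonneg _ _)
  have key := contDiffOn_integral (μ := earlyMeasure t) (k := 2)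
    (F := fun q y => heatKernel (t - q.1) (x - q.2) * F q.1 q.2 y) (b := fun q => b q * C) hU
    (hbi.mul_const C)
    (fun y _ => ((hT y).measurable_integrand t x).aestronglyMeasurable)
    (by filter_upwards [hae] with q hq y hy using hcd q hq y hy)
    (by
      filter_upwards [hae] with q hq y hy i hi
      refine (hbd q hq y hy i hi ⟨0, hn⟩).trans (mul_le_mul_of_nonneg_left ?_ (hb0 q))
      refine mul_le_of_le_one_right hC (Real.exp_le_one_iff.2 ?_)
      rw [neg_mul, neg_div, neg_nonpos]
      positivity)
  have he : (fun y => BBM.duhamel (fun s z => F s z y) t x) =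
      fun y => ∫ q, heatKernel (t - q.1) (x - q.2) * F q.1 q.2 y ∂(earlyMeasure t) :=
    funext fun y => (hT y).duhamel_eq ht.le x
  intro y hy
  beta_reduce
  rw [he]
  refine ⟨(key.1.contDiffAt (hU.mem_nhds hy)), fun i hi j _ => ?_⟩
  rw [key.2 y hy i hi]
  have h1 := norm_integral_le_of_norm_le (hbi.mul_const (C * Real.exp (-k * (x - y j) ^ 2 / t)))
    (by filter_upwards [hae] with q hq using hbd q hq y hy i hi j)
  refine h1.trans ?_
  rw [integral_mul_const, hbI, pow_zero, mul_one]
  calc _ = C * √2 * t * Real.exp (-k * (x - y j) ^ 2 / t) := by ring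
    _ ≤ _ := by
      gcongr
      exact htT.trans (le_max_left _ _)

/-- Separation is vacuous for one point. The derivative of order `i` costs `s^(-(i+1)/2)`; all are
brought to the worst exponent `3` at the price of `(1 + √T)²`. -/
lemma hasGaussianBound_g_one (δ : ℝ) {T : ℝ} (hT : 0 < T) :
    HasGaussianBound δ T 3 Set.univ (g 1) := by
  have hT1 : 0 ≤ √T := Real.sqrt_nonneg T
  have hg : ∀ s z, g 1 s z = (fun r => Real.exp (-s) * heatKernel s (z - r)) ∘
      fun y : Fin 1 → ℝ => y 0 := fun s z => funext fun y => g_one s z y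
  have d0 : ∀ s z r, HasDerivAt (fun r => Real.exp (-s) * heatKernel s (z - r))
      (-(Real.exp (-s) * heatKernel₁ s (z - r))) r := fun s z r => by
    simpa using ((hasDerivAt_heatKernel s (z - r)).comp_const_sub z r).const_mul (Real.exp (-s))
  have d1 : ∀ s z r, HasDerivAt (fun r => -(Real.exp (-s) * heatKernel₁ s (z - r)))
      (Real.exp (-s) * heatKernel₂ s (z - r)) r := fun s z r => by
    refine (((hasDerivAt_heatKernel₁ s (z - r)).comp_const_sub z r).const_mul
      (Real.exp (-s))).fun_neg.congr_deriv ?_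
    ring
  have hsm : ∀ s z, ContDiff ℝ 2 (fun r => Real.exp (-s) * heatKernel s (z - r)) := fun s z => by
    unfold heatKernel; fun_prop
  refine ⟨4 * (1 + √T) ^ 2, 1 / 4, by positivity, by norm_num, fun s hs hsT z y _ => ?_⟩
  have hsq : 0 < √s := Real.sqrt_pos.2 hs
  have hsqT : √s ≤ √T := Real.sqrt_le_sqrt hsT
  rw [hg]
  refine ⟨((hsm s z).comp (contDiff_apply ℝ ℝ (0 : Fin 1))).contDiffAt, fun i hi j _ => ?_⟩
  rw [Subsingleton.elim j 0]
  have h1 := (ContinuousLinearMap.proj (R := ℝ) (φ := fun _ : Fin 1 => ℝ) 0).iteratedFDeriv_comp_right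
    (hsm s z) y (i := i) (by exact_mod_cast hi)
  change ‖iteratedFDeriv ℝ i ((fun r => Real.exp (-s) * heatKernel s (z - r)) ∘
    (ContinuousLinearMap.proj (R := ℝ) (φ := fun _ : Fin 1 => ℝ) 0)) y‖ ≤ _
  rw [h1]
  have hproj : ‖ContinuousLinearMap.proj (R := ℝ) (φ := fun _ : Fin 1 => ℝ) 0‖ ≤ 1 :=
    ContinuousLinearMap.opNorm_le_bound _ zero_le_one fun y => by
      rw [one_mul]; exact norm_le_pi_norm y 0
  have hE : Real.exp (-s) ≤ 1 := Real.exp_le_one_iff.2 (by linarith)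
  have hder : ∀ i ≤ 2, |iteratedDeriv i (fun r => Real.exp (-s) * heatKernel s (z - r)) (y 0)| ≤
      4 * (√s)⁻¹ ^ (i + 1) * Real.exp (-((z - y 0) ^ 2 / s) / 4) := by
    have hm : ∀ {a b : ℝ}, |a| ≤ b → |Real.exp (-s) * a| ≤ b := fun {a b} hab => by
      rw [abs_mul, abs_of_pos (Real.exp_pos _)]
      calc _ ≤ 1 * b := mul_le_mul hE hab (abs_nonneg _) zero_le_one
        _ = b := one_mul b
    intro i hi
    have e1 : deriv (fun r => Real.exp (-s) * heatKernel s (z - r)) =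
        fun r => -(Real.exp (-s) * heatKernel₁ s (z - r)) := funext fun r => (d0 s z r).deriv
    interval_cases i
    · rw [iteratedDeriv_zero]; exact hm (abs_heatKernel_le hs _)
    · rw [iteratedDeriv_one, e1, abs_neg]; exact hm (abs_heatKernel₁_le hs _)
    · rw [iteratedDeriv_succ, iteratedDeriv_one, e1, (d1 s z _).deriv]
      exact hm (abs_heatKernel₂_le hs _)
  calc _ ≤ _ := ContinuousMultilinearMap.norm_compContinuousLinearMap_le _ _
    _ ≤ ‖iteratedFDeriv ℝ i (fun r => Real.exp (-s) * heatKernel s (z - r)) (y 0)‖ * 1 :=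
        mul_le_mul_of_nonneg_left (Finset.prod_le_one (fun _ _ => norm_nonneg _)
          fun _ _ => hproj) (norm_nonneg _)
    _ ≤ 4 * (√s)⁻¹ ^ (i + 1) * Real.exp (-((z - y 0) ^ 2 / s) / 4) := by
        rw [mul_one, norm_iteratedFDeriv_eq_norm_iteratedDeriv]
        exact hder i hi
    _ = 4 * √s ^ (2 - i) * (√s)⁻¹ ^ 3 * Real.exp (-(1 / 4) * (z - y 0) ^ 2 / s) := by
        have h3 : (√s)⁻¹ ^ (i + 1) = √s ^ (2 - i) * (√s)⁻¹ ^ 3 := by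
          rw [show (√s)⁻¹ ^ 3 = (√s)⁻¹ ^ (2 - i) * (√s)⁻¹ ^ (i + 1) by
            rw [← pow_add]; congr 1; omega, ← mul_assoc, ← mul_pow,
            mul_inv_cancel₀ hsq.ne', one_pow, one_mul]
        rw [h3]; ring_nf
    _ ≤ _ := by
        have h4 : √s ^ (2 - i) ≤ (1 + √T) ^ 2 :=
          calc _ ≤ (1 + √T) ^ (2 - i) := by gcongr; linarith
            _ ≤ _ := pow_le_pow_right₀ (by linarith) (by omega)
        gcongr

lemma HasGaussianBound.symTensor {n k m : ℕ} {δ T : ℝ} {M M' : ℕ} (hδ : 0 < δ) (hkm : k + m = n)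
    (hk : 1 ≤ k) (hm : 1 ≤ m) {Φ : ℝ → ℝ → (Fin k → ℝ) → ℝ} {Ψ : ℝ → ℝ → (Fin m → ℝ) → ℝ}
    (h : HasGaussianBound δ T M Set.univ Φ) (h' : HasGaussianBound δ T M' Set.univ Ψ) :
    HasGaussianBound δ T 0 Set.univ (fun s z => symTensor hkm (Φ s z) (Ψ s z)) := by
  unfold BBM.symTensor
  refine HasGaussianBound.const_mul (a := fun _ => ((n.factorial : ℝ))⁻¹)
    (A := |((n.factorial : ℝ))⁻¹|) ?_ fun _ _ _ => le_rfl
  refine hasGaussianBound_sum _ fun σ _ => ?_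
  have i1 : Function.Injective fun i : Fin k => σ (Fin.cast hkm (Fin.castAdd m i)) := fun a b e => by
    simpa using e
  have i2 : Function.Injective fun i : Fin m => σ (Fin.cast hkm (Fin.natAdd k i)) := fun a b e => by
    simpa using e
  refine (h.reindex i1).mul hδ (h'.reindex i2) ⟨_, ⟨⟨0, hk⟩, rfl⟩⟩ ⟨_, ⟨⟨0, hm⟩, rfl⟩⟩ ?_ ?_
  · rw [Set.disjoint_left]
    rintro _ ⟨a, rfl⟩ ⟨b, hb⟩
    have := congrArg Fin.val (Fin.cast_injective _ (σ.injective hb))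
    simp at this
    omega
  · rw [Set.eq_univ_iff_forall]
    intro j
    obtain ⟨l, hl⟩ : ∃ l : Fin (k + m), σ (Fin.cast hkm l) = j :=
      ⟨Fin.cast hkm.symm (σ.symm j), by simp⟩
    induction l using Fin.addCases with
    | left i => exact Or.inl ⟨i, hl⟩
    | right i => exact Or.inr ⟨i, hl⟩

/-- Gaussian bounds for the spatial derivatives of `g n` at separated configurations. -/
theorem exists_hasGaussianBound_g {n : ℕ} (hn : 1 ≤ n) {δ T : ℝ} (hδ : 0 < δ) (hT : 0 < T) :
    ∃ M, HasGaussianBound δ T M Set.univ (g n) := by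
  induction n using Nat.strong_induction_on with
  | _ n ih =>
    rcases hn.eq_or_lt with rfl | hn
    · exact ⟨3, hasGaussianBound_g_one δ hT⟩
    · refine ⟨0, ?_⟩
      -- Whatever powers `M` and `M'` the factors carry, the products in the source carry none,
      -- since each permutation splits the points into two nonempty complementary groups.
      have hS : HasGaussianBound δ T 0 Set.univ (fun s z y => source n y s z) := by
        unfold source
        refine HasGaussianBound.const_mul (A := Real.exp T) ?_ fun s _ hsT => by
          rw [abs_of_pos (Real.exp_pos _)]; exact Real.exp_le_exp.2 hsT
        unfold symTensorSum
        refine hasGaussianBound_sum _ fun k _ => ?_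
        have := k.isLt
        obtain ⟨M, hM⟩ := ih (k + 1) (by omega) (by omega)
        obtain ⟨M', hM'⟩ := ih (n - (k + 1)) (by omega) (by omega)
        exact hM.symTensor hδ _ (by omega) (by omega) hM'
      have hD := hS.duhamel (fun y => isTame_source y ⟨0, by omega⟩) (by omega)
      have := hD.const_mul (a := fun s => Real.exp (-s)) (A := 1) fun s hs _ => by
        rw [abs_of_pos (Real.exp_pos _)]; exact Real.exp_le_one_iff.2 (by linarith)
      convert this using 4 with s z y
      exact g_eq_duhamel hn s z y

lemma contDiffAt_g {n : ℕ} (hn : 1 ≤ n) {t : ℝ} (ht : 0 < t) (x : ℝ) {y : Fin n → ℝ}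
    (hy : Function.Injective y) : ContDiffAt ℝ 2 (g n t x) y := by
  obtain ⟨δ, hδ, hyδ⟩ := exists_mem_separated hy
  obtain ⟨M, C, c, -, -, H⟩ := exists_hasGaussianBound_g hn hδ ht
  exact (H t ht le_rfl x y hyδ).1

/-! ### The densities -/

/-- The density of the positions on the event that there are `n` particles. -/
noncomputable def density (n : ℕ) (t : ℝ) (y : Fin n → ℝ) : ℝ := g n t 0 (fun i => -y i)

lemma density_eq_g (n : ℕ) (t x : ℝ) (y : Fin n → ℝ) :
    density n t y = g n t x (fun i => x - y i) := by
  rw [density, ← g_translate n t 0 x (fun i => -y i)]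
  simp only [zero_add, neg_add_eq_sub]

/-- Moving the configuration along the diagonal amounts to moving the starting point, so diagonal
derivatives of the density are `x`-derivatives of `g` and exist even where coordinates coincide. -/
lemma density_add (n : ℕ) (t h : ℝ) (y : Fin n → ℝ) :
    density n t (fun i => y i + h) = g n t h (fun i => -y i) := by
  rw [density_eq_g n t h]
  simp

lemma density_sub (n : ℕ) (t h : ℝ) (y : Fin n → ℝ) :
    density n t (fun i => y i - h) = g n t (-h) (fun i => -y i) := by
  simpa only [sub_eq_add_neg] using density_add n t (-h) y

lemma density_nonneg {n : ℕ} {t : ℝ} (ht : 0 ≤ t) (y : Fin n → ℝ) : 0 ≤ density n t y :=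
  g_nonneg ht _ _

lemma measurable_density (n : ℕ) : Measurable (fun p : ℝ × (Fin n → ℝ) => density n p.1 p.2) :=
  (measurable_g n).comp (by fun_prop :
    Measurable fun p : ℝ × (Fin n → ℝ) => ((p.1, (0 : ℝ)), fun i => -p.2 i))

lemma density_perm (n : ℕ) (t : ℝ) (y : Fin n → ℝ) (π : Equiv.Perm (Fin n)) :
    density n t (fun i => y (π i)) = density n t y :=
  g_perm n t 0 (fun i => -y i) π

lemma symTensorSum_density (n : ℕ) (t : ℝ) (y : Fin n → ℝ) :
    symTensorSum (fun k => density k t) n y = symTensorSum (fun k => g k t 0) n (fun i => -y i) :=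
  symTensorSum_congr fun _ _ _ _ => rfl

lemma contDiff_two_of_hasDerivAt {u u₁ u₂ : ℝ → ℝ} (h : ∀ x, HasDerivAt u (u₁ x) x)
    (h₁ : ∀ x, HasDerivAt u₁ (u₂ x) x) (hc : Continuous u₂) :
    ContDiff ℝ 2 u ∧ iteratedDeriv 2 u = u₂ := by
  have e1 : deriv u = u₁ := funext fun x => (h x).deriv
  have e2 : deriv u₁ = u₂ := funext fun x => (h₁ x).deriv
  constructor
  · rw [show (2 : WithTop ℕ∞) = 1 + 1 by norm_num, contDiff_succ_iff_deriv, e1]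
    refine ⟨fun x => (h x).differentiableAt, by simp, ?_⟩
    rw [contDiff_one_iff_deriv, e2]
    exact ⟨fun x => (h₁ x).differentiableAt, hc⟩
  · rw [iteratedDeriv_succ, iteratedDeriv_one, e1, e2]

lemma density_diagonal_equation {n : ℕ} (hn : 1 ≤ n) {t : ℝ} (ht : 0 < t) (y : Fin n → ℝ) :
    ContDiff ℝ 2 (fun h : ℝ => density n t (fun i => y i + h)) ∧
      HasDerivAt (fun s : ℝ => density n s y)
        (1 / 2 * iteratedDeriv 2 (fun h : ℝ => density n t (fun i => y i + h)) 0
          + symTensorSum (fun k => density k t) n y - density n t y) t := by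
  obtain ⟨u₁, u₂, hu, hut⟩ := exists_isRegular_g hn (fun i => -y i)
  have hc : Continuous (u₂ t) := continuous_iff_continuousAt.2 fun x =>
    ContinuousAt.comp (f := fun x : ℝ => (t, x)) (g := Function.uncurry u₂) (hu.cont₂ t ht x)
      (by fun_prop)
  obtain ⟨h1, h2⟩ := contDiff_two_of_hasDerivAt (hu.deriv t ht) (hu.deriv₁ t ht) hc
  simp_rw [density_add]
  refine ⟨h1, ?_⟩
  rw [h2, symTensorSum_density]
  exact hut t ht 0

lemma contDiffAt_density {n : ℕ} (hn : 1 ≤ n) {t : ℝ} (ht : 0 < t) {y : Fin n → ℝ}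
    (hy : Function.Injective y) : ContDiffAt ℝ 2 (density n t) y := by
  have h1 : ContDiffAt ℝ 2 (g n t 0) (fun i => -y i) :=
    contDiffAt_g hn ht 0 fun i j h => hy (neg_injective h)
  exact ContDiffAt.comp (g := g n t 0) (f := fun (y : Fin n → ℝ) (i : Fin n) => -y i) y h1
    (by fun_prop)

/-- The square of the sum of the partial derivatives is the second derivative along the
diagonal. -/
lemma sum_partialDeriv_partialDeriv {n : ℕ} {f : (Fin n → ℝ) → ℝ} {y : Fin n → ℝ}
    (hf : ContDiffAt ℝ 2 f y) :
    ∑ k : Fin n, ∑ l : Fin n, partialDeriv k (partialDeriv l f) y =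
      iteratedDeriv 2 (fun h : ℝ => f (fun i => y i + h)) 0 := by
  have hd : ∀ᶠ w in 𝓝 y, DifferentiableAt ℝ f w :=
    (hf.eventually (by simp)).mono fun w hw => hw.differentiableAt (by simp)
  have hfd : DifferentiableAt ℝ (fderiv ℝ f) y :=
    (hf.fderiv_right (m := 1) (by norm_num)).differentiableAt (by simp)
  set H := fderiv ℝ (fderiv ℝ f) y with hH
  have hp : ∀ k l, partialDeriv k (partialDeriv l f) y = H (Pi.single k 1) (Pi.single l 1) := by
    intro k l
    have e1 : partialDeriv l f =ᶠ[𝓝 y] fun w => fderiv ℝ f w (Pi.single l 1) := by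
      filter_upwards [hd] with w hw using hw.lineDeriv_eq_fderiv
    have e2 : HasFDerivAt (fun w => fderiv ℝ f w (Pi.single l 1))
        (H.flip (Pi.single l 1)) y :=
      (hfd.hasFDerivAt.clm_apply (hasFDerivAt_const (Pi.single l (1 : ℝ)) y)).congr_fderiv (by
        ext v; simp [hH])
    rw [partialDeriv, Filter.EventuallyEq.lineDeriv_eq e1,
      e2.differentiableAt.lineDeriv_eq_fderiv, e2.fderiv]
    rfl
  have hone : ∑ k : Fin n, (Pi.single k 1 : Fin n → ℝ) = fun _ => 1 := by
    ext j; simp [Finset.sum_apply, Pi.single_apply]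
  have hsum : ∑ k : Fin n, ∑ l : Fin n, partialDeriv k (partialDeriv l f) y =
      H (fun _ => 1) (fun _ => 1) := by
    simp_rw [hp, ← map_sum, hone]
    rw [← sum_apply, ← map_sum, hone]
  set γ : ℝ → Fin n → ℝ := fun h i => y i + h with hγ
  have hγd : ∀ h, HasDerivAt γ (fun _ => 1) h := fun h => by
    rw [hasDerivAt_pi]; intro i; exact (hasDerivAt_id h).const_add (y i)
  have hγ0 : γ 0 = y := by ext i; simp [hγ]
  have hev : ∀ᶠ h in 𝓝 (0 : ℝ), DifferentiableAt ℝ f (γ h) :=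
    (hγd 0).continuousAt.eventually (by rwa [hγ0])
  have e1 : deriv (fun h => f (γ h)) =ᶠ[𝓝 0] fun h => fderiv ℝ f (γ h) (fun _ => 1) := by
    filter_upwards [hev] with h hh
    exact (hh.hasFDerivAt.comp_hasDerivAt h (hγd h)).deriv
  have e2 : HasDerivAt (fun h => fderiv ℝ f (γ h) (fun _ => 1)) (H (fun _ => 1) (fun _ => 1)) 0 := by
    have h1 : HasFDerivAt (fderiv ℝ f) H (γ 0) := by rw [hγ0]; exact hfd.hasFDerivAt
    have h2 := h1.comp_hasDerivAt (0 : ℝ) (hγd 0)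
    exact (h2.clm_apply (hasDerivAt_const (0 : ℝ) (fun _ : Fin n => (1 : ℝ)))).congr_deriv (by simp)
  rw [hsum, iteratedDeriv_succ, iteratedDeriv_one, e1.deriv_eq, e2.deriv]

/-! ### Integration of product functions -/

lemma measurePreserving_split {k m n : ℕ} (e : Fin k ⊕ Fin m ≃ Fin n) :
    MeasurePreserving (fun y : Fin n → ℝ => ((fun i => y (e (Sum.inl i)), fun j => y (e (Sum.inr j))) :
      (Fin k → ℝ) × (Fin m → ℝ))) volume volume := by
  have h1 := (volume_measurePreserving_piCongrLeft (fun _ : Fin n => ℝ) e).symm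
  have h2 := volume_measurePreserving_sumPiEquivProdPi (fun _ : Fin k ⊕ Fin m => ℝ)
  exact h2.comp h1

/-- Because `∏ f (y i)` is symmetric, all `n!` permutations contribute the same product of two
integrals, and the average has no effect. This turns `⊗̂` into ordinary multiplication. -/
lemma lintegral_prod_mul_symTensor {k m n : ℕ} (h : k + m = n) {F : (Fin k → ℝ) → ℝ}
    {G : (Fin m → ℝ) → ℝ} (hF : Measurable F) (hG : Measurable G) (hF0 : ∀ y, 0 ≤ F y)
    (hG0 : ∀ y, 0 ≤ G y) {f : ℝ → ℝ≥0∞} (hf : Measurable f) :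
    ∫⁻ y : Fin n → ℝ, (∏ i, f (y i)) * ENNReal.ofReal (symTensor h F G y) =
      (∫⁻ y, (∏ i, f (y i)) * ENNReal.ofReal (F y)) *
        ∫⁻ y, (∏ i, f (y i)) * ENNReal.ofReal (G y) := by
  have hterm : ∀ σ : Equiv.Perm (Fin n), ∫⁻ y : Fin n → ℝ, (∏ i, f (y i)) *
      (ENNReal.ofReal (F fun i => y (σ (Fin.cast h (Fin.castAdd m i)))) *
        ENNReal.ofReal (G fun j => y (σ (Fin.cast h (Fin.natAdd k j))))) =
      (∫⁻ y, (∏ i, f (y i)) * ENNReal.ofReal (F y)) *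
        ∫⁻ y, (∏ i, f (y i)) * ENNReal.ofReal (G y) := by
    intro σ
    let e : Fin k ⊕ Fin m ≃ Fin n := (finSumFinEquiv.trans (finCongr h)).trans σ
    have hmp := measurePreserving_split e
    have hmeas : Measurable fun p : (Fin k → ℝ) × (Fin m → ℝ) =>
        ((∏ i, f (p.1 i)) * ENNReal.ofReal (F p.1)) * ((∏ i, f (p.2 i)) * ENNReal.ofReal (G p.2)) := by
      fun_prop
    have h1 := hmp.lintegral_comp hmeas
    have h2 := lintegral_prod_mul (μ := volume) (ν := volume)
      (f := fun y : Fin k → ℝ => (∏ i, f (y i)) * ENNReal.ofReal (F y))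
      (g := fun y : Fin m → ℝ => (∏ i, f (y i)) * ENNReal.ofReal (G y))
      (by fun_prop) (by fun_prop)
    rw [← h2, ← Measure.volume_eq_prod, ← h1]
    refine lintegral_congr fun y => ?_
    rw [← e.prod_comp, Fintype.prod_sum_type]
    simp only [e, Equiv.trans_apply, finSumFinEquiv_apply_left, finSumFinEquiv_apply_right,
      finCongr_apply]
    ring
  have hsum : ∀ y : Fin n → ℝ, ENNReal.ofReal (symTensor h F G y) =
      ENNReal.ofReal ((n.factorial : ℝ))⁻¹ * ∑ σ : Equiv.Perm (Fin n),
        (ENNReal.ofReal (F fun i => y (σ (Fin.cast h (Fin.castAdd m i)))) *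
        ENNReal.ofReal (G fun j => y (σ (Fin.cast h (Fin.natAdd k j))))) := fun y => by
    rw [symTensor, ENNReal.ofReal_mul (by positivity),
      ENNReal.ofReal_sum_of_nonneg fun σ _ => mul_nonneg (hF0 _) (hG0 _)]
    simp_rw [ENNReal.ofReal_mul (hF0 _)]
  have hm : ∀ σ : Equiv.Perm (Fin n), Measurable fun y : Fin n → ℝ => (∏ i, f (y i)) *
      (ENNReal.ofReal (F fun i => y (σ (Fin.cast h (Fin.castAdd m i)))) *
        ENNReal.ofReal (G fun j => y (σ (Fin.cast h (Fin.natAdd k j))))) := fun σ => by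
    have h1 : Measurable fun y : Fin n → ℝ => F fun i => y (σ (Fin.cast h (Fin.castAdd m i))) :=
      hF.comp (measurable_pi_lambda _ fun i => measurable_pi_apply _)
    have h2 : Measurable fun y : Fin n → ℝ => G fun i => y (σ (Fin.cast h (Fin.natAdd k i))) :=
      hG.comp (measurable_pi_lambda _ fun i => measurable_pi_apply _)
    fun_prop
  simp_rw [hsum, mul_left_comm (∏ i, f _), Finset.mul_sum]
  rw [lintegral_finsetSum _ fun σ _ => (hm σ).const_mul _]
  simp_rw [lintegral_const_mul _ (hm _), hterm]
  rw [Finset.sum_const, Finset.card_univ, Fintype.card_perm, Fintype.card_fin, nsmul_eq_mul,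
    ← mul_assoc, ENNReal.ofReal_inv_of_pos (by positivity), ENNReal.ofReal_natCast,
    ENNReal.mul_inv_cancel (by exact_mod_cast n.factorial_ne_zero) (ENNReal.natCast_ne_top _),
    one_mul]

/-! ### Symmetric measures are determined by product functions -/

lemma measure_box_comp_perm {n : ℕ} {μ : Measure (Fin n → ℝ)}
    (hμ : ∀ (σ : Equiv.Perm (Fin n)) (A : Set (Fin n → ℝ)), MeasurableSet A →
      μ {y | (fun i => y (σ i)) ∈ A} = μ A) {A : Fin n → Set ℝ} (hA : ∀ i, MeasurableSet (A i))
    (σ : Equiv.Perm (Fin n)) :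
    μ (Set.univ.pi fun i => A (σ i)) = μ (Set.univ.pi A) := by
  rw [← hμ σ (Set.univ.pi fun i => A (σ i)) (MeasurableSet.univ_pi fun i => hA _)]
  congr 1
  ext y
  simp only [Set.mem_pi, Set.mem_univ, true_implies, Set.mem_ofPred_eq]
  exact σ.forall_congr_right (q := fun i => y i ∈ A i)

/-- Expanding the product of sums gives one box for each choice function `κ` with values in `S`. -/
lemma lintegral_prod_indicator_sum {n : ℕ} (μ : Measure (Fin n → ℝ)) {A : Fin n → Set ℝ}
    (hA : ∀ i, MeasurableSet (A i)) (S : Finset (Fin n)) :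
    ∫⁻ y, ∏ j, (∑ i ∈ S, (A i).indicator 1 (y j)) ∂μ =
      ∑ κ ∈ Fintype.piFinset (fun _ : Fin n => S), μ (Set.univ.pi fun j => A (κ j)) := by
  have h1 : ∀ (κ : Fin n → Fin n) (y : Fin n → ℝ), ∏ j, (A (κ j)).indicator (1 : ℝ → ℝ≥0∞) (y j) =
      (Set.univ.pi fun j => A (κ j)).indicator 1 y := fun κ y => by
    by_cases hy : y ∈ Set.univ.pi fun j => A (κ j)
    · rw [Set.indicator_of_mem hy]
      exact Finset.prod_eq_one fun j _ => Set.indicator_of_mem (hy j trivial) _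
    · rw [Set.indicator_of_notMem hy]
      simp only [Set.mem_pi, Set.mem_univ, true_implies, not_forall] at hy
      obtain ⟨j, hj⟩ := hy
      exact Finset.prod_eq_zero (Finset.mem_univ j) (Set.indicator_of_notMem hj _)
  simp_rw [Finset.prod_univ_sum, h1]
  have hbox : ∀ κ : Fin n → Fin n, MeasurableSet (Set.univ.pi fun j => A (κ j)) := fun κ =>
    MeasurableSet.univ_pi fun j => hA _
  rw [lintegral_finsetSum _ fun κ _ => measurable_one.indicator (hbox κ)]
  exact Finset.sum_congr rfl fun κ _ => lintegral_indicator_one (hbox κ)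

lemma sum_piFinset_eq_sum_image {n : ℕ} (m : (Fin n → Fin n) → ℝ≥0∞) (S : Finset (Fin n)) :
    ∑ κ ∈ Fintype.piFinset (fun _ : Fin n => S), m κ =
      ∑ T ∈ S.powerset, ∑ κ with Finset.univ.image κ = T, m κ := by
  rw [← Finset.sum_fiberwise_of_maps_to (s := Fintype.piFinset (fun _ : Fin n => S))
    (t := S.powerset) (g := fun κ => Finset.univ.image κ)]
  · refine Finset.sum_congr rfl fun T hT => Finset.sum_congr ?_ fun _ _ => rfl
    ext κ
    simp only [Finset.mem_filter, Fintype.mem_piFinset, Finset.mem_univ, true_and,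
      and_iff_right_iff_imp]
    rintro rfl i
    exact Finset.mem_powerset.1 hT (Finset.mem_image_of_mem _ (Finset.mem_univ i))
  · intro κ hκ
    simp only [Fintype.mem_piFinset] at hκ
    simp only [Finset.mem_powerset, Finset.image_subset_iff]
    exact fun i _ => hκ i

/-- Polarization: two finite symmetric measures that agree on all functions `∏ f (y i)` are
equal. -/
theorem symmetric_measure_ext {n : ℕ} {μ ν : Measure (Fin n → ℝ)} [IsFiniteMeasure μ]
    (hμ : ∀ (σ : Equiv.Perm (Fin n)) (A : Set (Fin n → ℝ)), MeasurableSet A →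
      μ {y | (fun i => y (σ i)) ∈ A} = μ A)
    (hν : ∀ (σ : Equiv.Perm (Fin n)) (A : Set (Fin n → ℝ)), MeasurableSet A →
      ν {y | (fun i => y (σ i)) ∈ A} = ν A)
    (h : ∀ f : ℝ → ℝ≥0∞, Measurable f → ∫⁻ y, ∏ i, f (y i) ∂μ = ∫⁻ y, ∏ i, f (y i) ∂ν) :
    μ = ν := by
  have huniv : μ Set.univ = ν Set.univ := by simpa using h (fun _ => 1) measurable_const
  refine ext_of_generate_finite _ generateFrom_pi.symm isPiSystem_pi ?_ huniv
  rintro _ ⟨A, hA, rfl⟩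
  simp only [Set.mem_pi, Set.mem_univ, true_implies, Set.mem_ofPred_eq] at hA
  set mμ : (Fin n → Fin n) → ℝ≥0∞ := fun κ => μ (Set.univ.pi fun j => A (κ j)) with hmμ
  set mν : (Fin n → Fin n) → ℝ≥0∞ := fun κ => ν (Set.univ.pi fun j => A (κ j)) with hmν
  have hfin : ∀ κ, mμ κ ≠ ∞ := fun κ => measure_ne_top _ _
  have hS : ∀ S : Finset (Fin n), ∑ T ∈ S.powerset, ∑ κ with Finset.univ.image κ = T, mμ κ =
      ∑ T ∈ S.powerset, ∑ κ with Finset.univ.image κ = T, mν κ := fun S => by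
    rw [← sum_piFinset_eq_sum_image, ← sum_piFinset_eq_sum_image,
      ← lintegral_prod_indicator_sum μ hA, ← lintegral_prod_indicator_sum ν hA]
    exact h (fun r => ∑ i ∈ S, (A i).indicator 1 r)
      (Finset.measurable_fun_sum _ fun i _ => measurable_one.indicator (hA i))
  -- Inversion over the lattice of subsets: knowing the sums over `κ` with image contained in `S`,
  -- for every `S`, isolates the sum over image exactly `S`.
  have hT : ∀ S : Finset (Fin n), ∑ κ with Finset.univ.image κ = S, mμ κ =
      ∑ κ with Finset.univ.image κ = S, mν κ := fun S => by
    induction S using Finset.strongInduction with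
    | _ S ih =>
      have := hS S
      rw [← Finset.insert_erase (Finset.mem_powerset_self S),
        Finset.sum_insert (Finset.notMem_erase _ _), Finset.sum_insert (Finset.notMem_erase _ _)]
        at this
      have hrest : ∑ T ∈ S.powerset.erase S, ∑ κ with Finset.univ.image κ = T, mμ κ =
          ∑ T ∈ S.powerset.erase S, ∑ κ with Finset.univ.image κ = T, mν κ :=
        Finset.sum_congr rfl fun T hT => ih T
          ((Finset.mem_powerset.1 (Finset.mem_of_mem_erase hT)).ssubset_of_ne
            (Finset.ne_of_mem_erase hT))
      rw [← hrest] at this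
      exact (ENNReal.add_left_inj (ENNReal.sum_ne_top.2 fun T _ =>
        ENNReal.sum_ne_top.2 fun κ _ => hfin κ)).1 this
  -- Choice functions with full image are permutations, and by symmetry their boxes all have the
  -- measure of the original box.
  have hperm : ∀ {ρ : Measure (Fin n → ℝ)}, (∀ (σ : Equiv.Perm (Fin n)) (A : Set (Fin n → ℝ)),
      MeasurableSet A → ρ {y | (fun i => y (σ i)) ∈ A} = ρ A) →
      ∑ κ : Fin n → Fin n with Finset.univ.image κ = Finset.univ,
        ρ (Set.univ.pi fun j => A (κ j)) =
      (Finset.univ.filter fun κ : Fin n → Fin n => Finset.univ.image κ = Finset.univ).card *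
        ρ (Set.univ.pi A) := fun {ρ} hρ => by
    rw [← nsmul_eq_mul, ← Finset.sum_const]
    refine Finset.sum_congr rfl fun κ hκ => ?_
    have hsurj : Function.Surjective κ := by
      simpa [Finset.eq_univ_iff_forall, Function.Surjective] using hκ
    exact measure_box_comp_perm hρ hA (Equiv.ofBijective κ (Finite.surjective_iff_bijective.1 hsurj))
  have hfinal := hT Finset.univ
  rw [hmμ, hmν, hperm hμ, hperm hν] at hfinal
  refine (ENNReal.mul_right_inj ?_ (ENNReal.natCast_ne_top _)).1 hfinal
  have : 0 < (Finset.univ.filter fun κ : Fin n → Fin n => Finset.univ.image κ = Finset.univ).card :=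
    Finset.card_pos.2 ⟨id, by simp⟩
  exact_mod_cast this.ne'

/-! ### Measurable functionals of the driving data -/

/-- The value of a path at time `s`, reconstructed from its values at rational times. It depends
measurably on the path and on `s`, and is the actual value for continuous paths. -/
noncomputable def pathEval (w : ℝ≥0 → ℝ) (s : ℝ≥0) : ℝ :=
  limsup (fun k : ℕ => w ((⌊s * (k + 1)⌋₊ : ℝ≥0) / (k + 1))) atTop

/-- At each level `k` only countably many times are evaluated. This is what allows a path from the
product space to be evaluated measurably at a random time. -/
lemma measurable_pathEval : Measurable (fun p : (ℝ≥0 → ℝ) × ℝ≥0 => pathEval p.1 p.2) := by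
  unfold pathEval
  refine Measurable.limsup fun k => ?_
  have h1 : Measurable fun q : (ℝ≥0 → ℝ) × ℕ => q.1 ((q.2 : ℝ≥0) / (k + 1)) :=
    measurable_from_prod_countable_left fun m =>
      (measurable_pi_apply ((m : ℝ≥0) / (k + 1)) : Measurable fun w : ℝ≥0 → ℝ => w _)
  exact h1.comp (measurable_fst.prodMk
    (Nat.measurable_floor.comp (measurable_snd.mul_const ((k : ℝ≥0) + 1))))

lemma tendsto_floor_mul_div (s : ℝ≥0) :
    Tendsto (fun k : ℕ => (⌊s * (k + 1)⌋₊ : ℝ≥0) / (k + 1)) atTop (𝓝 s) := by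
  rw [← NNReal.tendsto_coe]
  have h1 : Tendsto (fun k : ℕ => (k : ℝ) + 1) atTop atTop :=
    tendsto_atTop_add_const_right _ _ tendsto_natCast_atTop_atTop
  refine ((tendsto_nat_floor_mul_div_atTop s.2).comp h1).congr fun k => ?_
  have : ⌊(s : ℝ) * ((k : ℝ) + 1)⌋₊ = ⌊s * ((k : ℝ≥0) + 1)⌋₊ := by
    rw [← NNReal.coe_one, ← NNReal.coe_natCast, ← NNReal.coe_add, ← NNReal.coe_mul]
    exact Nonneg.nat_floor_coe _
  simp [this]

lemma pathEval_of_continuous {w : ℝ≥0 → ℝ} (hw : Continuous w) (s : ℝ≥0) : pathEval w s = w s :=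
  ((hw.tendsto s).comp (tendsto_floor_mul_div s)).limsup_eq

attribute [irreducible] pathEval

/-- The lifetime and the displacements of every particle. -/
abbrev Data : Type := List Bool → ℝ × (ℝ≥0 → ℝ)

/-- The data of the descendants of a child of the initial particle. -/
def Data.child (d : Data) (b : Bool) : Data := fun v => d (b :: v)

/-- The lifetimes. -/
def Data.lifetime (d : Data) (v : List Bool) : ℝ := (d v).1

/-- The displacements. -/
noncomputable def Data.motion (d : Data) (v : List Bool) (s : ℝ≥0) : ℝ := pathEval (d v).2 s

lemma measurable_child (b : Bool) : Measurable (fun d : Data => d.child b) :=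
  measurable_pi_lambda _ fun _ => measurable_pi_apply _

lemma measurable_lifetime (v : List Bool) : Measurable (fun d : Data => d.lifetime v) := by
  have h : Measurable fun d : Data => d v := measurable_pi_apply v
  exact h.fst

lemma measurable_motion (v : List Bool) :
    Measurable (fun p : Data × ℝ≥0 => p.1.motion v p.2) := by
  have h1 : Measurable fun d : Data => d v := measurable_pi_apply v
  have h2 : Measurable fun p : Data × ℝ≥0 => ((p.1 v).2, p.2) :=
    (h1.comp measurable_fst).snd.prodMk measurable_snd
  have h3 := measurable_pathEval.comp h2
  exact h3

lemma measurable_birthTime (v : List Bool) :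
    Measurable (fun d : Data => birthTime d.lifetime v) := by
  induction v with
  | nil => exact measurable_const
  | cons b v ih => exact (measurable_lifetime []).add (ih.comp (measurable_child b))

lemma measurable_motion_lifetime :
    Measurable (fun d : Data => d.motion [] (d.lifetime []).toNNReal) := by
  have h : Measurable fun d : Data => (d, (d.lifetime []).toNNReal) :=
    measurable_id.prodMk (measurable_lifetime []).real_toNNReal
  exact (measurable_motion []).comp h

lemma measurable_birthPlace (v : List Bool) :
    Measurable (fun d : Data => birthPlace d.lifetime d.motion v) := by
  induction v with
  | nil => exact measurable_const
  | cons b v ih => exact measurable_motion_lifetime.add (ih.comp (measurable_child b))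

lemma measurable_birthTime_fst (v : List Bool) :
    Measurable (fun p : Data × ℝ => birthTime p.1.lifetime v) := by
  have h : Measurable fun p : Data × ℝ => p.1 := measurable_fst
  exact (measurable_birthTime v).comp h

lemma measurable_position (v : List Bool) :
    Measurable (fun p : Data × ℝ => position p.1.lifetime p.1.motion p.2 v) := by
  have h : Measurable fun p : Data × ℝ => p.1 := measurable_fst
  have h1 : Measurable fun p : Data × ℝ => birthPlace p.1.lifetime p.1.motion v :=
    (measurable_birthPlace v).comp h
  have h2 : Measurable fun p : Data × ℝ => (p.2 - birthTime p.1.lifetime v).toNNReal :=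
    (measurable_snd.sub (measurable_birthTime_fst v)).real_toNNReal
  have h3 : Measurable fun p : Data × ℝ =>
      p.1.motion v (p.2 - birthTime p.1.lifetime v).toNNReal :=
    (measurable_motion v).comp (h.prodMk h2)
  exact h1.add h3

lemma measurableSet_mem_alive (v : List Bool) :
    MeasurableSet {p : Data × ℝ | v ∈ alive p.1.lifetime p.2} := by
  have h : Measurable fun p : Data × ℝ => p.1 := measurable_fst
  have h2 : Measurable fun p : Data × ℝ => p.1.lifetime v := (measurable_lifetime v).comp h
  exact (measurableSet_le (measurable_birthTime_fst v) measurable_snd).inter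
    (measurableSet_lt measurable_snd ((measurable_birthTime_fst v).add h2))

lemma measurableSet_alive_eq (S : Finset (List Bool)) :
    MeasurableSet {p : Data × ℝ | alive p.1.lifetime p.2 = S} := by
  have : {p : Data × ℝ | alive p.1.lifetime p.2 = S} =
      (⋂ v ∈ S, {p : Data × ℝ | v ∈ alive p.1.lifetime p.2}) ∩
        ⋂ v ∈ (S : Set (List Bool))ᶜ, {p : Data × ℝ | v ∈ alive p.1.lifetime p.2}ᶜ := by
    ext p
    simp only [Set.mem_ofPred_eq, Set.mem_inter_iff, Set.mem_iInter, Set.mem_compl_iff]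
    refine ⟨fun h => ⟨fun v hv => h ▸ hv, fun v hv => h ▸ hv⟩, fun h => ?_⟩
    ext v
    by_cases hv : v ∈ S
    · simp [hv, h.1 v hv]
    · simp [hv, h.2 v hv]
  rw [this]
  exact (Finset.measurableSet_biInter _ fun v _ => measurableSet_mem_alive v).inter
    (MeasurableSet.biInter (Set.to_countable _) fun v _ => (measurableSet_mem_alive v).compl)

open Classical in
/-- The product of `f` over the positions, shifted by `c`, of the particles at time `t`, if there
are `n` of them, and zero otherwise. -/
noncomputable def weight (f : ℝ → ℝ≥0∞) (n : ℕ) (d : Data) (t c : ℝ) : ℝ≥0∞ :=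
  ∑' S : Finset (List Bool), if S.card = n ∧ alive d.lifetime t = S then
    ∏ v ∈ S, f (c + position d.lifetime d.motion t v) else 0

lemma measurable_weight {f : ℝ → ℝ≥0∞} (hf : Measurable f) (n : ℕ) :
    Measurable (fun p : Data × ℝ × ℝ => weight f n p.1 p.2.1 p.2.2) := by
  unfold weight
  have hp : Measurable fun p : Data × ℝ × ℝ => (p.1, p.2.1) := by fun_prop
  refine Measurable.tsum fun S => Measurable.ite ?_ ?_ measurable_const
  · by_cases hS : S.card = n
    · simpa [hS] using hp (measurableSet_alive_eq S)
    · simp [hS]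
  · refine Finset.measurable_fun_prod _ fun v _ => hf.comp ?_
    exact (measurable_snd.comp measurable_snd).add ((measurable_position v).comp hp)

lemma weight_of_alive_eq (f : ℝ → ℝ≥0∞) {d : Data} {t : ℝ} (c : ℝ) {S : Finset (List Bool)}
    (hS : alive d.lifetime t = S) (n : ℕ) :
    weight f n d t c =
      if S.card = n then ∏ v ∈ S, f (c + position d.lifetime d.motion t v) else 0 := by
  rw [weight, tsum_eq_single S]
  · simp [hS]
  · intro S' hS'
    rw [if_neg]
    rintro ⟨-, h⟩
    exact hS' (Finset.coe_injective (h.symm.trans hS))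

lemma weight_of_infinite (f : ℝ → ℝ≥0∞) {d : Data} {t : ℝ} (c : ℝ)
    (h : (alive d.lifetime t).Infinite) (n : ℕ) : weight f n d t c = 0 := by
  rw [weight, ENNReal.tsum_eq_zero]
  intro S
  rw [if_neg]
  rintro ⟨-, hS⟩
  exact h (hS ▸ S.finite_toSet)

lemma weight_zero_of_nonempty (f : ℝ → ℝ≥0∞) {d : Data} {t : ℝ} (c : ℝ)
    (h : (alive d.lifetime t).Nonempty) : weight f 0 d t c = 0 := by
  rw [weight, ENNReal.tsum_eq_zero]
  intro S
  rw [if_neg]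
  rintro ⟨h0, hS⟩
  rw [Finset.card_eq_zero.1 h0] at hS
  simp [hS] at h

/-! ### The first branching -/

lemma cons_mem_alive {d : Data} {t : ℝ} {b : Bool} {v : List Bool} :
    b :: v ∈ alive d.lifetime t ↔ v ∈ alive (d.child b).lifetime (t - d.lifetime []) := by
  have : birthTime d.lifetime (b :: v) =
      d.lifetime [] + birthTime (d.child b).lifetime v := rfl
  have h2 : d.lifetime (b :: v) = (d.child b).lifetime v := rfl
  simp only [alive, Set.mem_ofPred_eq, this, h2]
  constructor <;> rintro ⟨h1, h2⟩ <;> constructor <;> linarith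

lemma position_cons (d : Data) (t : ℝ) (b : Bool) (v : List Bool) :
    position d.lifetime d.motion t (b :: v) = d.motion [] (d.lifetime []).toNNReal +
      position (d.child b).lifetime (d.child b).motion (t - d.lifetime []) v := by
  have h1 : birthTime d.lifetime (b :: v) =
      d.lifetime [] + birthTime (d.child b).lifetime v := rfl
  have h2 : birthPlace d.lifetime d.motion (b :: v) = d.motion [] (d.lifetime []).toNNReal +
      birthPlace (d.child b).lifetime (d.child b).motion v := rfl
  rw [position, h1, h2, position, add_assoc, sub_sub]
  rfl

/-- The embedding of the descendants of a child. -/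
def consEmb (b : Bool) : List Bool ↪ List Bool := ⟨fun v => b :: v, fun _ _ h => by simpa using h⟩

@[simp]
lemma consEmb_apply (b : Bool) (v : List Bool) : consEmb b v = b :: v := rfl

lemma alive_eq_of_split {d : Data} {t : ℝ} (h : d.lifetime [] ≤ t) {S₀ S₁ : Finset (List Bool)}
    (h₀ : alive (d.child false).lifetime (t - d.lifetime []) = S₀)
    (h₁ : alive (d.child true).lifetime (t - d.lifetime []) = S₁) :
    alive d.lifetime t = ((S₀.map (consEmb false)).disjUnion (S₁.map (consEmb true)) (by
      rw [Finset.disjoint_left]; simp) : Finset (List Bool)) := by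
  ext v
  rw [Finset.mem_coe, Finset.mem_disjUnion, Finset.mem_map, Finset.mem_map]
  match v with
  | [] =>
    simp only [consEmb_apply, reduceCtorEq, and_false, exists_false,
      or_self, iff_false]
    rintro ⟨-, h2⟩
    have : birthTime d.lifetime [] = 0 := rfl
    linarith
  | false :: v => rw [cons_mem_alive, h₀]; simp
  | true :: v => rw [cons_mem_alive, h₁]; simp

/-- The branching property of the weights at the first split. -/
lemma weight_of_split (f : ℝ → ℝ≥0∞) (n : ℕ) {d : Data} {t : ℝ} (h : d.lifetime [] ≤ t) (c : ℝ) :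
    weight f n d t c = ∑ p ∈ Finset.HasAntidiagonal.antidiagonal n,
      weight f p.1 (d.child false) (t - d.lifetime []) (c + d.motion [] (d.lifetime []).toNNReal) *
      weight f p.2 (d.child true) (t - d.lifetime []) (c + d.motion [] (d.lifetime []).toNNReal) := by
  -- If a subtree has infinitely many living particles, both sides vanish; explosions are covered
  -- without being excluded.
  have hinf : ∀ b, (alive (d.child b).lifetime (t - d.lifetime [])).Infinite →
      (alive d.lifetime t).Infinite := fun b hb => by
    refine (hb.image (consEmb b).injective.injOn).mono ?_
    rintro _ ⟨v, hv, rfl⟩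
    exact cons_mem_alive.2 hv
  by_cases hf0 : (alive (d.child false).lifetime (t - d.lifetime [])).Finite
  swap
  · rw [weight_of_infinite f c (hinf false hf0)]
    exact (Finset.sum_eq_zero fun p _ => by rw [weight_of_infinite f _ hf0, zero_mul]).symm
  by_cases hf1 : (alive (d.child true).lifetime (t - d.lifetime [])).Finite
  swap
  · rw [weight_of_infinite f c (hinf true hf1)]
    exact (Finset.sum_eq_zero fun p _ => by
      rw [weight_of_infinite f (n := p.2) _ hf1, mul_zero]).symm
  obtain ⟨S₀, h₀⟩ := hf0.exists_finset_coe
  obtain ⟨S₁, h₁⟩ := hf1.exists_finset_coe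
  simp_rw [weight_of_alive_eq f _ (alive_eq_of_split h h₀.symm h₁.symm),
    weight_of_alive_eq f _ h₀.symm, weight_of_alive_eq f _ h₁.symm]
  rw [Finset.card_disjUnion, Finset.card_map, Finset.card_map, Finset.prod_disjUnion,
    Finset.prod_map, Finset.prod_map]
  simp only [consEmb_apply, position_cons, ← add_assoc]
  split_ifs with hn
  -- Only the pair of actual subtree sizes contributes to the sum.
  · rw [Finset.sum_eq_single (S₀.card, S₁.card)]
    · simp
    · rintro ⟨a, b⟩ _ hab
      simp only [ite_mul, mul_ite, zero_mul, mul_zero]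
      split_ifs with h1 h2
      · exact (hab (by rw [h1, h2])).elim
      all_goals rfl
    · intro hnot; exact (hnot (Finset.HasAntidiagonal.mem_antidiagonal.2 hn)).elim
  · symm
    refine Finset.sum_eq_zero fun p hp => ?_
    have := Finset.HasAntidiagonal.mem_antidiagonal.1 hp
    simp only [ite_mul, mul_ite, zero_mul, mul_zero]
    split_ifs with h1 h2
    · omega
    all_goals rfl

lemma birthTime_nonneg {τ : List Bool → ℝ} (h : ∀ v, 0 ≤ τ v) (v : List Bool) :
    0 ≤ birthTime τ v := by
  induction v generalizing τ with
  | nil => exact le_rfl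
  | cons b v ih => exact add_nonneg (h _) (ih fun u => h _)

lemma alive_before_split {τ : List Bool → ℝ} (h : ∀ v, 0 ≤ τ v) {t : ℝ} (ht : 0 ≤ t)
    (htτ : t < τ []) : alive τ t = {[]} := by
  ext v
  match v with
  | [] => simpa [alive, birthTime] using ⟨ht, htτ⟩
  | b :: v =>
    simp only [alive, birthTime, Set.mem_ofPred_eq, Set.mem_singleton_iff, reduceCtorEq, iff_false]
    rintro ⟨h1, -⟩
    have := birthTime_nonneg (τ := fun u => τ (b :: u)) (fun u => h _) v
    linarith

lemma weight_before_split (f : ℝ → ℝ≥0∞) (n : ℕ) {d : Data} (h : ∀ v, 0 ≤ d.lifetime v) {t : ℝ}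
    (ht : 0 ≤ t) (htτ : t < d.lifetime []) (c : ℝ) :
    weight f n d t c = if n = 1 then f (c + d.motion [] t.toNNReal) else 0 := by
  rw [weight_of_alive_eq f c (S := {[]}) (by rw [alive_before_split h ht htτ]; simp)]
  simp [position, birthPlace, birthTime, eq_comm]

lemma birthTime_append (τ : List Bool → ℝ) (v : List Bool) (b : Bool) :
    birthTime τ (v ++ [b]) = birthTime τ v + τ v := by
  induction v generalizing τ with
  | nil => simp [birthTime]
  | cons a v ih =>
    have : birthTime τ (a :: v ++ [b]) = τ [] + birthTime (fun u => τ (a :: u)) (v ++ [b]) := rfl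
    rw [this, ih, birthTime]
    ring

/-- Along the line of first children, the parent of the first particle born after `t` is alive at
`t`. The condition `0 ≤ t` guarantees that this particle has a parent. -/
lemma alive_nonempty {τ : List Bool → ℝ} {t : ℝ} (ht : 0 ≤ t) {m : ℕ}
    (hm : t < birthTime τ (List.replicate m false)) : (alive τ t).Nonempty := by
  classical
  have hex : ∃ m, t < birthTime τ (List.replicate m false) := ⟨m, hm⟩
  have hspec := Nat.find_spec hex
  obtain ⟨k, hk⟩ : ∃ k, Nat.find hex = k + 1 := Nat.exists_eq_succ_of_ne_zero fun h0 => by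
    rw [h0] at hspec
    exact absurd hspec (not_lt.2 ht)
  rw [hk, List.replicate_succ', birthTime_append] at hspec
  exact ⟨List.replicate k false, not_lt.1 (Nat.find_min hex (by omega)), hspec⟩

lemma le_birthTime_replicate {τ : List Bool → ℝ} (h : ∀ v, 0 ≤ τ v) {i m : ℕ} (him : i < m) :
    τ (List.replicate i false) ≤ birthTime τ (List.replicate m false) := by
  have hmono : Monotone fun m => birthTime τ (List.replicate m false) :=
    monotone_nat_of_le_succ fun m => by
      rw [List.replicate_succ', birthTime_append]; linarith [h (List.replicate m false)]
  have h1 := hmono (Nat.succ_le_of_lt him)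
  simp only [Nat.succ_eq_add_one] at h1
  rw [List.replicate_succ', birthTime_append] at h1
  linarith [birthTime_nonneg h (List.replicate i false)]

/-! ### The law of the driving data -/

lemma lintegral_expMeasure_one {F : ℝ → ℝ≥0∞} (hF : Measurable F) :
    ∫⁻ s, F s ∂(expMeasure 1) = ∫⁻ s in Set.Ioi 0, ENNReal.ofReal (Real.exp (-s)) * F s := by
  have h1 : expMeasure 1 = volume.withDensity (gammaPDF 1 1) := rfl
  have hm : Measurable (gammaPDF 1 1) := (measurable_gammaPDFReal 1 1).ennreal_ofReal
  rw [h1, lintegral_withDensity_eq_lintegral_mul _ hm hF,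
    setLIntegral_congr Ioi_ae_eq_Ici, ← lintegral_indicator measurableSet_Ici]
  refine lintegral_congr fun s => ?_
  by_cases hs : 0 ≤ s
  · rw [Set.indicator_of_mem (by exact hs), Pi.mul_apply, gammaPDF_of_nonneg hs]
    simp
  · rw [Set.indicator_of_notMem (by exact hs), Pi.mul_apply, gammaPDF_of_neg (not_le.1 hs),
      zero_mul]

lemma expMeasure_one_Iic_lt_one (r : ℝ) : expMeasure 1 (Set.Iic r) < 1 := by
  have := isProbabilityMeasure_expMeasure one_pos
  rw [← ofReal_cdf, ENNReal.ofReal_lt_one, cdf_expMeasure_eq one_pos]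
  split_ifs
  · have := Real.exp_pos (-(1 * r)); linarith
  · exact one_pos

lemma expMeasure_one_Iic_zero : expMeasure 1 (Set.Iic 0) = 0 := by
  have := isProbabilityMeasure_expMeasure one_pos
  rw [← ofReal_cdf, cdf_expMeasure_eq one_pos]
  simp

variable {Ω : Type*}

/-- The driving data of a realization. -/
def drivingData (τ : List Bool → Ω → ℝ) (B : List Bool → ℝ≥0 → Ω → ℝ) (ω : Ω) : Data :=
  fun v => (τ v ω, fun s => B v s ω)

lemma child_drivingData (τ : List Bool → Ω → ℝ) (B : List Bool → ℝ≥0 → Ω → ℝ) (ω : Ω) (b : Bool) :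
    (drivingData τ B ω).child b =
      drivingData (fun v => τ (b :: v)) (fun v => B (b :: v)) ω := rfl

lemma comap_subfamily_le {ι κ β : Type*} [MeasurableSpace β] (Z : ι → Ω → β) (a : κ → ι) :
    MeasurableSpace.comap (fun ω i => Z (a i) ω) MeasurableSpace.pi ≤
      ⨆ i ∈ Set.range a, MeasurableSpace.comap (Z i) inferInstance := by
  rw [MeasurableSpace.pi, MeasurableSpace.comap_iSup]
  refine iSup_le fun i => ?_
  rw [MeasurableSpace.comap_comp]
  exact le_iSup₂_of_le (a i) ⟨i, rfl⟩ le_rfl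

variable [MeasurableSpace Ω] {P : Measure Ω}

/-- Functions of disjoint subfamilies of an independent family are independent. -/
lemma indepFun_of_subfamilies {ι κ κ' β : Type*} [MeasurableSpace β] {Z : ι → Ω → β}
    (hZ : ∀ i, Measurable (Z i)) (h : iIndepFun Z P) {a : κ → ι} {b : κ' → ι}
    (hab : ∀ i j, a i ≠ b j) : IndepFun (fun ω i => Z (a i) ω) (fun ω j => Z (b j) ω) P := by
  have h1 := indep_iSup_of_disjoint (fun i => (hZ i).comap_le) h.iIndep
    (S := Set.range a) (T := Set.range b) (by
      rw [Set.disjoint_left]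
      rintro _ ⟨i, rfl⟩ ⟨j, hj⟩
      exact hab i j hj.symm)
  exact indep_of_indep_of_le_left (indep_of_indep_of_le_right h1 (comap_subfamily_le Z b))
    (comap_subfamily_le Z a)

namespace IsDriving

variable {τ : List Bool → Ω → ℝ} {B : List Bool → ℝ≥0 → Ω → ℝ}

lemma child (h : IsDriving P τ B) (b : Bool) :
    IsDriving P (fun v => τ (b :: v)) (fun v => B (b :: v)) where
  measurable_lifetime v := h.measurable_lifetime _
  measurable_motion v := h.measurable_motion _
  lifetime_law v := h.lifetime_law _
  brownian v := h.brownian _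
  indep_lifetime_motion v := h.indep_lifetime_motion _
  indep_particles := h.indep_particles.precomp (g := fun v => b :: v) fun u v huv => by
    simpa using huv

lemma measurable_path (h : IsDriving P τ B) (v : List Bool) : Measurable (fun ω s => B v s ω) :=
  measurable_pi_lambda _ fun s => h.measurable_motion v s

lemma measurable_particle (h : IsDriving P τ B) (v : List Bool) :
    Measurable (fun ω => (τ v ω, fun s => B v s ω)) :=
  (h.measurable_lifetime v).prodMk (h.measurable_path v)

lemma measurable_drivingData (h : IsDriving P τ B) : Measurable (drivingData τ B) :=
  measurable_pi_lambda _ fun v => h.measurable_particle v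

lemma ae_lifetime_pos (h : IsDriving P τ B) : ∀ᵐ ω ∂P, ∀ v, 0 < τ v ω := by
  rw [ae_all_iff]
  intro v
  have := (h.lifetime_law v).measure_eq (p := fun x => x ≤ 0) measurableSet_Iic
  rw [ae_iff]
  simpa [expMeasure_one_Iic_zero] using this.trans expMeasure_one_Iic_zero

lemma ae_continuous (h : IsDriving P τ B) : ∀ᵐ ω ∂P, ∀ v, Continuous fun s => B v s ω := by
  rw [ae_all_iff]
  exact fun v => (h.brownian v).cont

lemma isProbabilityMeasure (h : IsDriving P τ B) : IsProbabilityMeasure P :=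
  h.indep_particles.isProbabilityMeasure

/-- Conditioning on the data of the initial particle. -/
lemma lintegral_mul_children (h : IsDriving P τ B)
    {F G : (ℝ × (ℝ≥0 → ℝ)) × Data → ℝ≥0∞} (hF : Measurable F) (hG : Measurable G) :
    ∫⁻ ω, F (drivingData τ B ω [], (drivingData τ B ω).child false) *
        G (drivingData τ B ω [], (drivingData τ B ω).child true) ∂P =
      ∫⁻ ω, (∫⁻ ω', F (drivingData τ B ω [], (drivingData τ B ω').child false) ∂P) *
        (∫⁻ ω', G (drivingData τ B ω [], (drivingData τ B ω').child true) ∂P) ∂P := by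
  have := h.isProbabilityMeasure
  have hm0 : Measurable fun ω => drivingData τ B ω [] := h.measurable_particle []
  have hm1 : Measurable fun ω => (drivingData τ B ω).child false :=
    (h.child false).measurable_drivingData
  have hm2 : Measurable fun ω => (drivingData τ B ω).child true :=
    (h.child true).measurable_drivingData
  have hi1 : IndepFun (fun ω => (drivingData τ B ω).child false)
      (fun ω => (drivingData τ B ω).child true) P :=
    indepFun_of_subfamilies (a := fun v => false :: v) (b := fun v => true :: v)
      h.measurable_particle h.indep_particles (by simp)
  have hi0 : IndepFun (fun ω => drivingData τ B ω [])
      (fun ω => ((drivingData τ B ω).child false, (drivingData τ B ω).child true)) P := by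
    have h1 := indepFun_of_subfamilies (a := fun _ : Unit => ([] : List Bool))
      (b := fun v : Bool × List Bool => v.1 :: v.2)
      h.measurable_particle h.indep_particles (by simp)
    have hu : Measurable fun w : Unit → ℝ × (ℝ≥0 → ℝ) => w () := measurable_pi_apply _
    have hw : Measurable fun w : Bool × List Bool → ℝ × (ℝ≥0 → ℝ) =>
        (((fun v => w (false, v)), fun v => w (true, v)) : Data × Data) :=
      (measurable_pi_lambda _ fun v => measurable_pi_apply _).prodMk
        (measurable_pi_lambda _ fun v => measurable_pi_apply _)
    exact h1.comp hu hw
  have e1 := (indepFun_iff_map_prod_eq_prod_map_map hm1.aemeasurable hm2.aemeasurable).1 hi1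
  have e0 := (indepFun_iff_map_prod_eq_prod_map_map hm0.aemeasurable
    (hm1.prodMk hm2).aemeasurable).1 hi0
  rw [e1] at e0
  have p1 := Measure.isProbabilityMeasure_map (μ := P) hm1.aemeasurable
  have p2 := Measure.isProbabilityMeasure_map (μ := P) hm2.aemeasurable
  have hFm : ∀ x, Measurable fun d => F (x, d) := fun x => hF.comp measurable_prodMk_left
  have hGm : ∀ x, Measurable fun d => G (x, d) := fun x => hG.comp measurable_prodMk_left
  have hFG : Measurable fun q : (ℝ × (ℝ≥0 → ℝ)) × Data × Data => F (q.1, q.2.1) * G (q.1, q.2.2) :=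
    (hF.comp (measurable_fst.prodMk measurable_snd.fst)).mul
      (hG.comp (measurable_fst.prodMk measurable_snd.snd))
  calc _ = ∫⁻ q, F (q.1, q.2.1) * G (q.1, q.2.2) ∂(P.map fun ω => (drivingData τ B ω [],
        ((drivingData τ B ω).child false, (drivingData τ B ω).child true))) :=
        (lintegral_map hFG (hm0.prodMk (hm1.prodMk hm2))).symm
    _ = ∫⁻ x, (∫⁻ d, F (x, d) ∂(P.map fun ω => (drivingData τ B ω).child false)) *
        (∫⁻ d, G (x, d) ∂(P.map fun ω => (drivingData τ B ω).child true))
          ∂(P.map fun ω => drivingData τ B ω []) := by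
        rw [e0, lintegral_prod _ hFG.aemeasurable]
        exact lintegral_congr fun x =>
          lintegral_prod_mul (hFm x).aemeasurable (hGm x).aemeasurable
    _ = _ := by
        refine (lintegral_map (hF.lintegral_prod_right'.mul hG.lintegral_prod_right') hm0).trans ?_
        simp only [Pi.mul_apply]
        refine lintegral_congr fun ω => ?_
        rw [lintegral_map (hFm _) hm1, lintegral_map (hGm _) hm2]

/-- Conditioning on the lifetime of the initial particle. -/
lemma lintegral_lifetime (h : IsDriving P τ B) {F : ℝ × (ℝ≥0 → ℝ) → ℝ≥0∞} (hF : Measurable F) :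
    ∫⁻ ω, F (drivingData τ B ω []) ∂P =
      ∫⁻ s in Set.Ioi 0, ENNReal.ofReal (Real.exp (-s)) *
        ∫⁻ ω, F (s, fun r => B [] r ω) ∂P := by
  have := h.isProbabilityMeasure
  have hm : Measurable fun ω r => B [] r ω := h.measurable_path []
  have p1 := Measure.isProbabilityMeasure_map (μ := P) hm.aemeasurable
  have e := (indepFun_iff_map_prod_eq_prod_map_map (h.measurable_lifetime []).aemeasurable
    hm.aemeasurable).1 (h.indep_lifetime_motion [])
  rw [(h.lifetime_law []).map_eq] at e
  calc _ = ∫⁻ q, F q ∂(P.map fun ω => (τ [] ω, fun r => B [] r ω)) :=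
        (lintegral_map hF (h.measurable_particle [])).symm
    _ = ∫⁻ s, ∫⁻ w, F (s, w) ∂(P.map fun ω r => B [] r ω) ∂(expMeasure 1) := by
        rw [e, lintegral_prod _ hF.aemeasurable]
    _ = _ := by
        rw [lintegral_expMeasure_one hF.lintegral_prod_right']
        refine lintegral_congr fun s => ?_
        exact congrArg _ (lintegral_map (hF.comp measurable_prodMk_left) hm)

lemma lintegral_pathEval (h : IsDriving P τ B) {s : ℝ} (hs : 0 < s) {φ : ℝ → ℝ≥0∞}
    (hφ : Measurable φ) :
    ∫⁻ ω, φ (pathEval (fun r => B [] r ω) s.toNNReal) ∂P =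
      ∫⁻ b, ENNReal.ofReal (heatKernel s b) * φ b := by
  have hlaw := (h.brownian []).hasLaw_eval s.toNNReal
  have hne : s.toNNReal ≠ 0 := (Real.toNNReal_pos.2 hs).ne'
  calc _ = ∫⁻ ω, φ (B [] s.toNNReal ω) ∂P := by
        refine lintegral_congr_ae ?_
        filter_upwards [h.ae_continuous] with ω hω
        rw [pathEval_of_continuous (hω [])]
    _ = ∫⁻ b, φ b ∂(gaussianReal 0 s.toNNReal) := by
        rw [← hlaw.map_eq, lintegral_map hφ (h.measurable_motion [] _)]
    _ = _ := by
        rw [gaussianReal_of_var_ne_zero _ hne,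
          lintegral_withDensity_eq_lintegral_mul _ (measurable_gaussianPDF _ _) hφ]
        refine lintegral_congr fun b => ?_
        rw [Pi.mul_apply, gaussianPDF, ← heatKernel_eq_gaussianPDFReal, Real.coe_toNNReal _ hs.le]

/-- Along the line of first children the lifetimes are independent and exponential, so almost surely
one of them exceeds any given bound. The exceptional set is the same for all `t`, as the statement
is later applied at the random time left after the first split. -/
lemma ae_alive_nonempty (h : IsDriving P τ B) :
    ∀ᵐ ω ∂P, ∀ t, 0 ≤ t → (alive (fun v => τ v ω) t).Nonempty := by
  have := h.isProbabilityMeasure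
  have key : ∀ R : ℕ, ∀ᵐ ω ∂P, ∃ i : ℕ, (R : ℝ) < τ (List.replicate i false) ω := by
    intro R
    have hindep : iIndepFun (fun i : ℕ => τ (List.replicate i false)) P := by
      have h1 := h.indep_particles.precomp (g := fun i : ℕ => List.replicate i false)
        fun i j hij => by simpa using congrArg List.length hij
      exact h1.comp (fun _ => Prod.fst) fun _ => measurable_fst
    have hle : ∀ m : ℕ, P {ω | ∀ i : ℕ, τ (List.replicate i false) ω ≤ R} ≤
        expMeasure 1 (Set.Iic R) ^ m := by
      intro m
      calc _ ≤ P (⋂ i ∈ Finset.range m, τ (List.replicate i false) ⁻¹' Set.Iic (R : ℝ)) :=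
            measure_mono fun ω hω => by
              simp only [Set.mem_iInter]
              exact fun i _ => hω i
        _ = ∏ i ∈ Finset.range m, P (τ (List.replicate i false) ⁻¹' Set.Iic (R : ℝ)) :=
            hindep.meas_biInter fun i _ => ⟨_, measurableSet_Iic, rfl⟩
        _ = ∏ _i ∈ Finset.range m, expMeasure 1 (Set.Iic R) :=
            Finset.prod_congr rfl fun i _ => by
              rw [← (h.lifetime_law (List.replicate i false)).map_eq,
                Measure.map_apply (h.measurable_lifetime _) measurableSet_Iic]
        _ = _ := by rw [Finset.prod_const, Finset.card_range]
    have h0 := le_antisymm (ge_of_tendsto' (ENNReal.tendsto_pow_atTop_nhds_zero_of_lt_one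
      (expMeasure_one_Iic_lt_one R)) hle) zero_le
    rw [ae_iff]
    simpa using h0
  filter_upwards [ae_all_iff.2 key, h.ae_lifetime_pos] with ω hω hpos t ht
  obtain ⟨R, hR⟩ := exists_nat_ge t
  obtain ⟨i, hi⟩ := hω R
  refine alive_nonempty ht (m := i + 1) ?_
  have := le_birthTime_replicate (τ := fun v => τ v ω) (fun v => (hpos v).le) (Nat.lt_succ_self i)
  exact hR.trans_lt (hi.trans_le this)

end IsDriving

/-! ### The generating functionals -/

/-- The recursion for the densities, as an identity of `ℝ≥0∞`-valued integrals. -/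
lemma lintegral_source_density {n : ℕ} (hn : 2 ≤ n) {t : ℝ} (ht : 0 ≤ t) (y : Fin n → ℝ) :
    ∫⁻ s in Set.Ioo 0 t, ∫⁻ b, ENNReal.ofReal (Real.exp (-s)) * (ENNReal.ofReal (heatKernel s b) *
        ENNReal.ofReal (symTensorSum (fun k => density k (t - s)) n (fun i => y i - b))) =
      ENNReal.ofReal (density n t y) := by
  have hT := isTame_source (n := n) (fun i => -y i) ⟨0, by omega⟩
  set F := source n (fun i => -y i) with hFdef
  have hF : ∀ s z, F s z = Real.exp s *
      symTensorSum (fun k => density k s) n (fun i => y i - (-z)) := by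
    intro s z
    rw [hFdef, source]
    congr 1
    refine symTensorSum_congr fun k _ _ e => ?_
    rw [density_sub k s (-z) fun i => y (e i), neg_neg]
  have hF0 : ∀ {s}, 0 ≤ s → ∀ z, 0 ≤ F s z := fun hs z => by
    rw [hF]
    exact mul_nonneg (Real.exp_pos _).le (symTensorSum_nonneg fun k _ _ w => density_nonneg hs w)
  have h1 : density n t y = ∫ q, Real.exp (-t) * (heatKernel (t - q.1) (0 - q.2) * F q.1 q.2)
      ∂((volume.restrict (Set.Ioc 0 t)).prod volume) := by
    rw [density, g_eq_duhamel hn, hT.duhamel_eq ht, integral_const_mul]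
  have hFm : Measurable fun q : ℝ × ℝ => F q.1 q.2 := hT.measurable
  have hmeas : Measurable fun q : ℝ × ℝ => Real.exp (-t) *
      (heatKernel (t - q.1) (0 - q.2) * F q.1 q.2) := by fun_prop
  rw [h1, ofReal_integral_eq_lintegral_ofReal]
  -- The substitutions `s ↦ t - s` and `b ↦ -z` match the two recursions: one integrates over the
  -- time of the first split, the Duhamel formula over the time that remains after it.
  · rw [lintegral_prod _ hmeas.ennreal_ofReal.aemeasurable, setLIntegral_congr Ioo_ae_eq_Ioc.symm,
      ← lintegral_indicator measurableSet_Ioo, ← lintegral_indicator measurableSet_Ioo,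
      ← lintegral_sub_left_eq_self _ t]
    refine lintegral_congr fun s => ?_
    by_cases hs : s ∈ Set.Ioo 0 t
    · have hs' : t - s ∈ Set.Ioo 0 t := by constructor <;> linarith [hs.1, hs.2]
      rw [Set.indicator_of_mem hs, Set.indicator_of_mem hs',
        ← lintegral_neg_eq_self]
      refine lintegral_congr fun z => ?_
      have h0 := hF0 hs.1.le z
      have e : Real.exp (-(t - s)) = Real.exp (-t) * Real.exp s := by rw [← Real.exp_add]; ring_nf
      rw [sub_sub_cancel, ← ENNReal.ofReal_mul (heatKernel_nonneg _ _),
        ← ENNReal.ofReal_mul (Real.exp_pos _).le, zero_sub, hF, e]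
      ring_nf
    · have hs' : t - s ∉ Set.Ioo 0 t := fun h => hs (by constructor <;> linarith [h.1, h.2])
      rw [Set.indicator_of_notMem hs, Set.indicator_of_notMem hs']
  · exact (hT.integrable t 0).const_mul _
  · have h0 : ∀ᵐ q ∂((volume.restrict (Set.Ioc 0 t)).prod (volume : Measure ℝ)), 0 ≤ q.1 := by
      filter_upwards [Measure.quasiMeasurePreserving_fst.ae (ae_restrict_Ioc_lt t)] with q hq
      exact hq.1.le
    filter_upwards [h0] with q hq
    exact mul_nonneg (Real.exp_pos _).le (mul_nonneg (heatKernel_nonneg _ _) (hF0 hq _))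

/-- The integral of `∏ f (c + y i)` against the density. -/
noncomputable def generating (f : ℝ → ℝ≥0∞) (n : ℕ) (t c : ℝ) : ℝ≥0∞ :=
  ∫⁻ y : Fin n → ℝ, (∏ i, f (c + y i)) * ENNReal.ofReal (density n t y)

lemma sum_generating_mul {f : ℝ → ℝ≥0∞} (hf : Measurable f) (n : ℕ) {t : ℝ} (ht : 0 ≤ t)
    (c b : ℝ) :
    ∑ k : Fin (n - 1), generating f (k + 1) t (c + b) * generating f (n - (k + 1)) t (c + b) =
      ∫⁻ y : Fin n → ℝ, (∏ i, f (c + y i)) *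
        ENNReal.ofReal (symTensorSum (fun k => density k t) n (fun i => y i - b)) := by
  have hf' : Measurable fun x => f (c + b + x) := hf.comp (measurable_const_add _)
  have hd : ∀ k, Measurable (density k t) := fun k =>
    (measurable_density k).comp measurable_prodMk_left
  have hp : Measurable fun y : Fin n → ℝ => ∏ i, f (c + b + y i) :=
    Finset.measurable_fun_prod _ fun i _ => hf'.comp (measurable_pi_apply i)
  rw [← lintegral_add_right_eq_self _ (fun _ : Fin n => b)]
  simp only [Pi.add_apply, add_sub_cancel_right, symTensorSum]
  calc _ = ∑ k : Fin (n - 1), ∫⁻ y : Fin n → ℝ, (∏ i, f (c + b + y i)) * ENNReal.ofReal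
        (symTensor (show (k + 1 : ℕ) + (n - (k + 1)) = n by have := k.isLt; omega)
          (density (k + 1) t) (density (n - (k + 1)) t) y) :=
        Finset.sum_congr rfl fun k _ => (lintegral_prod_mul_symTensor
          (show (k + 1 : ℕ) + (n - (k + 1)) = n by have := k.isLt; omega) (hd _) (hd _)
          (density_nonneg ht) (density_nonneg ht) hf').symm
    _ = _ := by
        rw [← lintegral_finsetSum]
        · refine lintegral_congr fun y => ?_
          rw [← Finset.mul_sum, ENNReal.ofReal_sum_of_nonneg]
          · simp only [add_assoc, add_comm b]
          · intro k _
            exact mul_nonneg (by positivity) (Finset.sum_nonneg fun σ _ =>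
              mul_nonneg (density_nonneg ht _) (density_nonneg ht _))
        · intro k _
          refine hp.mul (Measurable.ennreal_ofReal (Measurable.const_mul
            (Finset.measurable_fun_sum _ fun σ _ => Measurable.mul ?_ ?_) _))
          · exact (hd _).comp (measurable_pi_lambda _ fun i => measurable_pi_apply _)
          · exact (hd _).comp (measurable_pi_lambda _ fun i => measurable_pi_apply _)

/-- The recursion for the generating functionals. -/
lemma generating_eq {f : ℝ → ℝ≥0∞} (hf : Measurable f) {n : ℕ} (hn : 2 ≤ n) {t : ℝ} (ht : 0 ≤ t)
    (c : ℝ) :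
    generating f n t c = ∫⁻ s in Set.Ioo 0 t, ENNReal.ofReal (Real.exp (-s)) *
      ∫⁻ b, ENNReal.ofReal (heatKernel s b) * ∑ k : Fin (n - 1),
        generating f (k + 1) (t - s) (c + b) * generating f (n - (k + 1)) (t - s) (c + b) := by
  have hp : Measurable fun y : Fin n → ℝ => ∏ i, f (c + y i) :=
    Finset.measurable_fun_prod _ fun i _ =>
      hf.comp ((measurable_pi_apply (X := fun _ => ℝ) i).const_add c)
  have hS : Measurable fun q : (ℝ × ℝ) × (Fin n → ℝ) =>
      symTensorSum (fun k => density k (t - q.1.1)) n (fun i => q.2 i - q.1.2) := by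
    refine measurable_symTensorSum (a := fun k (q : (ℝ × ℝ) × (Fin n → ℝ)) =>
      density k (t - q.1.1)) (by fun_prop) fun k _ _ => ?_
    exact (measurable_density k).comp (by fun_prop :
      Measurable fun q : ((ℝ × ℝ) × (Fin n → ℝ)) × (Fin k → ℝ) => (t - q.1.1.1, q.2))
  have hK : Measurable fun q : (ℝ × ℝ) × (Fin n → ℝ) => (∏ i, f (c + q.2 i)) *
      (ENNReal.ofReal (Real.exp (-q.1.1)) * (ENNReal.ofReal (heatKernel q.1.1 q.1.2) *
        ENNReal.ofReal (symTensorSum (fun k => density k (t - q.1.1)) n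
          (fun i => q.2 i - q.1.2)))) := by
    fun_prop
  calc generating f n t c
      = ∫⁻ y : Fin n → ℝ, ∫⁻ q : ℝ × ℝ, (∏ i, f (c + y i)) *
        (ENNReal.ofReal (Real.exp (-q.1)) * (ENNReal.ofReal (heatKernel q.1 q.2) *
        ENNReal.ofReal (symTensorSum (fun k => density k (t - q.1)) n (fun i => y i - q.2))))
          ∂((volume.restrict (Set.Ioo 0 t)).prod volume) := by
        refine lintegral_congr fun y => ?_
        have hSy : Measurable fun q : ℝ × ℝ => ENNReal.ofReal (Real.exp (-q.1)) *
            (ENNReal.ofReal (heatKernel q.1 q.2) * ENNReal.ofReal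
              (symTensorSum (fun k => density k (t - q.1)) n (fun i => y i - q.2))) := by
          have := hS.comp (measurable_prodMk_right (y := y))
          simp only [Function.comp_def] at this
          fun_prop
        rw [← lintegral_source_density hn ht y, lintegral_const_mul _ hSy,
          lintegral_prod _ hSy.aemeasurable]
    _ = ∫⁻ q : ℝ × ℝ, (∫⁻ y : Fin n → ℝ, (∏ i, f (c + y i)) *
        (ENNReal.ofReal (Real.exp (-q.1)) * (ENNReal.ofReal (heatKernel q.1 q.2) *
        ENNReal.ofReal (symTensorSum (fun k => density k (t - q.1)) n (fun i => y i - q.2)))))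
          ∂((volume.restrict (Set.Ioo 0 t)).prod volume) :=
        (lintegral_lintegral_swap (f := fun (q : ℝ × ℝ) (y : Fin n → ℝ) => (∏ i, f (c + y i)) *
        (ENNReal.ofReal (Real.exp (-q.1)) * (ENNReal.ofReal (heatKernel q.1 q.2) *
        ENNReal.ofReal (symTensorSum (fun k => density k (t - q.1)) n
          (fun i => y i - q.2))))) hK.aemeasurable).symm
    _ = _ := by
        rw [lintegral_prod _ hK.lintegral_prod_right'.aemeasurable]
        refine setLIntegral_congr_fun measurableSet_Ioo fun s hs => ?_
        have hSs : ∀ b, Measurable fun y : Fin n → ℝ => (∏ i, f (c + y i)) * ENNReal.ofReal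
            (symTensorSum (fun k => density k (t - s)) n (fun i => y i - b)) := fun b =>
          hp.mul (hS.comp (measurable_prodMk_left (x := (s, b)))).ennreal_ofReal
        rw [← lintegral_const_mul' _ _ ENNReal.ofReal_ne_top]
        refine lintegral_congr fun b => ?_
        rw [sum_generating_mul hf n (by linarith [hs.2]), ← mul_assoc,
          ← lintegral_const_mul _ (hSs b)]
        refine lintegral_congr fun y => ?_
        ring

lemma measurable_generating {f : ℝ → ℝ≥0∞} (hf : Measurable f) (n : ℕ) :
    Measurable (fun p : ℝ × ℝ => generating f n p.1 p.2) := by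
  unfold generating
  refine Measurable.lintegral_prod_right' (f := fun q : (ℝ × ℝ) × (Fin n → ℝ) =>
    (∏ i, f (q.1.2 + q.2 i)) * ENNReal.ofReal (density n q.1.1 q.2)) (Measurable.mul ?_ ?_)
  · exact Finset.measurable_fun_prod _ fun i _ => hf.comp (by fun_prop)
  · exact ((measurable_density n).comp (by fun_prop :
      Measurable fun q : (ℝ × ℝ) × (Fin n → ℝ) => (q.1.1, q.2))).ennreal_ofReal

namespace IsDriving

variable {Ω : Type*} [MeasurableSpace Ω] {P : Measure Ω} {τ : List Bool → Ω → ℝ}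
  {B : List Bool → ℝ≥0 → Ω → ℝ}

/-- Decomposition of the weights at the first split. -/
lemma ae_weight_eq (h : IsDriving P τ B) (f : ℝ → ℝ≥0∞) {n : ℕ} (hn : 1 ≤ n) {t : ℝ} (ht : 0 ≤ t)
    (c : ℝ) :
    ∀ᵐ ω ∂P, weight f n (drivingData τ B ω) t c =
      if τ [] ω ≤ t then ∑ k : Fin (n - 1),
        weight f (k + 1) ((drivingData τ B ω).child false) (t - τ [] ω)
          (c + pathEval (fun r => B [] r ω) (τ [] ω).toNNReal) *
        weight f (n - (k + 1)) ((drivingData τ B ω).child true) (t - τ [] ω)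
          (c + pathEval (fun r => B [] r ω) (τ [] ω).toNNReal)
      else if n = 1 then f (c + pathEval (fun r => B [] r ω) t.toNNReal) else 0 := by
  filter_upwards [h.ae_lifetime_pos, (h.child false).ae_alive_nonempty,
    (h.child true).ae_alive_nonempty] with ω hpos h0 h1
  split_ifs with hτ hn1
  · have hr : 0 ≤ t - τ [] ω := sub_nonneg.2 hτ
    rw [weight_of_split f n (d := drivingData τ B ω) hτ]
    obtain ⟨m, rfl⟩ : ∃ m, n = m + 1 := ⟨n - 1, by omega⟩
    have e0 : ∀ c', weight f 0 ((drivingData τ B ω).child false) (t - τ [] ω) c' = 0 := fun c' =>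
      weight_zero_of_nonempty f c' (h0 _ hr)
    have e1 : ∀ c', weight f 0 ((drivingData τ B ω).child true) (t - τ [] ω) c' = 0 := fun c' =>
      weight_zero_of_nonempty f c' (h1 _ hr)
    have hsum := Finset.Nat.sum_antidiagonal_eq_sum_range_succ (fun i j =>
        weight f i ((drivingData τ B ω).child false) (t - τ [] ω)
          (c + pathEval (fun r => B [] r ω) (τ [] ω).toNNReal) *
        weight f j ((drivingData τ B ω).child true) (t - τ [] ω)
          (c + pathEval (fun r => B [] r ω) (τ [] ω).toNNReal)) (m + 1)
    refine hsum.trans ?_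
    -- The two extreme terms, in which one subtree has no particle, vanish; `n - 1` terms remain.
    rw [Finset.sum_range_succ, Nat.sub_self, e1, mul_zero, add_zero, Finset.sum_range_succ', e0,
      zero_mul, add_zero, Finset.sum_range]
    rfl
  · rw [weight_before_split f n (d := drivingData τ B ω) (fun v => (hpos v).le) ht (not_le.1 hτ),
      if_pos hn1]
    rfl
  · rw [weight_before_split f n (d := drivingData τ B ω) (fun v => (hpos v).le) ht (not_le.1 hτ),
      if_neg hn1]

lemma lintegral_weight_one (h : IsDriving P τ B) {f : ℝ → ℝ≥0∞} (hf : Measurable f) {t : ℝ}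
    (ht : 0 < t) (c : ℝ) :
    ∫⁻ ω, weight f 1 (drivingData τ B ω) t c ∂P = generating f 1 t c := by
  have := h.isProbabilityMeasure
  have hφ : Measurable fun b => f (c + b) := hf.comp (measurable_const_add c)
  have hF : Measurable fun x : ℝ × (ℝ≥0 → ℝ) =>
      (Set.Ioi t).indicator 1 x.1 * f (c + pathEval x.2 t.toNNReal) :=
    ((measurable_one.indicator measurableSet_Ioi).comp measurable_fst).mul
      (hφ.comp (measurable_pathEval.comp (measurable_snd.prodMk measurable_const)))
  have h1 : ∫⁻ s in Set.Ioi 0, ENNReal.ofReal (Real.exp (-s)) * (Set.Ioi t).indicator 1 s =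
      ENNReal.ofReal (Real.exp (-t)) := by
    rw [← lintegral_expMeasure_one (measurable_one.indicator measurableSet_Ioi),
      lintegral_indicator_one measurableSet_Ioi]
    have := isProbabilityMeasure_expMeasure one_pos
    rw [← Set.compl_Iic, prob_compl_eq_one_sub measurableSet_Iic, ← ofReal_cdf,
      cdf_expMeasure_eq one_pos, if_pos ht.le, ← ENNReal.ofReal_one,
      ← ENNReal.ofReal_sub _ (by simp [ht.le])]
    simp
  calc _ = ∫⁻ ω, (fun x : ℝ × (ℝ≥0 → ℝ) =>
        (Set.Ioi t).indicator 1 x.1 * f (c + pathEval x.2 t.toNNReal))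
          (drivingData τ B ω []) ∂P := by
        refine lintegral_congr_ae ?_
        filter_upwards [h.ae_weight_eq f le_rfl ht.le c] with ω hω
        rw [hω]
        by_cases hτ : τ [] ω ≤ t
        · simp [hτ, drivingData]
        · simp [hτ, drivingData, not_le.1 hτ]
    _ = ENNReal.ofReal (Real.exp (-t)) * ∫⁻ b, ENNReal.ofReal (heatKernel t b) * f (c + b) := by
        rw [h.lintegral_lifetime hF, ← h1, ← lintegral_mul_const]
        · refine lintegral_congr fun s => ?_
          dsimp only
          rw [lintegral_const_mul, h.lintegral_pathEval ht hφ, mul_assoc]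
          exact hφ.comp (measurable_pathEval.comp ((h.measurable_path []).prodMk measurable_const))
        · exact (by fun_prop : Measurable fun s : ℝ => ENNReal.ofReal (Real.exp (-s))).mul
            (measurable_one.indicator measurableSet_Ioi)
    _ = _ := by
        rw [generating]
        refine Eq.trans ?_ ((volume_preserving_funUnique (Fin 1) ℝ).symm.lintegral_comp_emb
          (MeasurableEquiv.measurableEmbedding _) _)
        rw [← lintegral_const_mul' _ _ ENNReal.ofReal_ne_top]
        refine lintegral_congr fun b => ?_
        simp [density, g_one, ENNReal.ofReal_mul (Real.exp_pos _).le]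
        ring

set_option maxHeartbeats 400000 in
/-- The law of the particle positions is described by the densities. -/
theorem lintegral_weight {f : ℝ → ℝ≥0∞} (hf : Measurable f) {n : ℕ} (hn : 1 ≤ n)
    (h : IsDriving P τ B) {t : ℝ} (ht : 0 ≤ t) (hnt : n = 1 → 0 < t) (c : ℝ) :
    ∫⁻ ω, weight f n (drivingData τ B ω) t c ∂P = generating f n t c := by
  -- The driving variables are generalized because the induction hypothesis is applied to the
  -- subtrees of the two children, which have driving data of the same kind.
  induction n using Nat.strong_induction_on generalizing τ B t c with
  | _ n ih =>
    obtain rfl | hn2 : n = 1 ∨ 2 ≤ n := by omega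
    · exact h.lintegral_weight_one hf (hnt rfl) c
    have := h.isProbabilityMeasure
    have hW : ∀ m, Measurable fun q : (ℝ × (ℝ≥0 → ℝ)) × Data =>
        weight f m q.2 (t - q.1.1) (c + pathEval q.1.2 q.1.1.toNNReal) := by
      intro m
      have hpe : Measurable fun q : (ℝ × (ℝ≥0 → ℝ)) × Data => pathEval q.1.2 q.1.1.toNNReal :=
        measurable_pathEval.comp
          (measurable_fst.snd.prodMk measurable_fst.fst.real_toNNReal)
      exact (measurable_weight hf m).comp (measurable_snd.prodMk
        ((measurable_fst.fst.const_sub t).prodMk (hpe.const_add c)))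
    set F : ℕ → (ℝ × (ℝ≥0 → ℝ)) × Data → ℝ≥0∞ := fun m q => (Set.Iic t).indicator 1 q.1.1 *
      weight f m q.2 (t - q.1.1) (c + pathEval q.1.2 q.1.1.toNNReal) with hFdef
    have hF : ∀ m, Measurable (F m) := fun m =>
      ((measurable_one.indicator measurableSet_Iic).comp measurable_fst.fst).mul (hW m)
    have hFc : ∀ m b, Measurable fun x : ℝ × (ℝ≥0 → ℝ) =>
        ∫⁻ ω, F m (x, (drivingData τ B ω).child b) ∂P := fun m b =>
      ((hF m).comp (measurable_fst.prodMk
        ((h.child b).measurable_drivingData.comp measurable_snd))).lintegral_prod_right'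
    have hFω : ∀ m b, Measurable fun ω => F m (drivingData τ B ω [], (drivingData τ B ω).child b) :=
      fun m b => by
        have h0 : Measurable fun ω => drivingData τ B ω [] := h.measurable_particle []
        have h1 : Measurable fun ω => (drivingData τ B ω).child b :=
          (h.child b).measurable_drivingData
        exact (hF m).comp (h0.prodMk h1)
    have hG : ∀ k : Fin (n - 1), Measurable fun p : ℝ × ℝ => generating f (k + 1) (t - p.1)
        (c + p.2) * generating f (n - (k + 1)) (t - p.1) (c + p.2) := fun k => by
      have hm : Measurable fun p : ℝ × ℝ => (t - p.1, c + p.2) := by fun_prop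
      exact ((measurable_generating hf _).comp hm).mul ((measurable_generating hf _).comp hm)
    have hpG : ∀ k : Fin (n - 1), Measurable fun p : ℝ × ℝ => ENNReal.ofReal (heatKernel p.1 p.2) *
        (generating f (k + 1) (t - p.1) (c + p.2) *
          generating f (n - (k + 1)) (t - p.1) (c + p.2)) := fun k =>
      (measurable_heatKernel.ennreal_ofReal).mul (hG k)
    have hpGs : ∀ (k : Fin (n - 1)) (s : ℝ), Measurable fun b : ℝ =>
        ENNReal.ofReal (heatKernel s b) * (generating f (k + 1) (t - s) (c + b) *
          generating f (n - (k + 1)) (t - s) (c + b)) := fun k s => by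
      have h1 : Measurable fun b : ℝ => (s, b) := measurable_prodMk_left
      exact (hpG k).comp h1
    have hint : ∀ k : Fin (n - 1), Measurable fun s : ℝ => ∫⁻ b, ENNReal.ofReal (heatKernel s b) *
        (generating f (k + 1) (t - s) (c + b) * generating f (n - (k + 1)) (t - s) (c + b)) :=
      fun k => Measurable.lintegral_prod_right' (hpG k)
    have hexp : Measurable fun s : ℝ => ENNReal.ofReal (Real.exp (-s)) := by fun_prop
    have key : ∀ k : Fin (n - 1),
        ∫⁻ ω, F (k + 1) (drivingData τ B ω [], (drivingData τ B ω).child false) *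
          F (n - (k + 1)) (drivingData τ B ω [], (drivingData τ B ω).child true) ∂P =
        ∫⁻ s in Set.Ioo 0 t, ENNReal.ofReal (Real.exp (-s)) *
          ∫⁻ b, ENNReal.ofReal (heatKernel s b) * (generating f (k + 1) (t - s) (c + b) *
            generating f (n - (k + 1)) (t - s) (c + b)) := by
      intro k
      have hk := k.isLt
      rw [h.lintegral_mul_children (hF _) (hF _)]
      refine (h.lintegral_lifetime ((hFc _ _).mul (hFc _ _))).trans ?_
      rw [← lintegral_indicator measurableSet_Ioi, ← lintegral_indicator measurableSet_Ioo]
      refine lintegral_congr_ae ?_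
      -- A split exactly at time `t` would leave the children no time, and a single particle has no
      -- density at time zero.
      have hne : ∀ᵐ s : ℝ, s ≠ t := by simp [ae_iff, measure_singleton]
      filter_upwards [hne] with s hs
      by_cases h0 : 0 < s
      swap
      · rw [Set.indicator_of_notMem (by exact h0), Set.indicator_of_notMem (fun h' => h0 h'.1)]
      rw [Set.indicator_of_mem (by exact h0)]
      by_cases hst : s < t
      · rw [Set.indicator_of_mem (by exact ⟨h0, hst⟩)]
        congr 1
        have hGs : Measurable fun b : ℝ => generating f (k + 1) (t - s) (c + b) *
            generating f (n - (k + 1)) (t - s) (c + b) := by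
          have h1 : Measurable fun b : ℝ => (s, b) := measurable_prodMk_left
          exact (hG k).comp h1
        refine Eq.trans ?_ (h.lintegral_pathEval h0 hGs)
        refine lintegral_congr fun ω => ?_
        simp only [hFdef, Pi.mul_apply,
          Set.indicator_of_mem (show s ∈ Set.Iic t from hst.le), Pi.one_apply, one_mul,
          child_drivingData]
        rw [ih _ (by omega) (by omega) (h.child false) (by linarith) (fun _ => by linarith),
          ih _ (by omega) (by omega) (h.child true) (by linarith) (fun _ => by linarith)]
      · rw [Set.indicator_of_notMem (fun h' => hst h'.2)]
        have hs' : s ∉ Set.Iic t := fun h' => hst (lt_of_le_of_ne h' hs)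
        simp [hFdef, hs']
    calc _ = ∫⁻ ω, ∑ k : Fin (n - 1),
          F (k + 1) (drivingData τ B ω [], (drivingData τ B ω).child false) *
          F (n - (k + 1)) (drivingData τ B ω [], (drivingData τ B ω).child true) ∂P := by
          refine lintegral_congr_ae ?_
          filter_upwards [h.ae_weight_eq f hn ht c] with ω hω
          rw [hω]
          by_cases hτ : τ [] ω ≤ t
          · simp [hτ, hFdef, drivingData]
          · simp [hτ, hFdef, drivingData]
            intro h1; omega
      _ = _ := by
          rw [lintegral_finsetSum]
          · simp_rw [key]
            rw [generating_eq hf hn2 ht, ← lintegral_finsetSum]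
            · refine lintegral_congr fun s => ?_
              rw [← Finset.mul_sum, ← lintegral_finsetSum]
              · simp_rw [Finset.mul_sum]
              · exact fun k _ => hpGs k s
            · intro k _
              exact hexp.mul (hint k)
          · exact fun k _ => (hFω _ _).mul (hFω _ _)

end IsDriving

/-! ### The law of the positions -/

section Law

variable {Ω : Type*} [MeasurableSpace Ω] {P : Measure Ω} {τ : List Bool → Ω → ℝ}
  {B : List Bool → ℝ≥0 → Ω → ℝ} {X : ℝ → ℕ → Ω → ℝ}

/-- For `n ≥ 1` the set of living particles is finite on this event; the value `0` is also the
`ncard` of an infinite set. -/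
lemma IsDriving.measurableSet_particleCount_eq (h : IsDriving P τ B) {n : ℕ} (hn : 1 ≤ n) (t : ℝ) :
    MeasurableSet {ω | particleCount τ t ω = n} := by
  have : {ω | particleCount τ t ω = n} = ⋃ S ∈ {S : Finset (List Bool) | S.card = n},
      {ω | alive (drivingData τ B ω).lifetime t = S} := by
    ext ω
    simp only [Set.mem_iUnion, Set.mem_ofPred_eq, exists_prop]
    constructor
    · intro hω
      have hfin : (alive (fun v => τ v ω) t).Finite :=
        Set.finite_of_ncard_pos (by rw [particleCount, count] at hω; omega)
      refine ⟨hfin.toFinset, ?_, hfin.coe_toFinset.symm⟩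
      rw [← Set.ncard_eq_toFinset_card _ hfin]
      exact hω
    · rintro ⟨S, hS, hω⟩
      have hω' : alive (fun v => τ v ω) t = S := hω
      rw [particleCount, count, hω', Set.ncard_coe_finset, hS]
  rw [this]
  refine MeasurableSet.biUnion (Set.to_countable _) fun S _ => ?_
  have hm : Measurable fun ω => (drivingData τ B ω, t) :=
    h.measurable_drivingData.prodMk measurable_const
  exact hm (measurableSet_alive_eq S)

namespace IsBranchingBrownianMotion

lemma measurable_vector (hX : IsBranchingBrownianMotion P τ B X) (n : ℕ) (t : ℝ) :
    Measurable fun ω (i : Fin n) => X t i ω :=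
  measurable_pi_lambda _ fun i => hX.measurable_position t i

lemma ae_weight_eq_prod (hX : IsBranchingBrownianMotion P τ B X) (f : ℝ → ℝ≥0∞) {n : ℕ}
    (hn : 1 ≤ n) {t : ℝ} (ht : 0 ≤ t) :
    ∀ᵐ ω ∂P, weight f n (drivingData τ B ω) t 0 =
      {ω | particleCount τ t ω = n}.indicator (fun ω => ∏ i : Fin n, f (X t i ω)) ω := by
  filter_upwards [hX.enumerates t ht, hX.driving.ae_continuous] with ω ⟨e, he, hXe⟩ hcont
  have hpos : ∀ v, position (drivingData τ B ω).lifetime (drivingData τ B ω).motion t v =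
      position (fun v => τ v ω) (fun v s => B v s ω) t v := by
    have hmot : (drivingData τ B ω).motion = fun v s => B v s ω := by
      funext v s
      exact pathEval_of_continuous (hcont v) s
    rw [hmot]
    exact fun v => rfl
  by_cases hfin : (alive (fun v => τ v ω) t).Finite
  · have hS : alive (drivingData τ B ω).lifetime t = hfin.toFinset := hfin.coe_toFinset.symm
    have hcard : hfin.toFinset.card = particleCount τ t ω :=
      (Set.ncard_eq_toFinset_card _ hfin).symm
    rw [weight_of_alive_eq f 0 hS, hcard]
    by_cases hω : particleCount τ t ω = n
    · rw [if_pos hω, Set.indicator_of_mem (by exact hω)]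
      symm
      refine Finset.prod_bij (fun (i : Fin n) _ => e i) ?_ ?_ ?_ ?_
      · intro i _
        exact hfin.mem_toFinset.2 (he.mapsTo (by rw [hω]; exact i.2))
      · intro i _ j _ hij
        exact Fin.ext (he.injOn (by rw [hω]; exact i.2) (by rw [hω]; exact j.2) hij)
      · intro v hv
        obtain ⟨k, hk, rfl⟩ := he.surjOn (hfin.mem_toFinset.1 hv)
        exact ⟨⟨k, hω ▸ hk⟩, Finset.mem_univ _, rfl⟩
      · intro i _
        rw [hXe i (by rw [hω]; exact i.2), zero_add, hpos]
    · rw [if_neg hω, Set.indicator_of_notMem (by exact hω)]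
  · rw [weight_of_infinite f 0 (d := drivingData τ B ω) hfin, Set.indicator_of_notMem]
    intro hω
    have hω' : (alive (fun v => τ v ω) t).ncard = n := hω
    rw [Set.Infinite.ncard hfin] at hω'
    omega

/-- The positions have the density `density n t`. -/
theorem measure_positionEvent (hX : IsBranchingBrownianMotion P τ B X) {n : ℕ} (hn : 1 ≤ n) {t : ℝ}
    (ht : 0 ≤ t) (hnt : n = 1 → 0 < t) {A : Set (Fin n → ℝ)} (hA : MeasurableSet A) :
    P (positionEvent τ X n t A) = ∫⁻ y in A, ENNReal.ofReal (density n t y) := by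
  have := hX.driving.isProbabilityMeasure
  have hC := hX.driving.measurableSet_particleCount_eq hn t
  have hV := hX.measurable_vector n t
  have hd : Measurable fun y => ENNReal.ofReal (density n t y) :=
    ((measurable_density n).comp measurable_prodMk_left).ennreal_ofReal
  set μ := (P.restrict {ω | particleCount τ t ω = n}).map (fun ω (i : Fin n) => X t i ω) with hμ
  set ν := (volume : Measure (Fin n → ℝ)).withDensity (fun y => ENNReal.ofReal (density n t y))
    with hν
  have hμA : ∀ A, MeasurableSet A → μ A = P (positionEvent τ X n t A) := fun A hA => by
    rw [hμ, Measure.map_apply hV hA, Measure.restrict_apply (hV hA), Set.inter_comm]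
    rfl
  have hperm : ∀ σ : Equiv.Perm (Fin n), Measurable fun (y : Fin n → ℝ) i => y (σ i) := fun σ =>
    measurable_pi_lambda _ fun i => measurable_pi_apply _
  have hμν : μ = ν := by
    -- The weights know the particles only as an unordered set. The order is recovered from
    -- exchangeability on one side and from the symmetry of the density on the other.
    refine symmetric_measure_ext (fun σ A hA => ?_) (fun σ A hA => ?_) fun f hf => ?_
    · rw [hμA {y | (fun i => y (σ i)) ∈ A} (hperm σ hA), hμA _ hA]
      exact hX.exchangeable t ht n σ A hA
    · have hmp : MeasurePreserving (fun (y : Fin n → ℝ) i => y (σ i)) :=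
        (volume_measurePreserving_piCongrLeft (fun _ : Fin n => ℝ) σ).symm
      rw [hν, withDensity_apply _ hA, withDensity_apply _ (s := {y : Fin n → ℝ | (fun i => y (σ i)) ∈ A}) (hperm σ hA),
        ← hmp.setLIntegral_comp_preimage hA hd]
      simp only [density_perm]
      rfl
    · have hp : Measurable fun y : Fin n → ℝ => ∏ i, f (y i) :=
        Finset.measurable_fun_prod _ fun i _ => hf.comp (measurable_pi_apply i)
      rw [hμ, lintegral_map hp hV, ← lintegral_indicator hC,
        ← lintegral_congr_ae (hX.ae_weight_eq_prod f hn ht),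
        hX.driving.lintegral_weight hf hn ht hnt, generating, hν,
        lintegral_withDensity_eq_lintegral_mul _ hd hp]
      refine lintegral_congr fun y => ?_
      simp only [zero_add, Pi.mul_apply, mul_comm]
  rw [← hμA A hA, hμν, hν, withDensity_apply _ hA]

/-- Two or more particles at time `t` force the initial particle to have split by then, which has
probability `1 - e^(-t)`. Through the density formula this also bounds the `L¹` norm of the density.
-/
lemma measure_positionEvent_le (hX : IsBranchingBrownianMotion P τ B X) {n : ℕ} (hn : 2 ≤ n) {t : ℝ}
    (ht : 0 ≤ t) (A : Set (Fin n → ℝ)) :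
    P (positionEvent τ X n t A) ≤ ENNReal.ofReal (1 - Real.exp (-t)) := by
  have := isProbabilityMeasure_expMeasure one_pos
  have h1 := (hX.driving.lifetime_law []).measure_eq (p := fun x => x ≤ t) measurableSet_Iic
  have h2 : expMeasure 1 {x | x ≤ t} = ENNReal.ofReal (1 - Real.exp (-t)) := by
    have h3 := ofReal_cdf (expMeasure 1) t
    rw [cdf_expMeasure_eq one_pos, if_pos ht, one_mul] at h3
    exact h3.symm
  rw [← h2, ← h1]
  refine measure_mono_ae ?_
  filter_upwards [hX.driving.ae_lifetime_pos] with ω hpos hω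
  by_contra hτ
  have h3 : alive (fun v => τ v ω) t = {[]} :=
    alive_before_split (fun v => (hpos v).le) ht (not_le.1 hτ)
  have h4 : particleCount τ t ω = n := hω.1
  rw [particleCount, count, h3, Set.ncard_singleton] at h4
  omega

lemma measure_positionEvent_zero (hX : IsBranchingBrownianMotion P τ B X) {A : Set (Fin 1 → ℝ)}
    (hA : MeasurableSet A) : P (positionEvent τ X 1 0 A) = Measure.dirac 0 A := by
  have := hX.driving.isProbabilityMeasure
  have hae : ∀ᵐ ω ∂P, ω ∈ positionEvent τ X 1 0 A ↔ (0 : Fin 1 → ℝ) ∈ A := by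
    filter_upwards [hX.driving.ae_lifetime_pos, hX.enumerates 0 le_rfl,
      (hX.driving.brownian []).eval_zero_ae_eq_zero] with ω hpos ⟨e, he, hXe⟩ hB
    have h3 : alive (fun v => τ v ω) 0 = {[]} :=
      alive_before_split (fun v => (hpos v).le) le_rfl (hpos [])
    have h4 : particleCount τ 0 ω = 1 := by rw [particleCount, count, h3, Set.ncard_singleton]
    have h5 : e 0 = [] := by
      have := he.mapsTo (show (0 : ℕ) ∈ Set.Iio (particleCount τ 0 ω) by rw [h4]; exact Nat.one_pos)
      rwa [h3] at this
    have h6 : X 0 0 ω = 0 := by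
      rw [hXe 0 (by rw [h4]; exact Nat.one_pos), h5]
      simpa [position, birthPlace, birthTime] using hB
    have h7 : (fun i : Fin 1 => X 0 i ω) = 0 := by
      funext i
      fin_cases i
      exact h6
    show particleCount τ 0 ω = 1 ∧ (fun i : Fin 1 => X 0 i ω) ∈ A ↔ _
    rw [h4, h7]
    simp
  by_cases h0 : (0 : Fin 1 → ℝ) ∈ A
  · rw [Measure.dirac_apply_of_mem h0, ← measure_univ (μ := P)]
    refine measure_congr ?_
    filter_upwards [hae] with ω hω
    exact propext ⟨fun _ => trivial, fun _ => hω.2 h0⟩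
  · rw [Measure.dirac_apply' _ hA, Set.indicator_of_notMem h0, measure_eq_zero_iff_ae_notMem]
    filter_upwards [hae] with ω hω hω'
    exact h0 (hω.1 hω')

lemma tendsto_integral_density (hX : IsBranchingBrownianMotion P τ B X) {n : ℕ} (hn : 2 ≤ n) :
    Tendsto (fun t : ℝ => ∫ y, density n t y) (𝓝[>] 0) (𝓝 0) := by
  have h1 : Tendsto (fun t : ℝ => 1 - Real.exp (-t)) (𝓝[>] 0) (𝓝 0) := by
    have : Continuous fun t : ℝ => 1 - Real.exp (-t) := by fun_prop
    simpa using (this.tendsto 0).mono_left nhdsWithin_le_nhds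
  refine squeeze_zero' ?_ ?_ h1
  · filter_upwards [self_mem_nhdsWithin] with t ht
    exact integral_nonneg fun y => density_nonneg (le_of_lt ht) y
  · filter_upwards [self_mem_nhdsWithin] with t ht
    have ht' : 0 ≤ t := le_of_lt ht
    have hm : Measurable (density n t) := (measurable_density n).comp measurable_prodMk_left
    rw [integral_eq_lintegral_of_nonneg_ae (Eventually.of_forall fun y => density_nonneg ht' y)
      hm.aestronglyMeasurable]
    refine ENNReal.toReal_le_of_le_ofReal (by simp [ht']) ?_
    rw [← setLIntegral_univ, ← hX.measure_positionEvent (by omega) ht' (by omega) .univ]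
    exact hX.measure_positionEvent_le hn ht' _

end IsBranchingBrownianMotion

end Law

/-- Rescaling by `√t` fixes the Gaussian and moves `t` into the argument of `φ`, so dominated
convergence applies. -/
lemma tendsto_integral_mul_density_one (φ : BoundedContinuousFunction (Fin 1 → ℝ) ℝ) :
    Tendsto (fun t : ℝ => ∫ y, φ y * density 1 t y) (𝓝[>] 0) (𝓝 (φ 0)) := by
  have hscale : ∀ t : ℝ, 0 < t → ∫ y, φ y * density 1 t y =
      Real.exp (-t) * ∫ u, φ (fun _ => √t * u) * heatKernel 1 u := by
    intro t ht
    have hs : 0 < √t := Real.sqrt_pos.2 ht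
    have h1 : ∫ y, φ y * density 1 t y = ∫ b, φ (fun _ => b) * (Real.exp (-t) * heatKernel t b) := by
      refine ((volume_preserving_funUnique (Fin 1) ℝ).symm.integral_comp
        (MeasurableEquiv.measurableEmbedding _) _).symm.trans ?_
      refine integral_congr_ae (Eventually.of_forall fun b => ?_)
      simp only [density, g_one, sub_neg_eq_add, zero_add]
      rfl
    have h2 := Measure.integral_comp_mul_left
      (fun b => φ (fun _ => b) * (Real.exp (-t) * heatKernel t b)) √t
    rw [abs_of_pos (inv_pos.2 hs), smul_eq_mul] at h2
    rw [h1, ← integral_const_mul]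
    have h3 : ∫ b, φ (fun _ => b) * (Real.exp (-t) * heatKernel t b) =
        √t * ∫ u, φ (fun _ => √t * u) * (Real.exp (-t) * heatKernel t (√t * u)) := by
      rw [h2, mul_inv_cancel_left₀ hs.ne']
    rw [h3, ← integral_const_mul]
    refine integral_congr_ae (Eventually.of_forall fun u => ?_)
    have h4 : √t * heatKernel t (√t * u) = heatKernel 1 u := by
      have e1 : √(2 * Real.pi * t) = √(2 * Real.pi) * √t := Real.sqrt_mul (by positivity) _
      have e2 : -(√t * u) ^ 2 / (2 * t) = -u ^ 2 / (2 * 1) := by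
        rw [mul_pow, Real.sq_sqrt ht.le]; field_simp
      rw [heatKernel, heatKernel, e1, e2, mul_one, mul_inv]
      field_simp
    beta_reduce
    rw [← h4]
    ring
  have hlim : Tendsto (fun t : ℝ => ∫ u, φ (fun _ => √t * u) * heatKernel 1 u) (𝓝[>] 0)
      (𝓝 (∫ u, φ 0 * heatKernel 1 u)) := by
    refine tendsto_integral_filter_of_dominated_convergence (fun u => ‖φ‖ * heatKernel 1 u) ?_ ?_ ?_ ?_
    · refine Eventually.of_forall fun t => Measurable.aestronglyMeasurable ?_
      refine Measurable.mul (φ.continuous.measurable.comp ?_) (by fun_prop)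
      exact measurable_pi_lambda _ fun _ => by fun_prop
    · refine Eventually.of_forall fun t => Eventually.of_forall fun u => ?_
      rw [norm_mul, Real.norm_of_nonneg (heatKernel_nonneg 1 u)]
      exact mul_le_mul_of_nonneg_right (φ.norm_coe_le_norm _) (heatKernel_nonneg 1 u)
    · exact (integrable_heatKernel one_pos).const_mul _
    · refine Eventually.of_forall fun u => Tendsto.mul_const _ ?_
      have hc : Continuous fun t : ℝ => φ (fun _ => √t * u) := by fun_prop
      have := (hc.tendsto 0).mono_left (nhdsWithin_le_nhds (s := Set.Ioi 0))
      simp only [Real.sqrt_zero, zero_mul] at this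
      exact this
  rw [integral_const_mul, integral_heatKernel one_pos, mul_one] at hlim
  have hexp : Tendsto (fun t : ℝ => Real.exp (-t)) (𝓝[>] 0) (𝓝 1) := by
    have : Continuous fun t : ℝ => Real.exp (-t) := by fun_prop
    simpa using (this.tendsto 0).mono_left (nhdsWithin_le_nhds (s := Set.Ioi 0))
  have := hexp.mul hlim
  rw [one_mul] at this
  refine this.congr' ?_
  filter_upwards [self_mem_nhdsWithin] with t ht
  exact (hscale t ht).symm

lemma integrableOn_duhamel_source {n : ℕ} (hn : 2 ≤ n) (t x : ℝ) (y : Fin n → ℝ) :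
    IntegrableOn (fun q : ℝ × ℝ => heatKernel (t - q.1) (x - q.2) * Real.exp q.1 *
      symTensorSum (fun k => g k q.1 q.2) n y) (Set.Ioc 0 t ×ˢ Set.univ) := by
  rw [IntegrableOn, prod_volume_restrict]
  refine ((isTame_source y ⟨0, by omega⟩).integrable t x).congr (Eventually.of_forall fun q => ?_)
  simp only [source, mul_assoc]

end BBM

theorem theorem1 {Ω : Type*} [MeasurableSpace Ω] (P : Measure Ω) [IsProbabilityMeasure P]
    (τ : List Bool → Ω → ℝ) (B : List Bool → ℝ≥0 → Ω → ℝ) (X : ℝ → ℕ → Ω → ℝ)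
    (hX : BBM.IsBranchingBrownianMotion P τ B X) :
    ∃ ρ : (n : ℕ) → ℝ → (Fin n → ℝ) → ℝ,
      -- `ρ n t` is the density of the positions on the event `n(t) = n`
      (∀ n : ℕ, 1 ≤ n → ∀ t : ℝ, 0 ≤ t → (n = 1 → 0 < t) →
        Measurable (ρ n t) ∧ (∀ y, 0 ≤ ρ n t y) ∧
        ∀ A : Set (Fin n → ℝ), MeasurableSet A →
          P (BBM.positionEvent τ X n t A) = ∫⁻ y in A, ENNReal.ofReal (ρ n t y)) ∧
      -- the system of equations, with the operator as the square of `∂_1 + ⋯ + ∂_n`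
      (∀ n : ℕ, 1 ≤ n → ∀ t : ℝ, 0 < t → ∀ y : Fin n → ℝ,
        ContDiff ℝ 2 (fun h : ℝ => ρ n t (fun i => y i + h)) ∧
        HasDerivAt (fun s : ℝ => ρ n s y)
          (1 / 2 * iteratedDeriv 2 (fun h : ℝ => ρ n t (fun i => y i + h)) 0
            + BBM.symTensorSum (fun k => ρ k t) n y - ρ n t y) t) ∧
      -- the system of equations, with the individual second partial derivatives
      (∀ n : ℕ, 1 ≤ n → ∀ t : ℝ, 0 < t → ∀ y : Fin n → ℝ, Function.Injective y →
        ContDiffAt ℝ 2 (ρ n t) y ∧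
        HasDerivAt (fun s : ℝ => ρ n s y)
          (1 / 2 * ∑ k : Fin n, ∑ l : Fin n,
              BBM.partialDeriv k (BBM.partialDeriv l (ρ n t)) y
            + BBM.symTensorSum (fun k => ρ k t) n y - ρ n t y) t) ∧
      -- the initial condition for `n = 1`, at time zero and as a limit
      (∀ A : Set (Fin 1 → ℝ), MeasurableSet A →
        P (BBM.positionEvent τ X 1 0 A) = Measure.dirac 0 A) ∧
      (∀ φ : BoundedContinuousFunction (Fin 1 → ℝ) ℝ,
        Tendsto (fun t : ℝ => ∫ y, φ y * ρ 1 t y) (𝓝[>] 0) (𝓝 (φ 0))) ∧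
      -- the initial condition for `n ≥ 2`, at time zero and as a limit in `L¹`
      (∀ n : ℕ, 2 ≤ n → (∀ y, ρ n 0 y = 0) ∧
        Tendsto (fun t : ℝ => ∫ y, ρ n t y) (𝓝[>] 0) (𝓝 0)) ∧
      -- the representation, and the convergence of the integrals that define `g`
      (∀ n : ℕ, 1 ≤ n → ∀ t : ℝ, 0 ≤ t → (n = 1 → 0 < t) → ∀ (x : ℝ) (y : Fin n → ℝ),
        ρ n t y = BBM.g n t x (fun i => x - y i)) ∧
      (∀ n : ℕ, 2 ≤ n → ∀ t : ℝ, 0 ≤ t → ∀ (x : ℝ) (y : Fin n → ℝ),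
        IntegrableOn (fun q : ℝ × ℝ => BBM.heatKernel (t - q.1) (x - q.2) * Real.exp q.1 *
          BBM.symTensorSum (fun k => BBM.g k q.1 q.2) n y)
          (Set.Ioc 0 t ×ˢ Set.univ)) := by
  refine ⟨BBM.density, fun n hn t ht hnt => ⟨?_, BBM.density_nonneg ht, fun A hA => ?_⟩,
    fun n hn t ht y => BBM.density_diagonal_equation hn ht y, fun n hn t ht y hy => ?_,
    fun A hA => hX.measure_positionEvent_zero hA, BBM.tendsto_integral_mul_density_one,
    fun n hn => ⟨fun y => BBM.g_zero_time hn _ _, hX.tendsto_integral_density hn⟩,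
    fun n _ t _ _ x y => BBM.density_eq_g n t x y,
    fun n hn t _ x y => BBM.integrableOn_duhamel_source hn t x y⟩
  · exact (BBM.measurable_density n).comp measurable_prodMk_left
  · exact hX.measure_positionEvent hn ht hnt hA
  -- Away from coincidences the density is `C²`, so the second diagonal derivative expands into the
  -- individual partial derivatives.
  · have hc := BBM.contDiffAt_density hn ht hy
    refine ⟨hc, ?_⟩
    rw [BBM.sum_partialDeriv_partialDeriv hc]
    exact (BBM.density_diagonal_equation hn ht y).2
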